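/- Let $\Sigma$ be a finite alphabet and $R$ an arbitrary set (of weights). **Weighted automata.** An $R$-weighted automaton over $\Sigma$ is a tuple $\mathcal A=(Q,\Sigma,\Delta,\mathrm{wgt},I,F)$ with a finite set $Q$ of states, transitions $\Delta\subseteq Q\times\Sigma\times Q$, a weight function $\mathrm{wgt}\colon\Delta\to R$, and sets $I,F\subseteq Q$ of initial and final states. A run from $p$ to $q$ with label $a_1\cdots a_n\in\Sigma^+$ is a sequence of transitions $\delta_1\cdots\delta_n$, $\delta_i=(p_i,a_i,q_i)\in\Delta$, with $p_1=p$, $q_n=q$ and $q_i=p_{i+1}$ for $1\le i<n$; its weight sequence is $\mathrm{wgt}(\delta_1)\cdots\mathrm{wgt}(\delta_n)\in R^+$. It is successful if $p\in I$ and $q\in F$. The abstract semantics of $\mathcal A$ maps each $u\in\Sigma^+$ to the finite multiset $\{\!|\mathcal A|\!\}(u)$ of the weight sequences of all successful runs with label $u$ (one occurrence for each run). The automaton is *aperiodic* if there is an integer $m\ge1$ such that for all $p,q\in Q$ and all $u\in\Sigma^+$ there is a run from $p$ to $q$ with label $u^m$ if and only if there is one with label $u^{m+1}$. It is *polynomially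 ambiguous* if there is a polynomial $P$ such that each $w\in\Sigma^+$ labels at most $P(|w|)$ successful runs, *finitely ambiguous* if $P$ can be taken constant, and *unambiguous* if each $w\in\Sigma^+$ labels at most one successful run. **Weighted first-order logic.** The formulas $\varphi$ of $\mathsf{FO}$, $\Psi$ of $\mathsf{step\text{-}wFO}$ and $\Phi$ of $\mathsf{wFO}$ are given by $$\varphi::=\top\mid P_a(x)\mid x\le y\mid\neg\varphi\mid\varphi\wedge\varphi\mid\forall x\,\varphi,\qquad \Psi::=r\mid\varphi\,?\,\Psi:\Psi,\qquad \Phi::=\mathbf 0\mid\textstyle\prod_x\Psi\mid\varphi\,?\,\Phi:\Phi\mid\Phi+\Phi\mid\sum_x\Phi,$$ with $a\in\Sigma$, $r\in R$ and first-order variables $x,y$. Given $u\in\Sigma^+$ and a valuation $\sigma$ of the variables by positions in $\{1,\dots,|u|\}$, $\mathsf{FO}$ has its usual semantics on words ($P_a(x)$ says that position $x$ of $u$ carries the letter $a$); the value of $r$ is $r$, and $\varphi\,?\,X_1:X_2$ has the value of $X_1$ if $u,\sigma\models\varphi$ and that of $X_2$ otherwise, both for step formulas and for $\mathsf{wFO}$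 formulas; $\mathbf 0$ has as value the empty multiset; $\prod_x\Psi$ has as value the singleton multiset containing the sequence $r_1\cdots r_{|u|}$, where $r_i$ is the value of $\Psi$ at $(u,\sigma[x\mapsto i])$; the value of $\Phi_1+\Phi_2$ is the multiset union of the two values; and the value of $\sum_x\Phi$ is the multiset union of the values of $\Phi$ at $(u,\sigma[x\mapsto i])$ over $1\le i\le|u|$. A $\mathsf{wFO}$ sentence is a $\mathsf{wFO}$ formula $\Phi$ without free variables; its semantics $\{\!|\Phi|\!\}$ maps words $u\in\Sigma^+$ to finite multisets over $R^+$. **Theorem.** The following classes define the same functions from $\Sigma^+$ to finite multisets over $R^+$; that is, for each automaton of the first class there is a sentence of the second class with the same semantics, and conversely: 1. aperiodic polynomially ambiguous $R$-weighted automata over $\Sigma$, and $\mathsf{wFO}$ sentences; 2. aperiodic finitely ambiguous $R$-weighted automata over $\Sigma$, and $\mathsf{wFO}$ sentences in which no first-order sum $\sum_x$ occurs; 3. aperiodic unambiguous $R$-weighted automata over $\Sigma$, and $\mathsf{wFO}$ sentences in which neither a binary sum $+$ nor a first-order sum $\sum_x$ occurs. -/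

import Mathlib

/-! ### Weighted automata over a set `R` of weights -/

/-- An `R`-weighted automaton `(Q, Σ, Δ, wgt, I, F)` over the alphabet `α`, with a finite set of
states. The weight function is defined on the transitions only. -/
structure WAutomaton (α : Type*) (R : Type*) where
  /-- the states -/
  State : Type
  /-- there are finitely many states -/
  finite_state : Finite State
  /-- the transitions -/
  Δ : Set (State × α × State)
  /-- the weight of a transition -/
  wgt : Δ → R
  /-- the initial states -/
  init : Set State
  /-- the final states -/
  final : Set State

attribute [instance] WAutomaton.finite_state

namespace WAutomaton

variable {α R : Type*} (A : WAutomaton α R)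

/-- `A.IsRun p ρ q`: the sequence of transitions `ρ` is a run of `A` from `p` to `q`; the empty
sequence is a run from each state to itself. -/
def IsRun : A.State → List A.Δ → A.State → Prop
  | p, [], q => p = q
  | p, δ :: ρ, q => δ.1.1 = p ∧ IsRun δ.1.2.2 ρ q

/-- The word read by a sequence of transitions. -/
def label (ρ : List A.Δ) : List α := ρ.map fun δ => δ.1.2.1

/-- The weight sequence of a sequence of transitions. -/
def weight (ρ : List A.Δ) : List R := ρ.map A.wgt

/-- The runs from `p` to `q` with label `u`. -/
def runs (p q : A.State) (u : List α) : Set (List A.Δ) :=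
  {ρ | A.IsRun p ρ q ∧ A.label ρ = u}

/-- The runs with label `u` from some initial to some final state. -/
def successfulRuns (u : List α) : Set (List A.Δ) :=
  {ρ | ∃ p ∈ A.init, ∃ q ∈ A.final, ρ ∈ A.runs p q u}

/-- The set of labels of runs from `p` to `q`. -/
def lang (p q : A.State) : Set (List α) := {u | (A.runs p q u).Nonempty}

/-- Aperiodicity of the underlying non-deterministic automaton; `u ^ m` is written as the
concatenation of `m` copies of `u`. -/
def Aperiodic : Prop :=
  ∃ m : ℕ, 1 ≤ m ∧ ∀ (p q : A.State) (u : List α), u ≠ [] →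
    ((List.replicate m u).flatten ∈ A.lang p q ↔ (List.replicate (m + 1) u).flatten ∈ A.lang p q)

/-- The number of successful runs on a nonempty word is bounded by a polynomial in its length. -/
def PolynomiallyAmbiguous : Prop :=
  ∃ P : Polynomial ℕ, ∀ w : List α, w ≠ [] → (A.successfulRuns w).encard ≤ P.eval w.length

/-- The number of successful runs on a nonempty word is bounded by a constant. -/
def FinitelyAmbiguous : Prop :=
  ∃ k : ℕ, ∀ w : List α, w ≠ [] → (A.successfulRuns w).encard ≤ k

/-- Each nonempty word has at most one successful run. -/
def Unambiguous : Prop :=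
  ∀ w : List α, w ≠ [] → (A.successfulRuns w).encard ≤ 1

theorem finite_runs [Finite α] (p q : A.State) (u : List α) : (A.runs p q u).Finite := by
  refine (List.finite_length_eq A.Δ u.length).subset ?_
  rintro ρ ⟨-, h⟩
  simp [← h, label]

/-- The abstract semantics of `A` from `p` to `q`: the multiset of the weight sequences of the
runs from `p` to `q` with label `u`, each run counted once. -/
noncomputable def usemFrom [Finite α] (p q : A.State) (u : List α) : Multiset (List R) :=
  (A.finite_runs p q u).toFinset.val.map A.weight

/-- The abstract semantics of `A` on nonempty words: the multiset union of the semantics from `p`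
to `q` over all initial `p` and final `q`. -/
noncomputable def usem [Finite α] (u : {u : List α // u ≠ []}) : Multiset (List R) :=
  ∑ p ∈ A.init.toFinite.toFinset, ∑ q ∈ A.final.toFinite.toFinset, A.usemFrom p q u.1

end WAutomaton

/-! ### First-order logic on words; the first-order variables are the natural numbers -/

/-- First-order formulas: `⊤`, `P_a(x)`, `x ≤ y`, `¬ φ`, `φ ∧ ψ`, `∀ x φ`. -/
inductive FOFormula (α : Type*) where
  | top : FOFormula α
  | letter (a : α) (x : ℕ) : FOFormula α
  | le (x y : ℕ) : FOFormula α
  | not (φ : FOFormula α) : FOFormula α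
  | and (φ ψ : FOFormula α) : FOFormula α
  | all (x : ℕ) (φ : FOFormula α) : FOFormula α

namespace FOFormula

variable {α : Type*}

/-- The free variables. -/
def freeVars : FOFormula α → Finset ℕ
  | top => ∅
  | letter _ x => {x}
  | le x y => {x, y}
  | not φ => φ.freeVars
  | and φ ψ => φ.freeVars ∪ ψ.freeVars
  | all x φ => φ.freeVars.erase x

/-- `φ.Sat u σ` is `u, σ ⊨ φ`, where `σ` assigns positions of `u` to the variables. -/
def Sat (u : List α) : FOFormula α → (ℕ → Fin u.length) → Prop
  | top, _ => True
  | letter a x, σ => u.get (σ x) = a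
  | le x y, σ => σ x ≤ σ y
  | not φ, σ => ¬ φ.Sat u σ
  | and φ ψ, σ => φ.Sat u σ ∧ ψ.Sat u σ
  | all x φ, σ => ∀ i : Fin u.length, φ.Sat u (Function.update σ x i)

end FOFormula

/-! ### Weighted first-order logic -/

/-- Step formulas: constants `r` and `φ ? Ψ₁ : Ψ₂`. -/
inductive StepWFO (α : Type*) (R : Type*) where
  | const (r : R) : StepWFO α R
  | ite (φ : FOFormula α) (Ψ₁ Ψ₂ : StepWFO α R) : StepWFO α R

namespace StepWFO

variable {α R : Type*}

/-- The free variables. -/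
def freeVars : StepWFO α R → Finset ℕ
  | const _ => ∅
  | ite φ Ψ₁ Ψ₂ => φ.freeVars ∪ Ψ₁.freeVars ∪ Ψ₂.freeVars

open Classical in
/-- The semantics of a step formula, a single weight. -/
noncomputable def sem (u : List α) : StepWFO α R → (ℕ → Fin u.length) → R
  | const r, _ => r
  | ite φ Ψ₁ Ψ₂, σ => if φ.Sat u σ then Ψ₁.sem u σ else Ψ₂.sem u σ

end StepWFO

/-- wFO formulas: `0`, `∏ₓ Ψ`, `φ ? Φ₁ : Φ₂`, `Φ₁ + Φ₂`, `∑ₓ Φ`. -/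
inductive WFO (α : Type*) (R : Type*) where
  | zero : WFO α R
  | prod (x : ℕ) (Ψ : StepWFO α R) : WFO α R
  | ite (φ : FOFormula α) (Φ₁ Φ₂ : WFO α R) : WFO α R
  | add (Φ₁ Φ₂ : WFO α R) : WFO α R
  | sum (x : ℕ) (Φ : WFO α R) : WFO α R

namespace WFO

variable {α R : Type*}

/-- The free variables. -/
def freeVars : WFO α R → Finset ℕ
  | zero => ∅
  | prod x Ψ => Ψ.freeVars.erase x
  | ite φ Φ₁ Φ₂ => φ.freeVars ∪ Φ₁.freeVars ∪ Φ₂.freeVars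
  | add Φ₁ Φ₂ => Φ₁.freeVars ∪ Φ₂.freeVars
  | sum x Φ => Φ.freeVars.erase x

/-- A sentence has no free variables. -/
def IsSentence (Φ : WFO α R) : Prop := Φ.freeVars = ∅

/-- No first-order sum `∑ₓ` occurs in the formula. -/
def NoFirstOrderSum : WFO α R → Prop
  | zero => True
  | prod _ _ => True
  | ite _ Φ₁ Φ₂ => Φ₁.NoFirstOrderSum ∧ Φ₂.NoFirstOrderSum
  | add Φ₁ Φ₂ => Φ₁.NoFirstOrderSum ∧ Φ₂.NoFirstOrderSum
  | sum _ _ => False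

/-- No binary sum `+` occurs in the formula. -/
def NoBinarySum : WFO α R → Prop
  | zero => True
  | prod _ _ => True
  | ite _ Φ₁ Φ₂ => Φ₁.NoBinarySum ∧ Φ₂.NoBinarySum
  | add _ _ => False
  | sum _ Φ => Φ.NoBinarySum

open Classical in
/-- The semantics of a wFO formula on a word `u` with a valuation `σ`. -/
noncomputable def sem (u : List α) : WFO α R → (ℕ → Fin u.length) → Multiset (List R)
  | zero, _ => 0
  | prod x Ψ, σ => {List.ofFn fun i : Fin u.length => Ψ.sem u (Function.update σ x i)}
  | ite φ Φ₁ Φ₂, σ => if φ.Sat u σ then Φ₁.sem u σ else Φ₂.sem u σ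
  | add Φ₁ Φ₂, σ => Φ₁.sem u σ + Φ₂.sem u σ
  | sum x Φ, σ => ∑ i : Fin u.length, Φ.sem u (Function.update σ x i)

/-- The semantics of a sentence on nonempty words. The valuation that sends every variable to the
first position is an arbitrary choice; by `sem_eq_usem` it does not matter for sentences. -/
noncomputable def usem (Φ : WFO α R) (u : {u : List α // u ≠ []}) : Multiset (List R) :=
  Φ.sem u.1 fun _ => ⟨0, List.length_pos_iff.2 u.2⟩

end WFO

theorem FOFormula.sat_congr {α : Type*} (u : List α) (φ : FOFormula α) :
    ∀ σ τ : ℕ → Fin u.length, (∀ x ∈ φ.freeVars, σ x = τ x) → (φ.Sat u σ ↔ φ.Sat u τ) := by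
  induction φ with
  | top => simp [Sat]
  | letter a x => intro σ τ h; simp only [Sat, h x (by simp [freeVars])]
  | le x y =>
    intro σ τ h
    simp only [Sat, h x (by simp [freeVars]), h y (by simp [freeVars])]
  | not φ ih => intro σ τ h; simp only [Sat, ih σ τ h]
  | and φ ψ ih₁ ih₂ =>
    intro σ τ h
    simp only [freeVars, Finset.mem_union] at h
    simp only [Sat, ih₁ σ τ (fun x hx => h x (.inl hx)), ih₂ σ τ (fun x hx => h x (.inr hx))]
  | all x φ ih =>
    intro σ τ h
    refine forall_congr' fun i => ih _ _ fun y hy => ?_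
    by_cases hyx : y = x
    · subst hyx; simp
    · simpa [hyx] using h y (Finset.mem_erase.2 ⟨hyx, hy⟩)

theorem StepWFO.sem_congr {α R : Type*} (u : List α) (Ψ : StepWFO α R) :
    ∀ σ τ : ℕ → Fin u.length, (∀ x ∈ Ψ.freeVars, σ x = τ x) → Ψ.sem u σ = Ψ.sem u τ := by
  induction Ψ with
  | const r => simp [sem]
  | ite φ Ψ₁ Ψ₂ ih₁ ih₂ =>
    intro σ τ h
    simp only [freeVars, Finset.mem_union] at h
    have hφ := φ.sat_congr u σ τ fun x hx => h x (.inl (.inl hx))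
    simp only [sem, ih₁ σ τ (fun x hx => h x (.inl (.inr hx))),
      ih₂ σ τ (fun x hx => h x (.inr hx))]
    by_cases hs : φ.Sat u τ
    · rw [if_pos hs, if_pos (hφ.2 hs)]
    · rw [if_neg hs, if_neg (mt hφ.1 hs)]

theorem WFO.sem_congr {α R : Type*} (u : List α) (Φ : WFO α R) :
    ∀ σ τ : ℕ → Fin u.length, (∀ x ∈ Φ.freeVars, σ x = τ x) → Φ.sem u σ = Φ.sem u τ := by
  have upd : ∀ (s : Finset ℕ) (x : ℕ) (σ τ : ℕ → Fin u.length) (i : Fin u.length),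
      (∀ y ∈ s.erase x, σ y = τ y) →
        ∀ y ∈ s, Function.update σ x i y = Function.update τ x i y := by
    intro s x σ τ i h y hy
    by_cases hyx : y = x
    · subst hyx; simp
    · simpa [hyx] using h y (Finset.mem_erase.2 ⟨hyx, hy⟩)
  induction Φ with
  | zero => simp [sem]
  | prod x Ψ =>
    intro σ τ h
    simp only [sem]
    congr 2
    funext i
    exact Ψ.sem_congr u _ _ (upd _ x σ τ i h)
  | ite φ Φ₁ Φ₂ ih₁ ih₂ =>
    intro σ τ h
    simp only [freeVars, Finset.mem_union] at h
    have hφ := φ.sat_congr u σ τ fun x hx => h x (.inl (.inl hx))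
    simp only [sem, ih₁ σ τ (fun x hx => h x (.inl (.inr hx))),
      ih₂ σ τ (fun x hx => h x (.inr hx))]
    by_cases hs : φ.Sat u τ
    · rw [if_pos hs, if_pos (hφ.2 hs)]
    · rw [if_neg hs, if_neg (mt hφ.1 hs)]
  | add Φ₁ Φ₂ ih₁ ih₂ =>
    intro σ τ h
    simp only [freeVars, Finset.mem_union] at h
    simp only [sem, ih₁ σ τ (fun x hx => h x (.inl hx)), ih₂ σ τ (fun x hx => h x (.inr hx))]
  | sum x Φ ih =>
    intro σ τ h
    simp only [sem]
    exact Finset.sum_congr rfl fun i _ => ih _ _ (upd _ x σ τ i h)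

/-- For a sentence the valuation is irrelevant. -/
theorem WFO.sem_eq_usem {α R : Type*} (Φ : WFO α R) (hΦ : Φ.IsSentence)
    (u : {u : List α // u ≠ []}) (σ : ℕ → Fin u.1.length) : Φ.sem u.1 σ = Φ.usem u :=
  Φ.sem_congr u.1 _ _ fun x hx => by
    rw [hΦ] at hx
    simp at hx

/-! ### Congruences of finite index with aperiodic quotient -/

universe u v w

/-- The concatenation of `n` copies of `x`. -/
def wordPow {B : Type*} (x : List B) (n : ℕ) : List B := (List.replicate n x).flatten

section WordPow

variable {B C : Type*}

theorem wordPow_zero (x : List B) : wordPow x 0 = [] := rfl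

theorem wordPow_succ (x : List B) (n : ℕ) : wordPow x (n + 1) = x ++ wordPow x n := by
  simp [wordPow, List.replicate_succ]

theorem wordPow_add (x : List B) (m n : ℕ) :
    wordPow x (m + n) = wordPow x m ++ wordPow x n := by
  rw [wordPow, List.replicate_add, List.flatten_append]; rfl

theorem wordPow_nil (n : ℕ) : wordPow ([] : List B) n = [] := by simp [wordPow]

theorem map_wordPow (g : B → C) (x : List B) (n : ℕ) :
    (wordPow x n).map g = wordPow (x.map g) n := by
  simp [wordPow, List.map_flatten]

theorem length_wordPow (x : List B) (n : ℕ) : (wordPow x n).length = n * x.length := by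
  simp [wordPow]

end WordPow

theorem apply_wordPow_of_le {B T : Type*} {f : List B → T}
    (hf : ∀ {x x' y : List B}, f x = f x' → f (x ++ y) = f (x' ++ y)) {x : List B} {N : ℕ}
    (hN : f (wordPow x N) = f (wordPow x (N + 1))) {n : ℕ} (hn : N ≤ n) :
    f (wordPow x n) = f (wordPow x (n + 1)) := by
  obtain ⟨k, rfl⟩ := Nat.exists_eq_add_of_le hn
  rw [Nat.add_right_comm, wordPow_add, wordPow_add]
  exact hf hN

/-- The kernel of `f` is a congruence on words, and the quotient is an aperiodic monoid. -/
structure AperiodicCongr {B : Type*} {T : Type*} (f : List B → T) : Prop where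
  append : ∀ {x x' y y' : List B}, f x = f x' → f y = f y' → f (x ++ y) = f (x' ++ y')
  exists_pow : ∃ N : ℕ, ∀ x : List B, f (wordPow x N) = f (wordPow x (N + 1))

namespace AperiodicCongr

variable {B C T T' : Type*} {f : List B → T}

theorem pow_of_le (hf : AperiodicCongr f) {N : ℕ}
    (hN : ∀ x : List B, f (wordPow x N) = f (wordPow x (N + 1))) {n : ℕ} (hn : N ≤ n)
    (x : List B) : f (wordPow x n) = f (wordPow x (n + 1)) :=
  apply_wordPow_of_le (fun h => hf.append h rfl) (hN x) hn

theorem comp_map (hf : AperiodicCongr f) (g : C → B) :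
    AperiodicCongr fun x : List C => f (x.map g) where
  append h h' := by simpa using hf.append h h'
  exists_pow := by
    obtain ⟨N, hN⟩ := hf.exists_pow
    exact ⟨N, fun x => by simpa [map_wordPow] using hN (x.map g)⟩

theorem comp_injective (hf : AperiodicCongr f) {g : T → T'} (hg : g.Injective) :
    AperiodicCongr fun x => g (f x) where
  append h h' := congrArg g (hf.append (hg h) (hg h'))
  exists_pow := by
    obtain ⟨N, hN⟩ := hf.exists_pow
    exact ⟨N, fun x => congrArg g (hN x)⟩

theorem prodMk (hf : AperiodicCongr f) {f' : List B → T'} (hf' : AperiodicCongr f') :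
    AperiodicCongr fun x => (f x, f' x) where
  append h h' := by
    simp only [Prod.mk.injEq] at h h' ⊢
    exact ⟨hf.append h.1 h'.1, hf'.append h.2 h'.2⟩
  exists_pow := by
    obtain ⟨N, hN⟩ := hf.exists_pow
    obtain ⟨N', hN'⟩ := hf'.exists_pow
    exact ⟨max N N', fun x => Prod.ext (hf.pow_of_le hN (le_max_left _ _) x)
      (hf'.pow_of_le hN' (le_max_right _ _) x)⟩

theorem pi {ι : Type*} [Finite ι] {T : ι → Type*} {f : ∀ i, List B → T i}
    (hf : ∀ i, AperiodicCongr (f i)) : AperiodicCongr fun x i => f i x where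
  append h h' := funext fun i => (hf i).append (congrFun h i) (congrFun h' i)
  exists_pow := by
    choose N hN using fun i => (hf i).exists_pow
    obtain ⟨M, hM⟩ := (Set.finite_range N).bddAbove
    exact ⟨M, fun x => funext fun i => (hf i).pow_of_le (hN i) (hM ⟨i, rfl⟩) x⟩

theorem append_append (hf : AperiodicCongr f) {x x' : List B} (h : f x = f x')
    (y z : List B) : f (y ++ x ++ z) = f (y ++ x' ++ z) :=
  hf.append (hf.append rfl h) rfl

end AperiodicCongr

/-! ### Projections -/

theorem exists_replicate_of_countP_le {B : Type*} (b : B) (N : ℕ) [DecidablePred fun c => c ≠ b] :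
    ∀ (k : ℕ) (l : List B), l.countP (fun c => c ≠ b) ≤ k → (k + 1) * N ≤ l.length →
      ∃ l₁ l₂, l = l₁ ++ List.replicate N b ++ l₂ := by
  intro k
  induction k with
  | zero =>
    intro l h hl
    have : l = List.replicate l.length b := by
      rw [List.eq_replicate_iff]
      refine ⟨rfl, fun c hc => ?_⟩
      have := List.countP_eq_zero.1 (Nat.le_zero.1 h) c hc
      simpa using this
    refine ⟨[], List.replicate (l.length - N) b, ?_⟩
    rw [List.nil_append, ← List.replicate_add, Nat.add_sub_cancel' (by lia)]
    exact this
  | succ k ih =>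
    intro l h hl
    by_cases h0 : (l.take N).countP (fun c => c ≠ b) = 0
    · refine ⟨[], l.drop N, ?_⟩
      have : l.take N = List.replicate N b := by
        rw [List.eq_replicate_iff]
        refine ⟨List.length_take_of_le (by nlinarith), fun c hc => ?_⟩
        have := List.countP_eq_zero.1 h0 c hc
        simpa using this
      rw [List.nil_append, ← this, List.take_append_drop]
    · have hs : l.countP (fun c => c ≠ b) =
          (l.take N).countP (fun c => c ≠ b) + (l.drop N).countP (fun c => c ≠ b) := by
        rw [← List.countP_append, List.take_append_drop]
      obtain ⟨l₁, l₂, hl₁⟩ := ih (l.drop N) (by lia) (by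
        rw [List.length_drop]
        have : (k + 1 + 1) * N = (k + 1) * N + N := by ring
        lia)
      refine ⟨l.take N ++ l₁, l₂, ?_⟩
      conv_lhs => rw [← List.take_append_drop N l, hl₁]
      simp

section Project

variable {B B' T : Type*} (f : List B' → T) (π : B' → B) (emb : B → B') (k : ℕ)

open Classical in
/-- The number of letters of a word over `B'` outside of the section `emb`. -/
noncomputable def markCount (y : List B') : ℕ := y.countP fun b => emb (π b) ≠ b

/-- The values of `f` at the preimages of a word under `π`, sorted by the number of letters
outside of the section `emb`, up to the bound `k`. -/
def projectClasses (x : List B) : Fin (k + 1) → Set T := fun j =>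
  {t | ∃ y : List B', y.map π = x ∧ markCount π emb y = j ∧ f y = t}

variable {f π emb k}

theorem markCount_append (y z : List B') :
    markCount π emb (y ++ z) = markCount π emb y + markCount π emb z := by
  simp [markCount]

theorem markCount_map_emb (h : ∀ b, π (emb b) = b) (x : List B) :
    markCount π emb (x.map emb) = 0 := by
  simp [markCount, h]

theorem markCount_eq_zero_iff {y : List B'} :
    markCount π emb y = 0 ↔ y = (y.map π).map emb := by
  induction y with
  | nil => simp [markCount]
  | cons b y ih =>
    simp only [markCount, List.countP_cons] at ih ⊢
    by_cases hb : emb (π b) = b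
    · simpa [hb] using ih
    · have : b ≠ emb (π b) := fun h => hb h.symm
      simp [hb, this]

theorem projectClasses_append_subset (hf : AperiodicCongr f) {x x' y y' : List B}
    (hx : projectClasses f π emb k x = projectClasses f π emb k x')
    (hy : projectClasses f π emb k y = projectClasses f π emb k y') (j : Fin (k + 1)) :
    projectClasses f π emb k (x ++ y) j ⊆ projectClasses f π emb k (x' ++ y') j := by
  rintro t ⟨z, hz, hj, rfl⟩
  obtain ⟨z₁, z₂, rfl, rfl, rfl⟩ := List.map_eq_append_iff.1 hz
  rw [markCount_append] at hj
  have h₁ : f z₁ ∈ projectClasses f π emb k (z₁.map π) ⟨markCount π emb z₁, by lia⟩ :=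
    ⟨z₁, rfl, rfl, rfl⟩
  have h₂ : f z₂ ∈ projectClasses f π emb k (z₂.map π) ⟨markCount π emb z₂, by lia⟩ :=
    ⟨z₂, rfl, rfl, rfl⟩
  rw [hx] at h₁
  rw [hy] at h₂
  obtain ⟨w₁, hw₁, hc₁, he₁⟩ := h₁
  obtain ⟨w₂, hw₂, hc₂, he₂⟩ := h₂
  refine ⟨w₁ ++ w₂, by simp [hw₁, hw₂], ?_, hf.append he₁ he₂⟩
  rw [markCount_append]
  simp only at hc₁ hc₂
  lia

/-- A preimage of a power is the concatenation of preimages of the base. -/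
theorem exists_blocks_of_map_eq_wordPow {x : List B} :
    ∀ (n : ℕ) (y : List B'), y.map π = wordPow x n →
      ∃ l : List (List B'), l.length = n ∧ l.flatten = y ∧ ∀ z ∈ l, z.map π = x := by
  intro n
  induction n with
  | zero => intro y hy; exact ⟨[], by simpa [wordPow, eq_comm] using hy⟩
  | succ n ih =>
    intro y hy
    rw [wordPow_succ] at hy
    obtain ⟨y₁, y₂, rfl, h₁, h₂⟩ := List.map_eq_append_iff.1 hy
    obtain ⟨l, hl, hl', hl''⟩ := ih y₂ h₂
    exact ⟨y₁ :: l, by simp [hl], by simp [hl'], by simpa using ⟨h₁, hl''⟩⟩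

open Classical in
theorem countP_ne_le_markCount {x : List B} (l : List (List B'))
    (hl : ∀ z ∈ l, z.map π = x) :
    l.countP (fun z => z ≠ x.map emb) ≤ markCount π emb l.flatten := by
  induction l with
  | nil => simp
  | cons z l ih =>
    rw [List.flatten_cons, markCount_append, List.countP_cons]
    have h1 := ih fun z' hz' => hl z' (by simp [hz'])
    have h2 : z ≠ x.map emb → 1 ≤ markCount π emb z := by
      intro hz
      by_contra h0
      have := (markCount_eq_zero_iff (emb := emb)).1 (by lia : markCount π emb z = 0)
      rw [hl z (by simp)] at this
      exact hz this
    by_cases hz : z = x.map emb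
    · simp [hz]; simp at h1; lia
    · have := h2 hz
      simp [hz]; simp at h1; lia

theorem AperiodicCongr.projectClasses (hf : AperiodicCongr f) (hπ : ∀ b, π (emb b) = b) (k : ℕ) :
    AperiodicCongr (projectClasses f π emb k) where
  append hx hy := funext fun j => Set.Subset.antisymm
    (projectClasses_append_subset hf hx hy j) (projectClasses_append_subset hf hx.symm hy.symm j)
  exists_pow := by
    classical
    obtain ⟨N, hN⟩ := hf.exists_pow
    have key : ∀ (x : List B) (n : ℕ) (j : Fin (k + 1)) (y : List B'), (k + 1) * (N + 1) ≤ n →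
        y.map π = wordPow x n → markCount π emb y = j → ∃ y₁ y₂ : List B', ∃ a b : ℕ,
          n = a + (N + 1) + b ∧ y = y₁ ++ wordPow (x.map emb) (N + 1) ++ y₂ ∧
          y₁.map π = wordPow x a ∧ y₂.map π = wordPow x b := by
      intro x n j y hn hy hj
      obtain ⟨l, hl, rfl, hl'⟩ := exists_blocks_of_map_eq_wordPow n y hy
      obtain ⟨l₁, l₂, rfl⟩ := exists_replicate_of_countP_le (x.map emb) (N + 1) k l
        ((countP_ne_le_markCount l hl').trans (by lia)) (by lia)
      have hpow : ∀ m : List (List B'), (∀ z ∈ m, z.map π = x) →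
          m.flatten.map π = wordPow x m.length := by
        intro m hm
        induction m with
        | nil => rfl
        | cons z m ih =>
          rw [List.flatten_cons, List.map_append, List.length_cons, wordPow_succ,
            ih fun z' hz' => hm z' (by simp [hz']), hm z (by simp)]
      refine ⟨l₁.flatten, l₂.flatten, l₁.length, l₂.length, ?_, ?_, ?_, ?_⟩
      · simpa [add_assoc] using hl.symm
      · simp [wordPow]
      · exact hpow _ fun z hz => hl' z (by simp [hz])
      · exact hpow _ fun z hz => hl' z (by simp [hz])
    refine ⟨(k + 1) * (N + 1), fun x => funext fun j => Set.Subset.antisymm ?_ ?_⟩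
    · rintro t ⟨y, hy, hj, rfl⟩
      obtain ⟨y₁, y₂, a, b, hab, rfl, h₁, h₂⟩ := key x _ j y le_rfl hy hj
      refine ⟨y₁ ++ wordPow (x.map emb) (N + 1 + 1) ++ y₂, ?_, ?_, ?_⟩
      · rw [hab, show a + (N + 1) + b + 1 = a + (N + 1 + 1) + b by ring]
        simp [h₁, h₂, map_wordPow, wordPow_add, Function.comp_def, hπ]
      · rw [← hj]
        simp only [markCount_append, ← map_wordPow, markCount_map_emb hπ]
      · exact hf.append_append (hf.pow_of_le hN (Nat.le_succ N) _).symm _ _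
    · rintro t ⟨y, hy, hj, rfl⟩
      obtain ⟨y₁, y₂, a, b, hab, rfl, h₁, h₂⟩ := key x _ j y (Nat.le_succ _) hy hj
      refine ⟨y₁ ++ wordPow (x.map emb) N ++ y₂, ?_, ?_, ?_⟩
      · rw [show (k + 1) * (N + 1) = a + N + b by lia]
        simp [h₁, h₂, map_wordPow, wordPow_add, Function.comp_def, hπ]
      · rw [← hj]
        simp only [markCount_append, ← map_wordPow, markCount_map_emb hπ]
      · exact hf.append_append (hN _) _ _

end Project

/-! ### Words with a valuation -/

/-- A nonempty word together with a valuation of the variables `V` by its positions. -/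
structure PointedWord (α : Type u) (V : Type) where
  /-- the word -/
  word : List α
  /-- the word is nonempty -/
  ne : word ≠ []
  /-- the valuation -/
  val : V → Fin word.length

namespace PointedWord

variable {α : Type u} {V V' : Type}

/-- Substitution of variables. -/
def subst (p : PointedWord α V') (s : V → V') : PointedWord α V :=
  ⟨p.word, p.ne, fun x => p.val (s x)⟩

/-- The extension of the valuation to one more variable `none`. -/
def extend (p : PointedWord α V) (i : Fin p.word.length) : PointedWord α (Option V) :=
  ⟨p.word, p.ne, fun o => o.elim i p.val⟩

/-- The word over the extended alphabet which encodes the valuation. -/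
def mark (p : PointedWord α V) : List (α × Set V) :=
  List.ofFn fun i => (p.word.get i, {x | p.val x = i})

/-- The first position. -/
def first (p : PointedWord α V) : Fin p.word.length := ⟨0, List.length_pos_iff.2 p.ne⟩

theorem length_mark (p : PointedWord α V) : p.mark.length = p.word.length := by simp [mark]

theorem getElem_mark (p : PointedWord α V) (i : ℕ) (hi : i < p.mark.length) :
    p.mark[i] = (p.word[i]'(p.length_mark ▸ hi),
      {x | p.val x = ⟨i, p.length_mark ▸ hi⟩}) := by
  simp [mark]

theorem mark_map_fst (p : PointedWord α V) : p.mark.map Prod.fst = p.word := by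
  simp [mark, List.map_ofFn, Function.comp_def]

theorem mark_subst (p : PointedWord α V') (s : V → V') :
    (p.subst s).mark = p.mark.map fun b => (b.1, s ⁻¹' b.2) := by
  simp [mark, List.map_ofFn, Function.comp_def, subst]

@[simp] theorem extend_word (p : PointedWord α V) (i : Fin p.word.length) :
    (p.extend i).word = p.word := rfl

theorem ext_val {u : List α} (h h' : u ≠ []) {σ τ : V → Fin u.length} (hst : ∀ x, σ x = τ x) :
    (⟨u, h, σ⟩ : PointedWord α V) = ⟨u, h', τ⟩ := by
  obtain rfl : σ = τ := funext hst
  rfl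

end PointedWord

open PointedWord

/-! ### Recognizable functions of pointed words -/

/-- `F` factors through the quotient by an aperiodic congruence of finite index. -/
def Rec {α : Type u} {V : Type} {X : Type*} (F : PointedWord α V → X) : Prop :=
  ∃ (n : ℕ) (f : List (α × Set V) → Fin n), AperiodicCongr f ∧
    ∀ p q : PointedWord α V, f p.mark = f q.mark → F p = F q

namespace Rec

variable {α : Type u} {V V' : Type} {X Y : Type*}

theorem of_aperiodicCongr {T : Type*} [Finite T] {f : List (α × Set V) → T}
    (hf : AperiodicCongr f) {F : PointedWord α V → X}
    (h : ∀ p q : PointedWord α V, f p.mark = f q.mark → F p = F q) : Rec F := by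
  obtain ⟨n, ⟨e⟩⟩ := Finite.exists_equiv_fin T
  exact ⟨n, fun x => e (f x), hf.comp_injective e.injective,
    fun p q hpq => h p q (e.injective hpq)⟩

theorem comp {F : PointedWord α V → X} (hF : Rec F) (g : X → Y) : Rec fun p => g (F p) := by
  obtain ⟨n, f, hf, h⟩ := hF
  exact ⟨n, f, hf, fun p q hpq => congrArg g (h p q hpq)⟩

theorem prodMk {F : PointedWord α V → X} (hF : Rec F) {G : PointedWord α V → Y} (hG : Rec G) :
    Rec fun p => (F p, G p) := by
  obtain ⟨n, f, hf, h⟩ := hF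
  obtain ⟨m, g, hg, h'⟩ := hG
  refine of_aperiodicCongr (hf.prodMk hg) fun p q hpq => ?_
  simp only [Prod.mk.injEq] at hpq
  rw [h p q hpq.1, h' p q hpq.2]

theorem pi {ι : Type*} [Finite ι] {X : ι → Type*} {F : ∀ i, PointedWord α V → X i}
    (hF : ∀ i, Rec (F i)) : Rec fun p i => F i p := by
  choose n f hf h using hF
  exact of_aperiodicCongr (AperiodicCongr.pi hf)
    fun p q hpq => funext fun i => h i p q (congrFun hpq i)

theorem const (x : X) : Rec fun _ : PointedWord α V => x :=
  of_aperiodicCongr (T := Unit) (f := fun _ => ()) ⟨fun _ _ => rfl, 0, fun _ => rfl⟩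
    fun _ _ _ => rfl

theorem subst {F : PointedWord α V → X} (hF : Rec F) (s : V → V') :
    Rec fun p : PointedWord α V' => F (p.subst s) := by
  obtain ⟨n, f, hf, h⟩ := hF
  refine of_aperiodicCongr (hf.comp_map fun b : α × Set V' => (b.1, s ⁻¹' b.2)) fun p q hpq => ?_
  exact h _ _ (by simpa only [mark_subst] using hpq)

theorem ite {P : PointedWord α V → Prop} (hP : Rec P) [DecidablePred P] {F G : PointedWord α V → X}
    (hF : Rec F) (hG : Rec G) : Rec fun p => if P p then F p else G p := by
  classical
  have := ((hP.prodMk hF).prodMk hG).comp fun x => if x.1.1 then x.1.2 else x.2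
  convert this using 3

theorem not {P : PointedWord α V → Prop} (hP : Rec P) : Rec fun p => ¬ P p := hP.comp Not

theorem and {P Q : PointedWord α V → Prop} (hP : Rec P) (hQ : Rec Q) :
    Rec fun p => P p ∧ Q p := (hP.prodMk hQ).comp fun x => x.1 ∧ x.2

/-- Erases the mark `none`. -/
def eraseNone (b : α × Set (Option V)) : α × Set V := (b.1, some ⁻¹' b.2)

/-- Regards a letter as one without the mark `none`. -/
def embSome (b : α × Set V) : α × Set (Option V) := (b.1, some '' b.2)

theorem eraseNone_embSome (b : α × Set V) : eraseNone (embSome b) = b := by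
  simp [eraseNone, embSome, Set.preimage_image_eq _ (Option.some_injective V)]

theorem embSome_eraseNone_ne {b : α × Set (Option V)} :
    embSome (eraseNone b) ≠ b ↔ none ∈ b.2 := by
  obtain ⟨a, S⟩ := b
  simp only [eraseNone, embSome, ne_eq, Prod.mk.injEq, true_and]
  constructor
  · intro h
    by_contra h'
    refine h (Set.ext fun o => ?_)
    cases o <;> simp [h']
  · intro h h'
    rw [← h'] at h
    simp at h

theorem mark_extend_map (p : PointedWord α V) (i : Fin p.word.length) :
    (p.extend i).mark.map eraseNone = p.mark := (mark_subst (p.extend i) some).symm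

theorem markCount_mark_extend (p : PointedWord α V) (i : Fin p.word.length) :
    markCount eraseNone embSome (p.extend i).mark = 1 := by
  classical
  have h : (p.extend i).mark =
      List.map (fun j => (p.word.get j, {x | (p.extend i).val x = j})) (List.finRange _) := by
    simp [mark, List.ofFn_eq_map]
  simp only [markCount, embSome_eraseNone_ne, h, List.countP_map]
  rw [show ((fun b : α × Set (Option V) => decide (none ∈ b.2)) ∘
      fun j => (p.word.get j, {x | (p.extend i).val x = j})) = fun j => j == i from ?_]
  · exact List.count_eq_one_of_mem (List.nodup_finRange _) (List.mem_finRange i)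
  · funext j
    simp [extend, eq_comm, Bool.beq_eq_decide_eq]

theorem exists_extend_of_markCount (p : PointedWord α V) (y : List (α × Set (Option V)))
    (hy : y.map eraseNone = p.mark) (h1 : markCount eraseNone embSome y = 1) :
    ∃ i, y = (p.extend i).mark := by
  classical
  have hlen : y.length = p.word.length := by rw [← p.length_mark, ← hy, List.length_map]
  have hpos : 0 < markCount eraseNone embSome y := by lia
  simp only [markCount, embSome_eraseNone_ne] at hpos h1
  obtain ⟨b, hb, hb'⟩ := List.countP_pos_iff.1 hpos
  obtain ⟨i, hi, rfl⟩ := List.getElem_of_mem hb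
  refine ⟨⟨i, hlen ▸ hi⟩, List.ext_getElem (by simp [length_mark, hlen]) fun j hj hj' => ?_⟩
  have huniq : ∀ j (hj : j < y.length), none ∈ y[j].2 → j = i := by
    intro j hj hn
    by_contra hne
    have h2 : 2 ≤ y.countP fun b => decide (none ∈ b.2) := by
      have hsub : [i, j].length ≤ ((List.range y.length).filter
          fun k => decide (∃ h : k < y.length, none ∈ (y[k]'h).2)).length := by
        refine List.Subperm.length_le (List.subperm_of_subset (by simp [Ne.symm hne]) ?_)
        intro k hk
        simp only [List.mem_cons, List.not_mem_nil, or_false] at hk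
        rcases hk with rfl | rfl
        · simpa [hi] using hb'
        · simpa [hj] using hn
      have heq : y.countP (fun b => decide (none ∈ b.2)) = ((List.range y.length).filter
          fun k => decide (∃ h : k < y.length, none ∈ (y[k]'h).2)).length := by
        conv_lhs => rw [show y = (List.finRange y.length).map y.get by simp]
        rw [← List.map_coe_finRange_eq_range, List.filter_map, List.length_map,
          List.countP_map, List.countP_eq_length_filter]
        congr 1
        apply List.filter_congr
        intro k _
        simp
      rw [heq]
      exact hsub
    lia
  have hm : eraseNone y[j] = p.mark[j]'(by simpa [length_mark, hlen] using hj) := by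
    simp only [← hy, List.getElem_map]
  rw [getElem_mark] at hm
  rw [getElem_mark]
  refine Prod.ext (congrArg Prod.fst hm :) (Set.ext fun o => ?_)
  cases o with
  | some x =>
    have := congrArg (fun b => x ∈ b.2) hm
    simpa [eraseNone, extend] using this
  | none =>
    constructor
    · exact fun h => Fin.ext (huniq j hj h).symm
    · intro h
      obtain rfl : i = j := congrArg Fin.val h
      simpa using hb'

theorem range_extend {F : PointedWord α (Option V) → X} (hF : Rec F) :
    Rec fun p : PointedWord α V => Set.range fun i => F (p.extend i) := by
  obtain ⟨n, f, hf, h⟩ := hF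
  refine of_aperiodicCongr (hf.projectClasses eraseNone_embSome 1) ?_
  have key : ∀ p q : PointedWord α V,
      projectClasses f eraseNone embSome 1 p.mark = projectClasses f eraseNone embSome 1 q.mark →
      (Set.range fun i => F (p.extend i)) ⊆ Set.range fun i => F (q.extend i) := by
    rintro p q hpq _ ⟨i, rfl⟩
    have hi : f (p.extend i).mark ∈ projectClasses f eraseNone embSome 1 p.mark 1 :=
      ⟨_, mark_extend_map p i, markCount_mark_extend p i, rfl⟩
    rw [hpq] at hi
    obtain ⟨y, hy, h1, hfy⟩ := hi
    obtain ⟨j, rfl⟩ := exists_extend_of_markCount q y hy h1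
    exact ⟨j, h _ _ hfy⟩
  exact fun p q hpq => (key p q hpq).antisymm (key q p hpq.symm)

theorem ex {P : PointedWord α (Option V) → Prop} (hP : Rec P) :
    Rec fun p : PointedWord α V => ∃ i, P (p.extend i) := by
  have := hP.range_extend.comp fun s => True ∈ s
  simpa using this

theorem all {P : PointedWord α (Option V) → Prop} (hP : Rec P) :
    Rec fun p : PointedWord α V => ∀ i, P (p.extend i) := by
  have := hP.not.ex.not
  simpa using this

theorem letter (a : α) (x : V) : Rec fun p : PointedWord α V => p.word.get (p.val x) = a := by
  refine of_aperiodicCongr (T := Prop) (f := fun y => ∃ b ∈ y, b.1 = a ∧ x ∈ b.2)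
    ⟨fun {x x' y y'} h h' => ?_, 1, fun y => ?_⟩ ?_
  · simp only [List.mem_append, or_and_right, exists_or, h, h']
  · simp only [wordPow_succ, wordPow_zero, List.mem_append, List.not_mem_nil, or_false, or_self]
  · have : ∀ p : PointedWord α V, (∃ b ∈ p.mark, b.1 = a ∧ x ∈ b.2) ↔
        p.word.get (p.val x) = a := by
      intro p
      simp only [mark, List.mem_ofFn]
      constructor
      · rintro ⟨_, ⟨i, rfl⟩, h1, h2⟩
        exact (congrArg _ h2).trans h1
      · exact fun h => ⟨_, ⟨p.val x, rfl⟩, h, rfl⟩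
    intro p q hpq
    rw [← this p, ← this q]
    exact hpq

theorem lt (x y : V) : Rec fun p : PointedWord α V => p.val x < p.val y := by
  refine of_aperiodicCongr (T := Prop × Prop × Prop) (f := fun z =>
    (∃ b ∈ z, x ∈ b.2, ∃ b ∈ z, y ∈ b.2, z.Pairwise fun b c => ¬ (x ∈ b.2 ∧ y ∈ c.2)))
    ⟨fun {z z' w w'} h h' => ?_, 2, fun z => ?_⟩ ?_
  · simp only [Prod.mk.injEq, eq_iff_iff] at h h' ⊢
    refine ⟨?_, ?_, ?_⟩
    · simp only [List.mem_append, or_and_right, exists_or, h.1, h'.1]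
    · simp only [List.mem_append, or_and_right, exists_or, h.2.1, h'.2.1]
    · rw [List.pairwise_append, List.pairwise_append, h.2.2, h'.2.2]
      have h1 := h.1
      have h2 := h'.2.1
      refine and_congr_right fun _ => and_congr_right fun _ => ?_
      rw [← not_iff_not]
      push Not
      constructor
      · rintro ⟨b, hb, c, hc, hx, hy⟩
        obtain ⟨b', hb', hx'⟩ := h1.1 ⟨b, hb, hx⟩
        obtain ⟨c', hc', hy'⟩ := h2.1 ⟨c, hc, hy⟩
        exact ⟨b', hb', c', hc', hx', hy'⟩
      · rintro ⟨b, hb, c, hc, hx, hy⟩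
        obtain ⟨b', hb', hx'⟩ := h1.2 ⟨b, hb, hx⟩
        obtain ⟨c', hc', hy'⟩ := h2.2 ⟨c, hc, hy⟩
        exact ⟨b', hb', c', hc', hx', hy'⟩
  · simp only [wordPow_succ, wordPow_zero, List.mem_append, or_self,
      List.append_nil, List.pairwise_append, Prod.mk.injEq, eq_iff_iff, true_and]
    constructor
    · rintro ⟨h1, -, h2⟩
      exact ⟨h1, ⟨h1, h1, h2⟩, h2⟩
    · rintro ⟨h1, -, h2⟩
      exact ⟨h1, h1, h2⟩
  · have : ∀ p : PointedWord α V, (p.mark.Pairwise fun b c => ¬ (x ∈ b.2 ∧ y ∈ c.2)) ↔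
        ¬ p.val x < p.val y := by
      intro p
      rw [mark, List.pairwise_ofFn]
      constructor
      · intro h hlt
        exact h hlt ⟨rfl, rfl⟩
      · rintro h i j hij ⟨hx, hy⟩
        exact h (hx.symm ▸ hy.symm ▸ hij)
    intro p q hpq
    simp only [Prod.mk.injEq, eq_iff_iff] at hpq
    rw [this, this] at hpq
    exact propext (not_iff_not.1 hpq.2.2)

theorem le (x y : V) : Rec fun p : PointedWord α V => p.val x ≤ p.val y := by
  simpa using (lt y x).not

theorem extend_first {F : PointedWord α (Option V) → X} (hF : Rec F) :
    Rec fun p : PointedWord α V => F (p.extend p.first) := by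
  have hmin : Rec fun p : PointedWord α (Option V) => ∀ i, p.val none ≤ i :=
    (le (some none) (none : Option (Option V))).all
  obtain ⟨n, f, hf, h⟩ := (hmin.prodMk hF).range_extend
  have hz : ∀ (p : PointedWord α V) (i : Fin p.word.length), (∀ j, i ≤ j) ↔ i = p.first := by
    intro p i
    constructor
    · intro h
      exact le_antisymm (h _) (Nat.zero_le _)
    · rintro rfl j
      exact Nat.zero_le _
  refine ⟨n, f, hf, fun p q hpq => ?_⟩
  have h1 : (True, F (p.extend p.first)) ∈
      Set.range fun i => (∀ j, (p.extend i).val none ≤ j, F (p.extend i)) :=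
    ⟨p.first, Prod.ext (eq_true ((hz p _).2 rfl)) rfl⟩
  obtain ⟨j, hj⟩ := (h p q hpq).subset h1
  simp only [Prod.mk.injEq, eq_iff_iff, iff_true] at hj
  exact hj.2.symm.trans (congrArg (fun i => F (q.extend i)) ((hz q j).1 hj.1))

end Rec

/-! ### First-order definable predicates of pointed words -/

/-- `P` is first-order definable, whatever the names `e` of its variables. -/
def FODef {α : Type u} {V : Type} (P : PointedWord α V → Prop) : Prop :=
  ∀ e : V → ℕ, ∃ φ : FOFormula α, (∀ x ∈ φ.freeVars, x ∈ Set.range e) ∧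
    ∀ (u : List α) (hu : u ≠ []) (σ : ℕ → Fin u.length),
      φ.Sat u σ ↔ P ⟨u, hu, fun x => σ (e x)⟩

namespace FODef

variable {α : Type u} {V V' : Type} {P Q : PointedWord α V → Prop}

theorem congr (hP : FODef P) (h : ∀ p, P p ↔ Q p) : FODef Q := by
  rwa [show Q = P from funext fun p => propext (h p).symm]

theorem true : FODef fun _ : PointedWord α V => True :=
  fun _ => ⟨.top, by simp [FOFormula.freeVars], by simp [FOFormula.Sat]⟩

theorem not (hP : FODef P) : FODef fun p => ¬ P p := by
  intro e
  obtain ⟨φ, h, h'⟩ := hP e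
  exact ⟨φ.not, h, fun u hu σ => not_congr (h' u hu σ)⟩

theorem const (c : Prop) : FODef fun _ : PointedWord α V => c := by
  by_cases hc : c
  · exact true.congr (by simp [hc])
  · exact true.not.congr (by simp [hc])

theorem and (hP : FODef P) (hQ : FODef Q) : FODef fun p => P p ∧ Q p := by
  intro e
  obtain ⟨φ, h, h'⟩ := hP e
  obtain ⟨ψ, k, k'⟩ := hQ e
  refine ⟨φ.and ψ, ?_, fun u hu σ => and_congr (h' u hu σ) (k' u hu σ)⟩
  simp only [FOFormula.freeVars, Finset.mem_union]
  exact fun x hx => hx.elim (h x) (k x)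

theorem or (hP : FODef P) (hQ : FODef Q) : FODef fun p => P p ∨ Q p :=
  (hP.not.and hQ.not).not.congr fun p => by tauto

theorem imp (hP : FODef P) (hQ : FODef Q) : FODef fun p => P p → Q p :=
  (hP.not.or hQ).congr fun p => by tauto

theorem letter (a : α) (x : V) : FODef fun p : PointedWord α V => p.word.get (p.val x) = a :=
  fun e => ⟨.letter a (e x), by simp [FOFormula.freeVars], by simp [FOFormula.Sat]⟩

theorem le (x y : V) : FODef fun p : PointedWord α V => p.val x ≤ p.val y :=
  fun e => ⟨.le (e x) (e y), by simp [FOFormula.freeVars], by simp [FOFormula.Sat]⟩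

theorem lt (x y : V) : FODef fun p : PointedWord α V => p.val x < p.val y :=
  (le y x).not.congr fun _ => by simp

theorem eq (x y : V) : FODef fun p : PointedWord α V => p.val x = p.val y :=
  ((le x y).and (le y x)).congr fun _ => le_antisymm_iff.symm

theorem subst (hP : FODef P) (s : V → V') : FODef fun p : PointedWord α V' => P (p.subst s) := by
  intro e
  obtain ⟨φ, h, h'⟩ := hP fun x => e (s x)
  refine ⟨φ, fun x hx => ?_, h'⟩
  obtain ⟨y, rfl⟩ := h x hx
  exact ⟨s y, rfl⟩

theorem all [Finite V] {P : PointedWord α (Option V) → Prop} (hP : FODef P) :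
    FODef fun p : PointedWord α V => ∀ i, P (p.extend i) := by
  intro e
  obtain ⟨z, hz⟩ := (Set.finite_range e).exists_notMem
  obtain ⟨φ, h, h'⟩ := hP fun o => o.elim z e
  refine ⟨.all z φ, fun x hx => ?_, fun u hu σ => ?_⟩
  · obtain ⟨hx, hx'⟩ := Finset.mem_erase.1 hx
    obtain ⟨o, rfl⟩ := h x hx'
    cases o with
    | none => exact absurd rfl hx
    | some y => exact ⟨y, rfl⟩
  · refine forall_congr' fun i => (h' u hu _).trans (iff_of_eq (congrArg P ?_))
    refine ext_val hu hu fun o => ?_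
    cases o with
    | none => simp
    | some y =>
      have : e y ≠ z := fun hy => hz ⟨y, hy⟩
      simp [this]

theorem ex [Finite V] {P : PointedWord α (Option V) → Prop} (hP : FODef P) :
    FODef fun p : PointedWord α V => ∃ i, P (p.extend i) :=
  hP.not.all.not.congr fun p => by simp

theorem exists_finite {ι : Type*} [Finite ι] {P : ι → PointedWord α V → Prop}
    (hP : ∀ i, FODef (P i)) : FODef fun p => ∃ i, P i p := by
  classical
  have := Fintype.ofFinite ι
  have : ∀ s : Finset ι, FODef fun p => ∃ i ∈ s, P i p := by
    intro s
    induction s using Finset.induction_on with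
    | empty => exact (const False).congr (by simp)
    | insert i s _ ih => exact ((hP i).or ih).congr (by simp)
  exact (this Finset.univ).congr (by simp)

theorem forall_finite {ι : Type*} [Finite ι] {P : ι → PointedWord α V → Prop}
    (hP : ∀ i, FODef (P i)) : FODef fun p => ∀ i, P i p :=
  (exists_finite fun i => (hP i).not).not.congr fun p => by simp

end FODef

/-- All fibres of `F` are first-order definable. -/
def FOFun {α : Type u} {V : Type} {X : Type*} (F : PointedWord α V → X) : Prop :=
  ∀ x, FODef fun p => F p = x

namespace FOFun

variable {α : Type u} {V V' : Type} {X Y Z : Type*}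

theorem comp [Finite X] {F : PointedWord α V → X} (hF : FOFun F) (g : X → Y) :
    FOFun fun p => g (F p) := fun y =>
  (FODef.exists_finite fun x => (hF x).and (.const (g x = y))).congr fun p => by
    simp

theorem map₂ [Finite X] [Finite Y] {F : PointedWord α V → X} (hF : FOFun F)
    {G : PointedWord α V → Y} (hG : FOFun G) (g : X → Y → Z) :
    FOFun fun p => g (F p) (G p) := fun z =>
  (FODef.exists_finite fun x : X × Y =>
    ((hF x.1).and (hG x.2)).and (.const (g x.1 x.2 = z))).congr fun p => by
    simp

theorem ite {P : PointedWord α V → Prop} (hP : FODef P) [DecidablePred P]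
    {F G : PointedWord α V → X} (hF : FOFun F) (hG : FOFun G) :
    FOFun fun p => if P p then F p else G p := fun x =>
  ((hP.and (hF x)).or (hP.not.and (hG x))).congr fun p => by
    by_cases h : P p <;> simp [h]

theorem const (x : X) : FOFun fun _ : PointedWord α V => x := fun _ => .const _

theorem subst {F : PointedWord α V → X} (hF : FOFun F) (s : V → V') :
    FOFun fun p : PointedWord α V' => F (p.subst s) := fun x => (hF x).subst s

end FOFun

/-! ### Local divisors -/

/-- The local divisor `cM ∩ Mc` of a monoid `M` at `c`. -/
def LocalDivisor {M : Type*} [Monoid M] (c : M) : Type _ :=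
  {m : M // (∃ x, m = x * c) ∧ ∃ y, m = c * y}

namespace LocalDivisor

variable {M : Type*} [Monoid M] {c : M}

noncomputable instance : Mul (LocalDivisor c) :=
  ⟨fun m n => ⟨m.2.1.choose * n.1, by
    obtain ⟨x, hx⟩ := n.2.1
    obtain ⟨y, hy⟩ := n.2.2
    obtain ⟨z, hz⟩ := m.2.2
    refine ⟨⟨m.2.1.choose * x, by rw [hx, mul_assoc]⟩, ⟨z * y, ?_⟩⟩
    rw [hy, ← mul_assoc, ← m.2.1.choose_spec, hz, mul_assoc]⟩⟩

instance : One (LocalDivisor c) := ⟨⟨c, ⟨1, by simp⟩, ⟨1, by simp⟩⟩⟩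

/-- The element `c * y * c`. -/
def conj (c y : M) : LocalDivisor c := ⟨c * y * c, ⟨_, rfl⟩, ⟨_, mul_assoc _ _ _⟩⟩

theorem coe_conj (y : M) : (conj c y).1 = c * y * c := rfl

theorem coe_one : (1 : LocalDivisor c).1 = c := rfl

theorem coe_mul_right (m n : LocalDivisor c) {y : M} (h : n.1 = c * y) :
    (m * n).1 = m.1 * y := by
  change m.2.1.choose * n.1 = _
  rw [h, ← mul_assoc, ← m.2.1.choose_spec]

theorem coe_mul_left (m n : LocalDivisor c) {x : M} (h : m.1 = x * c) :
    (m * n).1 = x * n.1 := by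
  obtain ⟨y, hy⟩ := n.2.2
  rw [coe_mul_right m n hy, h, hy, mul_assoc]

noncomputable instance : Monoid (LocalDivisor c) where
  mul_assoc m n k := by
    obtain ⟨x, hx⟩ := m.2.1
    obtain ⟨y, hy⟩ := n.2.1
    apply Subtype.ext
    rw [coe_mul_left (m * n) k (x := x * y) (by rw [coe_mul_left m n hx, hy, mul_assoc]),
      coe_mul_left m (n * k) hx, coe_mul_left n k hy, mul_assoc]
  one_mul m := Subtype.ext (by rw [coe_mul_left 1 m (x := 1) (by simp [coe_one]), one_mul])
  mul_one m := Subtype.ext (by rw [coe_mul_right m 1 (y := 1) (by simp [coe_one]), mul_one])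

theorem coe_pow (m : LocalDivisor c) {x : M} (h : m.1 = x * c) (n : ℕ) :
    (m ^ n).1 = x ^ n * c := by
  induction n with
  | zero => simp [coe_one]
  | succ n ih => rw [pow_succ', coe_mul_left m _ h, ih, pow_succ', mul_assoc]

theorem card_lt [Finite M] {N : ℕ} (hN : ∀ x : M, x ^ N = x ^ (N + 1)) (hc : c ≠ 1) :
    Nat.card (LocalDivisor c) < Nat.card M := by
  refine Finite.card_subtype_lt (x := 1) ?_
  rintro ⟨-, y, hy⟩
  apply hc
  have h : ∀ n : ℕ, c ^ n * y ^ n = 1 := by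
    intro n
    induction n with
    | zero => simp
    | succ n ih => rw [pow_succ c, pow_succ' y, mul_assoc, ← mul_assoc c, ← hy, one_mul, ih]
  calc c = c * (c ^ N * y ^ N) := by rw [h, mul_one]
    _ = c ^ (N + 1) * y ^ N := by rw [← mul_assoc, ← pow_succ']
    _ = 1 := by rw [← hN, h]

instance [Finite M] : Finite (LocalDivisor c) := Subtype.finite

end LocalDivisor

/-! ### Products along words -/

/-- The product `g 0 * ⋯ * g (n - 1)`. -/
def seqProd {M : Type*} [Monoid M] (g : ℕ → M) : ℕ → M
  | 0 => 1
  | n + 1 => seqProd g n * g n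

section SeqProd

variable {M : Type*} [Monoid M]

theorem seqProd_congr {g g' : ℕ → M} {n : ℕ} (h : ∀ z < n, g z = g' z) :
    seqProd g n = seqProd g' n := by
  induction n with
  | zero => rfl
  | succ n ih =>
    rw [seqProd, seqProd, ih fun z hz => h z (hz.trans n.lt_succ_self), h n n.lt_succ_self]

theorem seqProd_eq_one {g : ℕ → M} {n : ℕ} (h : ∀ z < n, g z = 1) : seqProd g n = 1 := by
  induction n with
  | zero => rfl
  | succ n ih =>
    rw [seqProd, ih fun z hz => h z (hz.trans n.lt_succ_self), h n n.lt_succ_self, one_mul]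

theorem seqProd_eq_of_le {g : ℕ → M} {m n : ℕ} (hmn : m ≤ n) (h : ∀ z, m ≤ z → g z = 1) :
    seqProd g n = seqProd g m := by
  induction n, hmn using Nat.le_induction with
  | base => rfl
  | succ n hn ih => rw [seqProd, ih, h n hn, mul_one]

open Classical in
/-- The elements of the sequence before the first occurrence of `c`, padded by `1`. -/
noncomputable def beforeFirst (c : M) (g : ℕ → M) (y : ℕ) : M :=
  if ∀ x ≤ y, g x ≠ c then g y else 1

open Classical in
/-- The elements of the sequence between the last occurrence of `c` before `z` and `z`, padded
by `1`. -/
noncomputable def sinceLast (c : M) (g : ℕ → M) (z y : ℕ) : M :=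
  if y < z ∧ ∀ x, y ≤ x → x < z → g x ≠ c then g y else 1

open Classical in
/-- At each occurrence of `c` except for the first one the block that leads from the previous
occurrence to it, as an element of the local divisor. -/
noncomputable def blockAt (c : M) (g : ℕ → M) (z : ℕ) : LocalDivisor c :=
  if g z = c ∧ ∃ k < z, g k = c then
    LocalDivisor.conj c (seqProd (sinceLast c g z) z) else 1

theorem seqProd_sinceLast_succ_self {c : M} {g : ℕ → M} {n : ℕ} (h : g n = c) :
    seqProd (sinceLast c g (n + 1)) (n + 1) = 1 :=
  seqProd_eq_one fun _ hz =>
    if_neg fun h' => h'.2 n (Nat.le_of_lt_succ hz) n.lt_succ_self h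

theorem seqProd_sinceLast_succ_of_ne {c : M} {g : ℕ → M} {n : ℕ} (h : g n ≠ c) :
    seqProd (sinceLast c g (n + 1)) (n + 1) = seqProd (sinceLast c g n) n * g n := by
  rw [seqProd]
  congr 1
  · refine seqProd_congr fun z hz => ?_
    classical
    unfold sinceLast
    refine if_congr ?_ rfl rfl
    constructor
    · exact fun h' => ⟨hz, fun x hx hx' => h'.2 x hx (by lia)⟩
    · refine fun h' => ⟨by lia, fun x hx hx' => ?_⟩
      rcases Nat.lt_succ_iff_lt_or_eq.1 hx' with hx' | rfl
      · exact h'.2 x hx hx'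
      · exact h
  · refine if_pos ⟨n.lt_succ_self, fun x hx hx' => ?_⟩
    rwa [show x = n by lia]

theorem seqProd_blockAt_eq_one {c : M} {g : ℕ → M} {n : ℕ} (h : ∀ k < n, g k ≠ c) :
    seqProd (blockAt c g) n = 1 :=
  seqProd_eq_one fun z hz => if_neg fun h' => h z hz h'.1

open Classical in
theorem seqProd_eq_local (c : M) (g : ℕ → M) (n : ℕ) :
    seqProd g n = if ∃ k < n, g k = c then
      seqProd (beforeFirst c g) n * (seqProd (blockAt c g) n).1 * seqProd (sinceLast c g n) n
      else seqProd (beforeFirst c g) n := by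
  induction n with
  | zero => simp [seqProd]
  | succ n ih =>
    by_cases hn : g n = c
    · have hb : beforeFirst c g n = 1 := if_neg fun h => h n le_rfl hn
      rw [if_pos ⟨n, n.lt_succ_self, hn⟩, seqProd_sinceLast_succ_self hn, mul_one]
      simp only [seqProd, hb, mul_one]
      by_cases hk : ∃ k < n, g k = c
      · rw [if_pos hk] at ih
        rw [ih, hn, LocalDivisor.coe_mul_right _ (blockAt c g n)
          (y := seqProd (sinceLast c g n) n * c)]
        · simp only [mul_assoc]
        · rw [blockAt, if_pos ⟨hn, hk⟩, LocalDivisor.coe_conj, mul_assoc]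
      · rw [if_neg hk] at ih
        have h1 : blockAt c g n = 1 := if_neg fun h => hk h.2
        push Not at hk
        rw [ih, hn, h1, mul_one, seqProd_blockAt_eq_one hk, LocalDivisor.coe_one]
    · by_cases hk : ∃ k < n, g k = c
      · rw [if_pos hk] at ih
        obtain ⟨k, hk, hkc⟩ := hk
        have hb : beforeFirst c g n = 1 := if_neg fun h => h k hk.le hkc
        have h1 : blockAt c g n = 1 := if_neg fun h => hn h.1
        rw [if_pos ⟨k, hk.trans n.lt_succ_self, hkc⟩, seqProd_sinceLast_succ_of_ne hn]
        simp only [seqProd, hb, h1, mul_one, ih, mul_assoc]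
      · rw [if_neg hk] at ih
        push Not at hk
        have hk' : ∀ k ≤ n, g k ≠ c := fun k hkn => by
          rcases hkn.lt_or_eq with h | rfl
          · exact hk k h
          · exact hn
        rw [if_neg (by push Not; exact fun k hkn => hk' k (Nat.le_of_lt_succ hkn)), seqProd, ih,
          seqProd, beforeFirst, if_pos hk']

end SeqProd

/-! ### First-order definability of products -/

section PosProd

variable {α : Type u} {V : Type} {M : Type*} [Monoid M]

/-- The values of `col` at the positions of a word, continued by `1`. -/
noncomputable def posSeq (col : PointedWord α (Option V) → M) (p : PointedWord α V) (z : ℕ) : M :=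
  if h : z < p.word.length then col (p.extend ⟨z, h⟩) else 1

/-- The product of the values of `col` at the positions of a word. -/
noncomputable def posProd (col : PointedWord α (Option V) → M) (p : PointedWord α V) : M :=
  seqProd (posSeq col p) p.word.length

theorem posSeq_coe (col : PointedWord α (Option V) → M) (p : PointedWord α V)
    (i : Fin p.word.length) : posSeq col p i = col (p.extend i) := dif_pos i.2

theorem posProd_eq_seqProd {col : PointedWord α (Option V) → M} {p : PointedWord α V} {g : ℕ → M}
    (h : ∀ i : Fin p.word.length, col (p.extend i) = g i) :
    posProd col p = seqProd g p.word.length :=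
  seqProd_congr fun z hz => (posSeq_coe col p ⟨z, hz⟩).trans (h ⟨z, hz⟩)

/-- Forgets the second last variable. -/
def skip : Option V → Option (Option V) := Option.map some

theorem extend_extend_subst_skip (p : PointedWord α V) (i j : Fin p.word.length) :
    ((p.extend i).extend j).subst skip = p.extend j :=
  ext_val _ _ fun o => by cases o <;> rfl

open Classical in
theorem posProd_eq_local (c : M) (col : PointedWord α (Option V) → M) (p : PointedWord α V) :
    posProd col p = if ∃ i, col (p.extend i) = c then
      posProd (fun q => if ∀ x, (q.extend x).val none ≤ (q.extend x).val (some none) →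
        col ((q.extend x).subst skip) ≠ c then col q else 1) p *
      (posProd (fun q => if col q = c ∧ ∃ k, (q.extend k).val none < (q.extend k).val (some none) ∧
          col ((q.extend k).subst skip) = c then
        LocalDivisor.conj c (posProd (fun r => if r.val none < r.val (some none) ∧
          ∀ x, (r.extend x).val (some none) ≤ (r.extend x).val none →
            (r.extend x).val none < (r.extend x).val (some (some none)) →
            col ((r.extend x).subst fun o => skip (skip o)) ≠ c then col (r.subst skip) else 1) q)
        else 1) p).1 *
      posProd (fun q => if ∀ x, (q.extend x).val (some none) ≤ (q.extend x).val none →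
        col ((q.extend x).subst skip) ≠ c then col q else 1) p
      else posProd (fun q => if ∀ x, (q.extend x).val none ≤ (q.extend x).val (some none) →
        col ((q.extend x).subst skip) ≠ c then col q else 1) p := by
  have hskip : ∀ (i : Fin p.word.length) (x : Fin (p.extend i).word.length),
      col (((p.extend i).extend x).subst skip) = posSeq col p x := fun i x =>
    (congrArg col (extend_extend_subst_skip p i x)).trans (posSeq_coe col p x).symm
  have hbefore : posProd (fun q => if ∀ x, (q.extend x).val none ≤ (q.extend x).val (some none) →
        col ((q.extend x).subst skip) ≠ c then col q else 1) p =
      seqProd (beforeFirst c (posSeq col p)) p.word.length := by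
    refine posProd_eq_seqProd fun i => ?_
    rw [beforeFirst, posSeq_coe]
    refine if_congr ?_ rfl rfl
    constructor
    · intro h x hx
      exact fun e => h ⟨x, hx.trans_lt i.2⟩ hx ((hskip i _).trans e)
    · intro h x hx e
      exact h x hx ((hskip i x).symm.trans e)
  have hsince : posProd (fun q => if ∀ x, (q.extend x).val (some none) ≤ (q.extend x).val none →
        col ((q.extend x).subst skip) ≠ c then col q else 1) p =
      seqProd (sinceLast c (posSeq col p) p.word.length) p.word.length := by
    refine posProd_eq_seqProd fun i => ?_
    rw [sinceLast, posSeq_coe]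
    refine if_congr ?_ rfl rfl
    constructor
    · refine fun h => ⟨i.2, fun x hx hx' => ?_⟩
      exact fun e => h ⟨x, hx'⟩ hx ((hskip i _).trans e)
    · intro h x hx e
      exact h.2 x hx x.2 ((hskip i x).symm.trans e)
  have hblock : ∀ q : PointedWord α (Option V), ∀ i : Fin p.word.length, q = p.extend i →
      posProd (fun r => if r.val none < r.val (some none) ∧
          ∀ x, (r.extend x).val (some none) ≤ (r.extend x).val none →
            (r.extend x).val none < (r.extend x).val (some (some none)) →
            col ((r.extend x).subst fun o => skip (skip o)) ≠ c then col (r.subst skip) else 1) q =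
        seqProd (sinceLast c (posSeq col p) i) i := by
    rintro _ i rfl
    rw [← seqProd_eq_of_le (g := sinceLast c (posSeq col p) i) i.2.le
      fun z hz => if_neg fun h => absurd h.1 (not_lt.2 hz)]
    refine posProd_eq_seqProd (p := p.extend i) fun j => ?_
    rw [sinceLast]
    refine if_congr ?_ (hskip i j) rfl
    have hs : ∀ x : Fin p.word.length, ((((p.extend i).extend j).extend x).subst
        fun o => skip (skip o)) = p.extend x := fun x =>
      ext_val _ _ fun o => by cases o <;> rfl
    replace hs : ∀ x : Fin ((p.extend i).extend j).word.length,
        col ((((p.extend i).extend j).extend x).subst fun o => skip (skip o)) = posSeq col p x :=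
      fun x => (congrArg col (hs x)).trans (posSeq_coe col p x).symm
    constructor
    · refine fun h => ⟨h.1, fun x hx hx' => ?_⟩
      exact fun e => h.2 ⟨x, hx'.trans i.2⟩ hx hx' ((hs _).trans e)
    · refine fun h => ⟨h.1, fun x hx hx' e => h.2 x hx hx' ((hs x).symm.trans e)⟩
  have hmid : posProd (fun q => if col q = c ∧
        ∃ k, (q.extend k).val none < (q.extend k).val (some none) ∧
          col ((q.extend k).subst skip) = c then
        LocalDivisor.conj c (posProd (fun r => if r.val none < r.val (some none) ∧
          ∀ x, (r.extend x).val (some none) ≤ (r.extend x).val none →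
            (r.extend x).val none < (r.extend x).val (some (some none)) →
            col ((r.extend x).subst fun o => skip (skip o)) ≠ c then col (r.subst skip) else 1) q)
        else 1) p = seqProd (blockAt c (posSeq col p)) p.word.length := by
    refine posProd_eq_seqProd fun i => ?_
    rw [blockAt, posSeq_coe]
    refine if_congr (and_congr_right fun _ => ?_) (by rw [hblock _ i rfl]) rfl
    constructor
    · rintro ⟨k, hk, h⟩
      exact ⟨k, hk, (hskip i k).symm.trans h⟩
    · rintro ⟨k, hk, h⟩
      exact ⟨⟨k, hk.trans i.2⟩, hk, (hskip i _).trans h⟩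
  rw [hbefore, hsince, hmid, posProd, seqProd_eq_local c]
  refine if_congr ?_ rfl rfl
  constructor
  · rintro ⟨k, hk, h⟩
    exact ⟨⟨k, hk⟩, (posSeq_coe col p ⟨k, hk⟩).symm.trans h⟩
  · rintro ⟨k, h⟩
    exact ⟨k, k.2, by rwa [posSeq_coe]⟩

end PosProd

theorem FOFun.posProd_of_values {α : Type u} (n : ℕ) : ∀ (M : Type w) [Monoid M] [Finite M],
    (∃ N : ℕ, ∀ x : M, x ^ N = x ^ (N + 1)) → Nat.card M ≤ n → ∀ (A : Finset M) (V : Type)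
    [Finite V] (col : PointedWord α (Option V) → M), (∀ p, col p ∈ A ∨ col p = 1) →
    FOFun col → FOFun (posProd col) := by
  classical
  induction n with
  | zero =>
    intro M _ _ _ h
    exact absurd (Nat.card_pos (α := M)) (by lia)
  | succ n ihn =>
    intro M _ _ hap hcard A
    induction A using Finset.induction_on with
    | empty =>
      intro V _ col hcol _
      have : posProd col = fun _ => 1 := funext fun p => seqProd_eq_one fun z hz => by
        simpa [posSeq, hz] using hcol (p.extend ⟨z, hz⟩)
      rw [this]
      exact .const 1
    | insert c A _ ihA =>
      intro V _ col hcol hdef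
      by_cases hc : c = 1
      · refine ihA V col (fun p => ?_) hdef
        have := hcol p
        rw [Finset.mem_insert, hc] at this
        tauto
      obtain ⟨N, hN⟩ := hap
      have hvals : ∀ {V' : Type} {col' : PointedWord α V' → M} (s : PointedWord α V' →
          PointedWord α (Option V)) (P : PointedWord α V' → Prop) [DecidablePred P],
          (∀ q, P q → col (s q) ≠ c) → (∀ q, col' q = if P q then col (s q) else 1) →
          ∀ q, col' q ∈ A ∨ col' q = 1 := by
        intro V' col' s P _ hP hcol' q
        rw [hcol']
        by_cases hq : P q
        · have := hcol (s q)
          rw [Finset.mem_insert] at this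
          rw [if_pos hq]
          have := hP q hq
          tauto
        · exact .inr (if_neg hq)
      have hne : FODef fun q : PointedWord α (Option (Option V)) => col (q.subst skip) ≠ c :=
        ((hdef c).subst skip).not
      have hbefore := ihA V (fun q => if ∀ x, (q.extend x).val none ≤
          (q.extend x).val (some none) → col ((q.extend x).subst skip) ≠ c then col q else 1)
        (hvals id _ (fun q hq => by
          have := hq (q.val none) le_rfl
          rwa [show (q.extend (q.val none)).subst skip = q from
            ext_val _ _ fun o => by cases o <;> rfl] at this) fun q => rfl)
        (.ite (((FODef.le none (some none)).imp hne).all) hdef (.const 1))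
      have hsince := ihA V (fun q => if ∀ x, (q.extend x).val (some none) ≤
          (q.extend x).val none → col ((q.extend x).subst skip) ≠ c then col q else 1)
        (hvals id _ (fun q hq => by
          have := hq (q.val none) le_rfl
          rwa [show (q.extend (q.val none)).subst skip = q from
            ext_val _ _ fun o => by cases o <;> rfl] at this) fun q => rfl)
        (.ite (((FODef.le (some none) none).imp hne).all) hdef (.const 1))
      have hblock := ihA (Option V) (fun r => if r.val none < r.val (some none) ∧
          ∀ x, (r.extend x).val (some none) ≤ (r.extend x).val none →
            (r.extend x).val none < (r.extend x).val (some (some none)) →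
            col ((r.extend x).subst fun o => skip (skip o)) ≠ c then col (r.subst skip) else 1)
        (hvals (fun r => r.subst skip) _ (fun r hr => by
          have := hr.2 (r.val none) le_rfl hr.1
          rwa [show (r.extend (r.val none)).subst (fun o => skip (skip o)) = r.subst skip from
            ext_val _ _ fun o => by cases o <;> rfl] at this) fun q => rfl)
        (.ite ((FODef.lt none (some none)).and (((FODef.le (some none) none).imp
          ((FODef.lt none (some (some none))).imp ((hdef c).subst _).not)).all))
          (hdef.subst skip) (.const 1))
      have hmid := ihn (LocalDivisor c) ⟨N, fun m => by
          obtain ⟨x, hx⟩ := m.2.1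
          exact Subtype.ext (by rw [m.coe_pow hx, m.coe_pow hx, hN])⟩
        (by have := LocalDivisor.card_lt hN hc; lia)
        (Set.toFinite Set.univ).toFinset V _ (fun q => by simp)
        (FOFun.ite ((hdef c).and ((FODef.lt none (some none)).and ((hdef c).subst skip)).ex)
          (hblock.comp (LocalDivisor.conj c)) (.const 1))
      have := FOFun.ite (hdef c).ex ((hbefore.map₂ (hmid.comp Subtype.val) (· * ·)).map₂
        hsince (· * ·)) hbefore
      convert this using 1
      exact funext fun p => posProd_eq_local c col p

theorem FOFun.posProd {α : Type u} {V : Type} [Finite V] {M : Type w} [Monoid M] [Finite M]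
    (hM : ∃ N : ℕ, ∀ x : M, x ^ N = x ^ (N + 1)) {col : PointedWord α (Option V) → M}
    (hcol : FOFun col) : FOFun (posProd col) :=
  posProd_of_values _ M hM le_rfl (Set.toFinite Set.univ).toFinset V col (fun p => by simp) hcol

/-! ### Recognizable predicates are first-order definable -/

/-- The congruence given by an aperiodic congruence function. -/
def AperiodicCongr.con {B T : Type*} {f : List B → T} (hf : AperiodicCongr f) :
    Con (FreeMonoid B) where
  r x y := f x.toList = f y.toList
  iseqv := ⟨fun _ => rfl, Eq.symm, Eq.trans⟩
  mul' h h' := hf.append h h'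

theorem AperiodicCongr.foDef {α : Type u} [Finite α] {V : Type} [Finite V] {T : Type*} [Finite T]
    {f : List (α × Set V) → T} (hf : AperiodicCongr f) (t : T) :
    FODef fun p : PointedWord α V => f p.mark = t := by
  classical
  let val : hf.con.Quotient → T := fun m => Con.liftOn m (fun x => f x.toList) fun _ _ h => h
  have hval : Function.Injective val := by
    intro m n
    induction m using Con.induction_on with | _ x =>
    induction n using Con.induction_on with | _ y =>
    exact fun h => (Con.eq _).2 h
  have : Finite hf.con.Quotient := .of_injective val hval
  obtain ⟨N, hN⟩ := hf.exists_pow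
  have hpow : ∀ (x : FreeMonoid (α × Set V)) (n : ℕ), (x ^ n).toList = wordPow x.toList n := by
    intro x n
    induction n with
    | zero => rfl
    | succ n ih => rw [pow_succ', FreeMonoid.toList_mul, ih, wordPow_succ]
  have hap : ∃ N : ℕ, ∀ x : hf.con.Quotient, x ^ N = x ^ (N + 1) := by
    refine ⟨N, fun x => ?_⟩
    induction x using Con.induction_on with | _ x =>
    refine (Con.eq _ (a := x ^ N) (b := x ^ (N + 1))).2 ?_
    change f _ = f _
    rw [hpow, hpow]
    exact hN _
  let lett : PointedWord α (Option V) → α × Set V :=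
    fun q => (q.word.get (q.val none), {x | q.val (some x) = q.val none})
  have hlett : FOFun lett := fun b =>
    ((FODef.letter b.1 none).and (FODef.forall_finite fun x =>
      (FODef.eq (some x) none).imp (.const (x ∈ b.2)) |>.and
        ((FODef.const (x ∈ b.2)).imp (FODef.eq (some x) none)))).congr fun q => by
      obtain ⟨a, S⟩ := b
      simp only [lett, Prod.mk.injEq, Set.ext_iff]
      exact and_congr_right fun _ => forall_congr' fun x => iff_def.symm
  have hprod := FOFun.posProd hap (hlett.comp fun b => ((FreeMonoid.of b : FreeMonoid _) :
    hf.con.Quotient))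
  refine (hprod.comp val t).congr fun p => ?_
  have key : ∀ n ≤ p.word.length, seqProd (posSeq (fun q => ((FreeMonoid.of (lett q) :
      FreeMonoid _) : hf.con.Quotient)) p) n =
      ((FreeMonoid.ofList (p.mark.take n) : FreeMonoid _) : hf.con.Quotient) := by
    intro n hn
    induction n with
    | zero => rfl
    | succ n ih =>
      have hn' : n < p.mark.length := by rw [length_mark]; exact hn
      rw [seqProd, ih (by lia), posSeq, dif_pos (by exact hn), ← Con.coe_mul,
        List.take_succ_eq_append_getElem hn', getElem_mark, FreeMonoid.ofList_append]
      rfl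
  have hp := key _ le_rfl
  rw [List.take_of_length_le p.length_mark.le] at hp
  exact iff_of_eq (congrArg (fun m => val m = t) hp)

theorem Rec.foDef {α : Type u} [Finite α] {V : Type} [Finite V] {P : PointedWord α V → Prop}
    (hP : Rec P) : FODef P := by
  obtain ⟨n, f, hf, h⟩ := hP
  refine (FODef.exists_finite fun t : {t : Fin n // ∃ q, f q.mark = t ∧ P q} =>
    hf.foDef t.1).congr fun p => ?_
  constructor
  · rintro ⟨⟨t, q, rfl, hq⟩, hp⟩
    rw [h p q hp]
    exact hq
  · exact fun hp => ⟨⟨_, p, rfl, hp⟩, rfl⟩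

/-! ### Recognizable series of multisets -/

namespace PointedWord

variable {α : Type u} {V W : Type}

/-- The extension of the valuation to the variables in `W`. -/
def append (p : PointedWord α V) (τ : W → Fin p.word.length) : PointedWord α (V ⊕ W) :=
  ⟨p.word, p.ne, Sum.elim p.val τ⟩

end PointedWord

section Series

variable {α : Type u} {R : Type v} {V V' : Type}

open Classical in
/-- The single sequence of the weights `w` if the condition `P` holds. -/
noncomputable def condProd (P : PointedWord α V → Prop) (w : PointedWord α (Option V) → R)
    (p : PointedWord α V) : Multiset (List R) :=
  if P p then {List.ofFn fun i => w (p.extend i)} else 0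

/-- The sum of `condProd P w` over all valuations of `k` further variables. -/
noncomputable def sumProd (k : ℕ) (P : PointedWord α (V ⊕ Fin k) → Prop)
    (w : PointedWord α (Option (V ⊕ Fin k)) → R) (p : PointedWord α V) : Multiset (List R) :=
  ∑ τ : Fin k → Fin p.word.length, condProd P w (p.append τ)

variable (α R V) in
/-- Finite sums of functions `sumProd k P w` with recognizable `P` and `w`. -/
def RecSeries : AddSubmonoid (PointedWord α V → Multiset (List R)) :=
  AddSubmonoid.closure {G | ∃ k P w, Rec P ∧ Rec w ∧ G = sumProd k P w}

variable (α R V) in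
/-- Finite sums of functions `condProd P w` with recognizable `P` and `w`. -/
def RecStepSeries : AddSubmonoid (PointedWord α V → Multiset (List R)) :=
  AddSubmonoid.closure {G | ∃ P w, Rec P ∧ Rec w ∧ G = condProd P w}

theorem condProd_congr {P : PointedWord α V → Prop} {w : PointedWord α (Option V) → R}
    {P' : PointedWord α V' → Prop} {w' : PointedWord α (Option V') → R}
    {u : List α} (hu hu' : u ≠ []) {σ : V → Fin u.length} {τ : V' → Fin u.length}
    (hP : P ⟨u, hu, σ⟩ ↔ P' ⟨u, hu', τ⟩)
    (hw : ∀ i, w ⟨u, hu, fun o => o.elim i σ⟩ = w' ⟨u, hu', fun o => o.elim i τ⟩) :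
    condProd P w ⟨u, hu, σ⟩ = condProd P' w' ⟨u, hu', τ⟩ := by
  classical
  unfold condProd
  exact if_congr hP (congrArg _ (congrArg List.ofFn (funext hw))) rfl

/-- Replaces the first of the summation variables by `none`. -/
def shiftVar {k : ℕ} : V ⊕ Fin (k + 1) → Option V ⊕ Fin k
  | .inl x => .inl (some x)
  | .inr j => Fin.cases (.inl none) .inr j

/-- Replaces `none` by the first of the summation variables. -/
def unshiftVar {k : ℕ} : Option V ⊕ Fin k → V ⊕ Fin (k + 1)
  | .inl (some x) => .inl x
  | .inl none => .inr 0
  | .inr j => .inr j.succ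

theorem shiftVar_unshiftVar {k : ℕ} (x : Option V ⊕ Fin k) : shiftVar (unshiftVar x) = x := by
  rcases x with (_ | x) | j <;> simp [shiftVar, unshiftVar]

theorem sumProd_succ {k : ℕ} (P : PointedWord α (V ⊕ Fin (k + 1)) → Prop)
    (w : PointedWord α (Option (V ⊕ Fin (k + 1))) → R) (p : PointedWord α V) :
    sumProd (k + 1) P w p = ∑ i, sumProd k (fun q => P (q.subst shiftVar))
      (fun q => w (q.subst (Option.map shiftVar))) (p.extend i) := by
  unfold sumProd
  rw [← (Fin.consEquiv fun _ : Fin (k + 1) => Fin p.word.length).sum_comp, Fintype.sum_prod_type]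
  refine Finset.sum_congr rfl fun i _ => Finset.sum_congr rfl fun τ _ => ?_
  have h : ∀ x, Sum.elim p.val (Fin.cons i τ : Fin (k + 1) → Fin p.word.length) x =
      Sum.elim (p.extend i).val τ (shiftVar x) := by
    rintro (x | j)
    · rfl
    · refine Fin.cases ?_ (fun j => ?_) j <;> rfl
  refine condProd_congr _ _ (iff_of_eq (congrArg P (ext_val _ _ h)))
    fun z => congrArg w (ext_val _ _ fun o => ?_)
  cases o with
  | none => rfl
  | some x => exact h x

theorem sumProd_zero (P : PointedWord α (V ⊕ Fin 0) → Prop)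
    (w : PointedWord α (Option (V ⊕ Fin 0)) → R) :
    sumProd 0 P w = condProd (fun q => P (q.subst (Sum.elim id Fin.elim0)))
      (fun q => w (q.subst (Option.map (Sum.elim id Fin.elim0)))) := by
  funext p
  rw [sumProd, Fintype.sum_unique]
  refine condProd_congr _ _ (iff_of_eq (congrArg P (ext_val _ _ ?_)))
    fun z => congrArg w (ext_val _ _ ?_)
  · rintro (x | j)
    · rfl
    · exact j.elim0
  · rintro (_ | x | j)
    · rfl
    · rfl
    · exact j.elim0

theorem sumProd_mem {k : ℕ} {P : PointedWord α (V ⊕ Fin k) → Prop} (hP : Rec P)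
    {w : PointedWord α (Option (V ⊕ Fin k)) → R} (hw : Rec w) :
    sumProd k P w ∈ RecSeries α R V :=
  AddSubmonoid.subset_closure ⟨k, P, w, hP, hw, rfl⟩

theorem condProd_mem_step {P : PointedWord α V → Prop} (hP : Rec P)
    {w : PointedWord α (Option V) → R} (hw : Rec w) : condProd P w ∈ RecStepSeries α R V :=
  AddSubmonoid.subset_closure ⟨P, w, hP, hw, rfl⟩

theorem condProd_mem {P : PointedWord α V → Prop} (hP : Rec P)
    {w : PointedWord α (Option V) → R} (hw : Rec w) : condProd P w ∈ RecSeries α R V := by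
  have := sumProd_mem (k := 0) (hP.subst .inl) (hw.subst (Option.map .inl))
  rw [sumProd_zero] at this
  convert this using 1
  funext p
  refine condProd_congr _ _ Iff.rfl fun z => congrArg w (ext_val _ _ fun o => ?_)
  cases o <;> rfl

namespace RecSeries

theorem sum_extend {G : PointedWord α (Option V) → Multiset (List R)}
    (hG : G ∈ RecSeries α R (Option V)) :
    (fun p => ∑ i, G (p.extend i)) ∈ RecSeries α R V := by
  induction hG using AddSubmonoid.closure_induction with
  | mem G hG =>
    obtain ⟨k, P, w, hP, hw, rfl⟩ := hG
    have := sumProd_mem (hP.subst unshiftVar) (hw.subst (Option.map unshiftVar))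
    convert this using 1
    funext p
    rw [sumProd_succ]
    refine Finset.sum_congr rfl fun i _ => ?_
    have h1 : ∀ q : PointedWord α (Option V ⊕ Fin k),
        (q.subst shiftVar).subst unshiftVar = q := fun q =>
      ext_val _ _ fun x => congrArg q.val (shiftVar_unshiftVar x)
    have h2 : ∀ q : PointedWord α (Option (Option V ⊕ Fin k)),
        (q.subst (Option.map shiftVar)).subst (Option.map unshiftVar) = q := fun q =>
      ext_val _ _ fun x => congrArg q.val (by cases x <;> simp [shiftVar_unshiftVar])
    simp only [h1, h2]
  | zero =>
    convert (RecSeries α R V).zero_mem using 1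
    funext p
    simp
  | add G H _ _ ihG ihH =>
    convert (RecSeries α R V).add_mem ihG ihH using 1
    funext p
    simp [Finset.sum_add_distrib]

open Classical in
theorem guard {P : PointedWord α V → Prop} (hP : Rec P)
    {G : PointedWord α V → Multiset (List R)} (hG : G ∈ RecSeries α R V) :
    (fun p => if P p then G p else 0) ∈ RecSeries α R V := by
  induction hG using AddSubmonoid.closure_induction with
  | mem G hG =>
    obtain ⟨k, Q, w, hQ, hw, rfl⟩ := hG
    convert sumProd_mem ((hP.subst .inl).and hQ) hw using 1
    funext p
    by_cases h : P p
    · rw [if_pos h]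
      refine Finset.sum_congr rfl fun τ _ => condProd_congr _ _ ?_ fun _ => rfl
      exact (and_iff_right h).symm
    · rw [if_neg h]
      refine (Finset.sum_eq_zero fun τ _ => if_neg fun h' => h h'.1).symm
  | zero =>
    convert (RecSeries α R V).zero_mem using 1
    funext p
    simp
  | add G H _ _ ihG ihH =>
    convert (RecSeries α R V).add_mem ihG ihH using 1
    funext p
    by_cases h : P p <;> simp [h]

/-- Substitution of variables, where `none` stands for the first position. -/
theorem subst_first {G : PointedWord α V → Multiset (List R)} (hG : G ∈ RecSeries α R V)
    (s : V → Option V') :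
    (fun p : PointedWord α V' => G ((p.extend p.first).subst s)) ∈ RecSeries α R V' := by
  induction hG using AddSubmonoid.closure_induction with
  | mem G hG =>
    obtain ⟨k, P, w, hP, hw, rfl⟩ := hG
    let s₁ : V ⊕ Fin k → Option (V' ⊕ Fin k) :=
      Sum.elim (fun x => (s x).map .inl) fun j => some (.inr j)
    let s₂ : Option (V ⊕ Fin k) → Option (Option (V' ⊕ Fin k)) :=
      fun o => o.elim (some none) fun x => (s₁ x).map some
    convert sumProd_mem (hP.subst s₁).extend_first (hw.subst s₂).extend_first using 1
    funext p
    have h : ∀ (τ : Fin k → Fin p.word.length) (x : V ⊕ Fin k),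
        Sum.elim ((p.extend p.first).subst s).val τ x =
          (((p.append τ).extend (p.append τ).first).subst s₁).val x := by
      rintro τ (x | j)
      · change (s x).elim p.first p.val = ((s x).map Sum.inl).elim p.first (Sum.elim p.val τ)
        cases s x <;> rfl
      · rfl
    refine Finset.sum_congr rfl fun τ _ => ?_
    refine condProd_congr _ _ (iff_of_eq (congrArg P (ext_val _ _ (h τ)))) fun i =>
      congrArg w (ext_val _ _ ?_)
    rintro (_ | x)
    · rfl
    · refine (h τ x).trans ?_
      change (s₁ x).elim p.first (Sum.elim p.val τ) =
        ((s₁ x).map some).elim p.first fun o => o.elim i (Sum.elim p.val τ)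
      cases s₁ x <;> rfl
  | zero => exact (RecSeries α R V').zero_mem
  | add G H _ _ ihG ihH => exact (RecSeries α R V').add_mem ihG ihH

theorem subst {G : PointedWord α V → Multiset (List R)} (hG : G ∈ RecSeries α R V)
    (s : V → V') : (fun p : PointedWord α V' => G (p.subst s)) ∈ RecSeries α R V' :=
  subst_first hG fun x => some (s x)

open Classical in
theorem ite {P : PointedWord α V → Prop} (hP : Rec P)
    {G H : PointedWord α V → Multiset (List R)} (hG : G ∈ RecSeries α R V)
    (hH : H ∈ RecSeries α R V) :
    (fun p => if P p then G p else H p) ∈ RecSeries α R V := by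
  convert (RecSeries α R V).add_mem (guard hP hG) (guard hP.not hH) using 1
  funext p
  by_cases h : P p <;> simp [h]

end RecSeries

/-! ### Formulas define recognizable series -/

/-- The substitution of `none` for the variable `x`. -/
def bindVar (x y : ℕ) : Option ℕ := if y = x then none else some y

theorem extend_subst_bindVar (p : PointedWord α ℕ) (x : ℕ) (i : Fin p.word.length) :
    (p.extend i).subst (bindVar x) = ⟨p.word, p.ne, Function.update p.val x i⟩ :=
  ext_val _ _ fun y => by
    by_cases h : y = x
    · subst h; simp [bindVar, extend]
    · simp [bindVar, extend, h]

theorem FOFormula.rec_sat (φ : FOFormula α) :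
    Rec fun p : PointedWord α ℕ => φ.Sat p.word p.val := by
  induction φ with
  | top => exact Rec.const True
  | letter a x => exact Rec.letter a x
  | le x y => exact Rec.le x y
  | not φ ih => exact ih.not
  | and φ ψ ih₁ ih₂ => exact ih₁.and ih₂
  | all x φ ih =>
    convert (ih.subst (bindVar x)).all using 1
    exact funext fun p => propext <| forall_congr' fun i => iff_of_eq <|
      congrArg (fun q : PointedWord α ℕ => φ.Sat q.word q.val) (extend_subst_bindVar p x i).symm

theorem StepWFO.rec_sem (Ψ : StepWFO α R) :
    Rec fun p : PointedWord α ℕ => Ψ.sem p.word p.val := by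
  classical
  induction Ψ with
  | const r => exact Rec.const r
  | ite φ Ψ₁ Ψ₂ ih₁ ih₂ =>
    convert φ.rec_sat.ite ih₁ ih₂ using 2
    simp only [sem]

theorem WFO.sem_mem_recSeries (Φ : WFO α R) :
    (fun p : PointedWord α ℕ => Φ.sem p.word p.val) ∈ RecSeries α R ℕ := by
  classical
  induction Φ with
  | zero => exact (RecSeries α R ℕ).zero_mem
  | prod x Ψ =>
    convert condProd_mem (Rec.const True) (Ψ.rec_sem.subst (bindVar x)) using 1
    funext p
    rw [condProd, if_pos trivial]
    exact congrArg (fun l => ({l} : Multiset (List R))) <| congrArg List.ofFn <| funext fun i =>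
      congrArg (fun q : PointedWord α ℕ => Ψ.sem q.word q.val) (extend_subst_bindVar p x i).symm
  | ite φ Φ₁ Φ₂ ih₁ ih₂ =>
    convert RecSeries.ite φ.rec_sat ih₁ ih₂ using 2
    simp only [sem]
  | add Φ₁ Φ₂ ih₁ ih₂ => exact (RecSeries α R ℕ).add_mem ih₁ ih₂
  | sum x Φ ih =>
    convert RecSeries.sum_extend (RecSeries.subst ih (bindVar x)) using 1
    exact funext fun p => Finset.sum_congr rfl fun i _ =>
      congrArg (fun q : PointedWord α ℕ => Φ.sem q.word q.val) (extend_subst_bindVar p x i).symm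

/-- The pointed word without variables given by a nonempty word. -/
def pureWord (u : {u : List α // u ≠ []}) : PointedWord α Empty := ⟨u.1, u.2, Empty.elim⟩

theorem WFO.exists_recSeries (Φ : WFO α R) :
    ∃ G ∈ RecSeries α R Empty, ∀ u, Φ.usem u = G (pureWord u) :=
  ⟨_, RecSeries.subst_first Φ.sem_mem_recSeries fun _ => none, fun _ => rfl⟩

end Series

/-! ### Recognizable series are defined by formulas -/

section Definable

variable {α : Type u} {R : Type v} {V : Type}

/-- `F` is given by a step formula, whatever the names `e` of its variables. -/
def StepDef (F : PointedWord α V → R) : Prop :=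
  ∀ e : V → ℕ, ∃ Ψ : StepWFO α R, (∀ x ∈ Ψ.freeVars, x ∈ Set.range e) ∧
    ∀ (u : List α) (hu : u ≠ []) (σ : ℕ → Fin u.length),
      Ψ.sem u σ = F ⟨u, hu, fun x => σ (e x)⟩

/-- `G` is given by a formula in the class `C`, whatever the names `e` of its variables. -/
def WFODef (C : WFO α R → Prop) (G : PointedWord α V → Multiset (List R)) : Prop :=
  ∀ e : V → ℕ, ∃ Φ : WFO α R, C Φ ∧ (∀ x ∈ Φ.freeVars, x ∈ Set.range e) ∧
    ∀ (u : List α) (hu : u ≠ []) (σ : ℕ → Fin u.length),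
      Φ.sem u σ = G ⟨u, hu, fun x => σ (e x)⟩

theorem Rec.stepDef [Finite α] [Finite V] [Nonempty R] {F : PointedWord α V → R} (hF : Rec F) :
    StepDef F := by
  classical
  obtain ⟨n, f, hf, h⟩ := hF
  intro e
  have key : ∀ s : Finset (Fin n), ∃ Ψ : StepWFO α R, (∀ x ∈ Ψ.freeVars, x ∈ Set.range e) ∧
      ∀ (u : List α) (hu : u ≠ []) (σ : ℕ → Fin u.length),
        f (⟨u, hu, fun x => σ (e x)⟩ : PointedWord α V).mark ∈ s →
        Ψ.sem u σ = F ⟨u, hu, fun x => σ (e x)⟩ := by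
    intro s
    induction s using Finset.induction_on with
    | empty => exact ⟨.const (Classical.arbitrary R), by simp [StepWFO.freeVars], by simp⟩
    | insert t s _ ih =>
      obtain ⟨Ψ, hΨ, hΨ'⟩ := ih
      by_cases ht : ∃ q : PointedWord α V, f q.mark = t
      · obtain ⟨q, hq⟩ := ht
        obtain ⟨φ, hφ, hφ'⟩ := hf.foDef t e
        refine ⟨.ite φ (.const (F q)) Ψ, ?_, fun u hu σ hs => ?_⟩
        · simp only [StepWFO.freeVars, Finset.mem_union, Finset.notMem_empty, or_false]
          exact fun x hx => hx.elim (hφ x) (hΨ x)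
        · rw [StepWFO.sem]
          split_ifs with hsat
          · exact (h _ _ (((hφ' u hu σ).1 hsat).trans hq.symm)).symm
          · refine hΨ' u hu σ ((Finset.mem_insert.1 hs).resolve_left fun ht => ?_)
            exact hsat ((hφ' u hu σ).2 ht)
      · refine ⟨Ψ, hΨ, fun u hu σ hs => hΨ' u hu σ ?_⟩
        exact (Finset.mem_insert.1 hs).resolve_left fun h' => ht ⟨_, h'⟩
  obtain ⟨Ψ, hΨ, hΨ'⟩ := key Finset.univ
  exact ⟨Ψ, hΨ, fun u hu σ => hΨ' u hu σ (Finset.mem_univ _)⟩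

namespace WFODef

variable {C : WFO α R → Prop}

theorem zero (hC : C .zero) : WFODef C (0 : PointedWord α V → Multiset (List R)) :=
  fun _ => ⟨.zero, hC, by simp [WFO.freeVars], fun _ _ _ => rfl⟩

theorem add (hC : ∀ Φ₁ Φ₂, C Φ₁ → C Φ₂ → C (.add Φ₁ Φ₂))
    {G H : PointedWord α V → Multiset (List R)} (hG : WFODef C G) (hH : WFODef C H) :
    WFODef C (G + H) := by
  intro e
  obtain ⟨Φ₁, h₁, h₁', h₁''⟩ := hG e
  obtain ⟨Φ₂, h₂, h₂', h₂''⟩ := hH e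
  refine ⟨.add Φ₁ Φ₂, hC _ _ h₁ h₂, ?_, fun u hu σ => ?_⟩
  · simp only [WFO.freeVars, Finset.mem_union]
    exact fun x hx => hx.elim (h₁' x) (h₂' x)
  · rw [WFO.sem, h₁'' u hu, h₂'' u hu]
    rfl

open Classical in
theorem ite (hC : ∀ φ Φ₁ Φ₂, C Φ₁ → C Φ₂ → C (.ite φ Φ₁ Φ₂)) {P : PointedWord α V → Prop}
    (hP : FODef P) {G H : PointedWord α V → Multiset (List R)} (hG : WFODef C G)
    (hH : WFODef C H) : WFODef C fun p => if P p then G p else H p := by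
  intro e
  obtain ⟨φ, h₀, h₀'⟩ := hP e
  obtain ⟨Φ₁, h₁, h₁', h₁''⟩ := hG e
  obtain ⟨Φ₂, h₂, h₂', h₂''⟩ := hH e
  refine ⟨.ite φ Φ₁ Φ₂, hC _ _ _ h₁ h₂, ?_, fun u hu σ => ?_⟩
  · simp only [WFO.freeVars, Finset.mem_union]
    exact fun x hx => hx.elim (fun hx => hx.elim (h₀ x) (h₁' x)) (h₂' x)
  · rw [WFO.sem, h₁'' u hu, h₂'' u hu]
    exact if_congr (h₀' u hu σ) rfl rfl

theorem sum [Finite V] (hC : ∀ x Φ, C Φ → C (.sum x Φ))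
    {G : PointedWord α (Option V) → Multiset (List R)} (hG : WFODef C G) :
    WFODef C fun p : PointedWord α V => ∑ i, G (p.extend i) := by
  intro e
  obtain ⟨z, hz⟩ := (Set.finite_range e).exists_notMem
  obtain ⟨Φ, hΦ, h, h'⟩ := hG fun o => o.elim z e
  refine ⟨.sum z Φ, hC _ _ hΦ, fun x hx => ?_, fun u hu σ => ?_⟩
  · obtain ⟨hx, hx'⟩ := Finset.mem_erase.1 hx
    obtain ⟨o, rfl⟩ := h x hx'
    cases o with
    | none => exact absurd rfl hx
    | some y => exact ⟨y, rfl⟩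
  · rw [WFO.sem]
    refine Finset.sum_congr rfl fun i _ => (h' u hu _).trans (congrArg G ?_)
    refine ext_val hu hu fun o => ?_
    cases o with
    | none => simp
    | some y =>
      have : e y ≠ z := fun hy => hz ⟨y, hy⟩
      simp [this]

theorem prod [Finite V] (hC : ∀ x Ψ, C (.prod x Ψ)) {w : PointedWord α (Option V) → R}
    (hw : StepDef w) :
    WFODef C fun p : PointedWord α V => {List.ofFn fun i => w (p.extend i)} := by
  intro e
  obtain ⟨z, hz⟩ := (Set.finite_range e).exists_notMem
  obtain ⟨Ψ, h, h'⟩ := hw fun o => o.elim z e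
  refine ⟨.prod z Ψ, hC _ _, fun x hx => ?_, fun u hu σ => ?_⟩
  · obtain ⟨hx, hx'⟩ := Finset.mem_erase.1 hx
    obtain ⟨o, rfl⟩ := h x hx'
    cases o with
    | none => exact absurd rfl hx
    | some y => exact ⟨y, rfl⟩
  · rw [WFO.sem]
    refine congrArg (fun l => ({l} : Multiset (List R))) (congrArg List.ofFn (funext fun i =>
      (h' u hu _).trans (congrArg w ?_)))
    refine ext_val hu hu fun o => ?_
    cases o with
    | none => simp
    | some y =>
      have : e y ≠ z := fun hy => hz ⟨y, hy⟩
      simp [this]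

theorem condProd [Finite α] [Finite V] (h0 : C .zero) (hprod : ∀ x Ψ, C (.prod x Ψ))
    (hite : ∀ φ Φ₁ Φ₂, C Φ₁ → C Φ₂ → C (.ite φ Φ₁ Φ₂)) {P : PointedWord α V → Prop} (hP : Rec P)
    {w : PointedWord α (Option V) → R} (hw : Rec w) : WFODef C (condProd P w) := by
  by_cases hR : Nonempty R
  · exact ite hite hP.foDef (prod hprod hw.stepDef) (zero h0)
  · have : _root_.condProd P w = 0 := funext fun p =>
      absurd ⟨w (p.extend p.first)⟩ hR
    rw [this]
    exact zero h0

theorem sumProd [Finite α] (h0 : C .zero) (hprod : ∀ x Ψ, C (.prod x Ψ))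
    (hite : ∀ φ Φ₁ Φ₂, C Φ₁ → C Φ₂ → C (.ite φ Φ₁ Φ₂)) (hsum : ∀ x Φ, C Φ → C (.sum x Φ))
    (k : ℕ) : ∀ (V : Type) [Finite V] {P : PointedWord α (V ⊕ Fin k) → Prop} (_ : Rec P)
    {w : PointedWord α (Option (V ⊕ Fin k)) → R} (_ : Rec w), WFODef C (sumProd k P w) := by
  induction k with
  | zero =>
    intro V _ P hP w hw
    rw [sumProd_zero]
    exact condProd h0 hprod hite (hP.subst _) (hw.subst _)
  | succ k ih =>
    intro V _ P hP w hw
    rw [show _root_.sumProd (k + 1) P w = _ from funext (sumProd_succ P w)]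
    exact sum hsum (ih (Option V) (hP.subst _) (hw.subst _))

end WFODef

theorem RecSeries.wfoDef [Finite α] [Finite V] {G : PointedWord α V → Multiset (List R)}
    (hG : G ∈ RecSeries α R V) : WFODef (fun _ => True) G := by
  induction hG using AddSubmonoid.closure_induction with
  | mem G hG =>
    obtain ⟨k, P, w, hP, hw, rfl⟩ := hG
    exact WFODef.sumProd trivial (fun _ _ => trivial) (fun _ _ _ _ _ => trivial)
      (fun _ _ _ => trivial) k V hP hw
  | zero => exact .zero trivial
  | add G H _ _ ihG ihH => exact ihG.add (fun _ _ _ _ => trivial) ihH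

theorem RecStepSeries.wfoDef [Finite α] [Finite V] {G : PointedWord α V → Multiset (List R)}
    (hG : G ∈ RecStepSeries α R V) : WFODef WFO.NoFirstOrderSum G := by
  induction hG using AddSubmonoid.closure_induction with
  | mem G hG =>
    obtain ⟨P, w, hP, hw, rfl⟩ := hG
    exact WFODef.condProd trivial (fun _ _ => trivial) (fun _ _ _ h h' => ⟨h, h'⟩) hP hw
  | zero => exact .zero trivial
  | add G H _ _ ihG ihH => exact ihG.add (fun _ _ h h' => ⟨h, h'⟩) ihH

theorem RecStepSeries.rec_eq_zero {G : PointedWord α V → Multiset (List R)}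
    (hG : G ∈ RecStepSeries α R V) : Rec fun p => G p = 0 := by
  induction hG using AddSubmonoid.closure_induction with
  | mem G hG =>
    obtain ⟨P, w, hP, hw, rfl⟩ := hG
    convert hP.not using 2
    simp [condProd]
  | zero => simpa using Rec.const True
  | add G H _ _ ihG ihH => simpa using ihG.and ihH

theorem RecStepSeries.wfoDef_of_card_le_one [Finite α] [Finite V]
    {G : PointedWord α V → Multiset (List R)} (hG : G ∈ RecStepSeries α R V)
    (h1 : ∀ p, (G p).card ≤ 1) :
    WFODef (fun Φ => Φ.NoBinarySum ∧ Φ.NoFirstOrderSum) G := by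
  classical
  induction hG using AddSubmonoid.closure_induction with
  | mem G hG =>
    obtain ⟨P, w, hP, hw, rfl⟩ := hG
    exact WFODef.condProd ⟨trivial, trivial⟩ (fun _ _ => ⟨trivial, trivial⟩)
      (fun _ _ _ h h' => ⟨⟨h.1, h'.1⟩, h.2, h'.2⟩) hP hw
  | zero => exact .zero ⟨trivial, trivial⟩
  | add G H hG hH ihG ihH =>
    have hc : ∀ p, (G p).card + (H p).card ≤ 1 := fun p => by simpa using h1 p
    have := WFODef.ite (fun _ _ _ h h' => ⟨⟨h.1, h'.1⟩, h.2, h'.2⟩)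
      (RecStepSeries.rec_eq_zero hG).foDef (ihH fun p => by have := hc p; lia)
      (ihG fun p => by have := hc p; lia)
    convert this using 1
    funext p
    by_cases h : G p = 0
    · simp [h]
    · have h0 := Multiset.card_pos.2 h
      have : H p = 0 := Multiset.card_eq_zero.1 (by have := hc p; lia)
      simp [h, this]

/-! ### Bounded recognizable series -/

/-- The value of `F` at the only position that satisfies `Q` is recognizable. -/
theorem Rec.exists_select {X : Type*} [Nonempty X] {Q : PointedWord α (Option V) → Prop}
    (hQ : Rec Q) {F : PointedWord α (Option V) → X} (hF : Rec F)
    (huniq : ∀ (p : PointedWord α V) i j, Q (p.extend i) → Q (p.extend j) → i = j) :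
    ∃ G : PointedWord α V → X, Rec G ∧ ∀ p i, Q (p.extend i) → G p = F (p.extend i) := by
  classical
  refine ⟨_, (hQ.prodMk hF).range_extend.comp fun S => if h : ∃ x, (True, x) ∈ S then h.choose
    else Classical.arbitrary X, fun p i hi => ?_⟩
  have h : ∃ x, (True, x) ∈ Set.range fun i => (Q (p.extend i), F (p.extend i)) :=
    ⟨F (p.extend i), i, by simp [hi]⟩
  rw [dif_pos h]
  obtain ⟨j, hj⟩ := h.choose_spec
  simp only [Prod.mk.injEq, eq_iff_iff, iff_true] at hj
  rw [← hj.2, huniq p i j hi hj.1]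

theorem exists_sum_condProd_eq {P : PointedWord α (Option V) → Prop} (hP : Rec P)
    {w : PointedWord α (Option (Option V)) → R} (hw : Rec w)
    (huniq : ∀ (p : PointedWord α V) i j, P (p.extend i) → P (p.extend j) → i = j) :
    ∃ w' : PointedWord α (Option V) → R, Rec w' ∧
      ∀ p : PointedWord α V, ∑ i, condProd P w (p.extend i) =
        condProd (fun p => ∃ i, P (p.extend i)) w' p := by
  classical
  by_cases hR : Nonempty R
  · let s : Option (Option V) → Option (Option V)
      | none => some none
      | some none => none
      | some (some x) => some (some x)
    have hskip : ∀ (q : PointedWord α (Option V)) (i : Fin q.word.length),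
        (q.extend i).subst skip = (q.subst some).extend i := fun q i =>
      ext_val _ _ fun o => by cases o <;> rfl
    obtain ⟨w', hw', h⟩ := (hP.subst skip).exists_select (hw.subst s) (fun q i j hi hj => by
      rw [hskip] at hi hj
      exact huniq (q.subst some) i j hi hj)
    refine ⟨w', hw', fun p => ?_⟩
    by_cases hex : ∃ i, P (p.extend i)
    · obtain ⟨i, hi⟩ := hex
      rw [Finset.sum_eq_single i, condProd, condProd, if_pos hi, if_pos ⟨i, hi⟩]
      · refine congrArg (fun l => ({l} : Multiset (List R))) (congrArg List.ofFn (funext fun z => ?_))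
        refine Eq.trans (congrArg w ?_) (h (p.extend z) i 
          (cast (congrArg P (extend_extend_subst_skip p z i).symm) hi)).symm
        exact ext_val _ _ fun o => by rcases o with _ | _ | x <;> rfl
      · exact fun j _ hj => if_neg fun hj' => hj (huniq p j i hj' hi)
      · simp
    · rw [condProd, if_neg hex]
      exact Finset.sum_eq_zero fun i _ => if_neg fun hi => hex ⟨i, hi⟩
  · have hempty : ∀ p : PointedWord α (Option V), False := fun p =>
      hR ⟨w (p.extend p.first)⟩
    obtain ⟨n, f, hf, -⟩ := Rec.const (α := α) (V := Option V) ()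
    exact ⟨fun p => (hempty p).elim, ⟨n, f, hf, fun p => (hempty p).elim⟩, fun p =>
      (hempty (p.extend p.first)).elim⟩

theorem sum_condProd_mem_of_card_le (K : ℕ) : ∀ {P : PointedWord α (Option V) → Prop} (_ : Rec P)
    {w : PointedWord α (Option (Option V)) → R} (_ : Rec w),
    (∀ p : PointedWord α V, (∑ i, condProd P w (p.extend i)).card ≤ K) →
    (fun p : PointedWord α V => ∑ i, condProd P w (p.extend i)) ∈ RecStepSeries α R V := by
  classical
  induction K with
  | zero =>
    intro P _ w _ h
    convert (RecStepSeries α R V).zero_mem using 1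
    exact funext fun p => Multiset.card_eq_zero.1 (Nat.le_zero.1 (h p))
  | succ K ih =>
    intro P hP w hw h
    let E : PointedWord α (Option V) → Prop := fun q => ∃ j,
      (q.extend j).val none < (q.extend j).val (some none) ∧ P ((q.extend j).subst skip)
    have hE : Rec E := ((Rec.lt none (some none)).and (hP.subst skip)).ex
    have hEiff : ∀ (p : PointedWord α V) (i : Fin p.word.length),
        E (p.extend i) ↔ ∃ j < i, P (p.extend j) := fun p i =>
      exists_congr fun j => and_congr_right fun _ =>
        iff_of_eq (congrArg P (extend_extend_subst_skip p i j))
    have huniq : ∀ (p : PointedWord α V) i j, (P (p.extend i) ∧ ¬ E (p.extend i)) →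
        (P (p.extend j) ∧ ¬ E (p.extend j)) → i = j := by
      rintro p i j ⟨hi, hi'⟩ ⟨hj, hj'⟩
      rw [hEiff] at hi' hj'
      rcases lt_trichotomy i j with hlt | heq | hlt
      · exact absurd ⟨i, hlt, hi⟩ hj'
      · exact heq
      · exact absurd ⟨j, hlt, hj⟩ hi'
    obtain ⟨w', hw', hsum⟩ := exists_sum_condProd_eq (hP.and hE.not) hw huniq
    have hsplit : ∀ p : PointedWord α V, ∑ i, condProd P w (p.extend i) =
        condProd (fun p => ∃ i, P (p.extend i) ∧ ¬ E (p.extend i)) w' p +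
          ∑ i, condProd (fun q => P q ∧ E q) w (p.extend i) := by
      intro p
      rw [← hsum, ← Finset.sum_add_distrib]
      refine Finset.sum_congr rfl fun i _ => ?_
      by_cases h1 : P (p.extend i) <;> by_cases h2 : E (p.extend i) <;> simp [condProd, h1, h2]
    have hrest := ih (hP.and hE) hw fun p => by
      by_cases hex : ∃ i, P (p.extend i)
      · obtain ⟨i, hi, hi'⟩ := WellFounded.has_min (wellFounded_lt (α := Fin p.word.length))
          {i | P (p.extend i)} hex
        have h1 : (condProd (fun p => ∃ i, P (p.extend i) ∧ ¬ E (p.extend i)) w' p).card = 1 := by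
          have hmin : ¬ E (p.extend i) := by
            rw [hEiff]
            rintro ⟨j, hj, hj'⟩
            exact hi' j hj' hj
          rw [condProd, if_pos ⟨i, hi, hmin⟩, Multiset.card_singleton]
        have := h p
        rw [hsplit, Multiset.card_add, h1] at this
        lia
      · rw [Finset.sum_eq_zero fun i _ => show condProd _ w (p.extend i) = 0 from
          if_neg fun hi => hex ⟨i, hi.1⟩]
        simp
    have := (RecStepSeries α R V).add_mem (condProd_mem_step (hP.and hE.not).ex hw') hrest
    convert this using 1
    exact funext hsplit

theorem RecStepSeries.sum_extend {G : PointedWord α (Option V) → Multiset (List R)}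
    (hG : G ∈ RecStepSeries α R (Option V)) {K : ℕ}
    (hK : ∀ p : PointedWord α V, (∑ i, G (p.extend i)).card ≤ K) :
    (fun p => ∑ i, G (p.extend i)) ∈ RecStepSeries α R V := by
  induction hG using AddSubmonoid.closure_induction with
  | mem G hG =>
    obtain ⟨P, w, hP, hw, rfl⟩ := hG
    exact sum_condProd_mem_of_card_le K hP hw hK
  | zero =>
    convert (RecStepSeries α R V).zero_mem using 1
    funext p
    simp
  | add G H _ _ ihG ihH =>
    have hs : ∀ p : PointedWord α V, (∑ i, G (p.extend i)).card + (∑ i, H (p.extend i)).card ≤ K :=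
      fun p => by
        have := hK p
        simpa only [Pi.add_apply, Finset.sum_add_distrib, Multiset.card_add] using this
    convert (RecStepSeries α R V).add_mem (ihG fun p => by have := hs p; lia)
      (ihH fun p => by have := hs p; lia) using 1
    funext p
    simp [Finset.sum_add_distrib]

theorem sumProd_mem_step_of_card_le (K k : ℕ) : ∀ {V : Type}
    {P : PointedWord α (V ⊕ Fin k) → Prop} (_ : Rec P)
    {w : PointedWord α (Option (V ⊕ Fin k)) → R} (_ : Rec w),
    (∀ p, (sumProd k P w p).card ≤ K) → sumProd k P w ∈ RecStepSeries α R V := by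
  induction k with
  | zero =>
    intro V P hP w hw _
    rw [sumProd_zero]
    exact condProd_mem_step (hP.subst _) (hw.subst _)
  | succ k ih =>
    intro V P hP w hw hK
    rw [show sumProd (k + 1) P w = _ from funext (sumProd_succ P w)]
    have hK' : ∀ p : PointedWord α V, (∑ i, sumProd k (fun q => P (q.subst shiftVar))
        (fun q => w (q.subst (Option.map shiftVar))) (p.extend i)).card ≤ K := fun p => by
      rw [← sumProd_succ]
      exact hK p
    refine RecStepSeries.sum_extend (ih (hP.subst _) (hw.subst _) fun q => ?_) hK'
    have hq : (q.subst some).extend (q.val none) = q :=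
      ext_val _ _ fun o => by cases o <;> rfl
    have := hK' (q.subst some)
    rw [Multiset.card_sum] at this
    refine (le_of_eq (by rw [hq])).trans ((Finset.single_le_sum
      (f := fun i => (sumProd k (fun q => P (q.subst shiftVar))
        (fun q => w (q.subst (Option.map shiftVar))) ((q.subst some).extend i)).card)
      (fun _ _ => Nat.zero_le _) (Finset.mem_univ (q.val none))).trans this)

theorem RecSeries.mem_step_of_card_le {G : PointedWord α V → Multiset (List R)}
    (hG : G ∈ RecSeries α R V) {K : ℕ} (hK : ∀ p, (G p).card ≤ K) :
    G ∈ RecStepSeries α R V := by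
  induction hG using AddSubmonoid.closure_induction with
  | mem G hG =>
    obtain ⟨k, P, w, hP, hw, rfl⟩ := hG
    exact sumProd_mem_step_of_card_le K k hP hw hK
  | zero => exact (RecStepSeries α R V).zero_mem
  | add G H _ _ ihG ihH =>
    have hs : ∀ p, (G p).card + (H p).card ≤ K := fun p => by simpa using hK p
    exact (RecStepSeries α R V).add_mem (ihG fun p => by have := hs p; lia)
      (ihH fun p => by have := hs p; lia)

theorem WFODef.exists_sentence {C : WFO α R → Prop} {G : PointedWord α Empty → Multiset (List R)}
    (hG : WFODef C G) : ∃ Φ : WFO α R, Φ.IsSentence ∧ C Φ ∧ Φ.usem = fun u => G (pureWord u) := by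
  obtain ⟨Φ, hC, hfv, hsem⟩ := hG Empty.elim
  refine ⟨Φ, Finset.eq_empty_of_forall_notMem fun x hx => ?_, hC, funext fun u => ?_⟩
  · obtain ⟨y, -⟩ := hfv x hx
    exact y.elim
  · exact (hsem u.1 u.2 _).trans (congrArg G (ext_val _ _ fun x => x.elim))

end Definable

/-! ### Runs of weighted automata -/

namespace WAutomaton

variable {α : Type u} {R : Type v} (A : WAutomaton α R)

variable {A} in
theorem isRun_append {ρ ρ' : List A.Δ} : ∀ {p q : A.State},
    A.IsRun p (ρ ++ ρ') q ↔ ∃ r, A.IsRun p ρ r ∧ A.IsRun r ρ' q := by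
  induction ρ with
  | nil => simp [IsRun]
  | cons δ ρ ih =>
    intro p q
    simp [IsRun, ih, and_assoc]

theorem label_append (ρ ρ' : List A.Δ) : A.label (ρ ++ ρ') = A.label ρ ++ A.label ρ' := by
  simp [label]

variable {A} in
theorem append_mem_lang {p q : A.State} {x y : List α} :
    x ++ y ∈ A.lang p q ↔ ∃ r, x ∈ A.lang p r ∧ y ∈ A.lang r q := by
  constructor
  · rintro ⟨ρ, hρ, hl⟩
    obtain ⟨ρ₁, ρ₂, rfl, h₁, h₂⟩ := List.map_eq_append_iff.1 hl
    obtain ⟨r, hr, hr'⟩ := isRun_append.1 hρ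
    exact ⟨r, ⟨ρ₁, hr, h₁⟩, ⟨ρ₂, hr', h₂⟩⟩
  · rintro ⟨r, ⟨ρ₁, hr, h₁⟩, ⟨ρ₂, hr', h₂⟩⟩
    exact ⟨ρ₁ ++ ρ₂, isRun_append.2 ⟨r, hr, hr'⟩, by rw [label_append, h₁, h₂]⟩

theorem aperiodic_iff : A.Aperiodic ↔
    AperiodicCongr fun x : List α => {s : A.State × A.State | x ∈ A.lang s.1 s.2} := by
  constructor
  · rintro ⟨m, hm, h⟩
    refine ⟨fun {x x' y y'} hx hy => Set.ext fun s => ?_, m, fun x => Set.ext fun s => ?_⟩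
    · have hx' := fun r => Set.ext_iff.1 hx (s.1, r)
      have hy' := fun r => Set.ext_iff.1 hy (r, s.2)
      simp only [Set.mem_ofPred_eq] at hx' hy' ⊢
      simp only [append_mem_lang, hx', hy']
    · by_cases hx : x = []
      · simp [hx, wordPow_nil]
      · exact h s.1 s.2 x hx
  · intro h
    obtain ⟨N, hN⟩ := h.exists_pow
    refine ⟨N + 1, by lia, fun p q x _ => ?_⟩
    exact Set.ext_iff.1 (h.pow_of_le hN (Nat.le_succ N) x) (p, q)

theorem finite_successfulRuns [Finite α] (x : List α) : (A.successfulRuns x).Finite := by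
  refine (List.finite_length_eq A.Δ x.length).subset ?_
  rintro ρ ⟨p, -, q, -, -, h⟩
  simp [← h, label]

variable {A} in
theorem IsRun.unique {ρ : List A.Δ} (hρ : ρ ≠ []) : ∀ {p q p' q' : A.State},
    A.IsRun p ρ q → A.IsRun p' ρ q' → p = p' ∧ q = q' := by
  induction ρ with
  | nil => exact absurd rfl hρ
  | cons δ ρ ih =>
    rintro p q p' q' ⟨rfl, h⟩ ⟨rfl, h'⟩
    refine ⟨rfl, ?_⟩
    by_cases hρ' : ρ = []
    · subst hρ'
      exact (show _ = _ from h).symm.trans h'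
    · exact (ih hρ' h h').2

theorem usemFrom_eq_sum [Finite α] (p q : A.State) (x : List α) :
    A.usemFrom p q x = ∑ ρ ∈ (A.finite_runs p q x).toFinset, {A.weight ρ} := by
  rw [usemFrom, ← Multiset.sum_map_singleton (Multiset.map _ _), Multiset.map_map]
  rfl

theorem usem_eq_sum [Finite α] (x : {x : List α // x ≠ []}) :
    A.usem x = ∑ ρ ∈ (A.finite_successfulRuns x.1).toFinset, {A.weight ρ} := by
  classical
  have h : (A.finite_successfulRuns x.1).toFinset =
      (A.init.toFinite.toFinset ×ˢ A.final.toFinite.toFinset).biUnion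
        fun s => (A.finite_runs s.1 s.2 x.1).toFinset := by
    ext ρ
    simp [successfulRuns]
  rw [h, Finset.sum_biUnion, Finset.sum_product]
  · exact Finset.sum_congr rfl fun p _ => Finset.sum_congr rfl fun q _ =>
      A.usemFrom_eq_sum p q x.1
  · intro s _ s' _ hs
    rw [Function.onFun, Finset.disjoint_left]
    intro ρ hρ hρ'
    rw [Set.Finite.mem_toFinset] at hρ hρ'
    have hne : ρ ≠ [] := by
      rintro rfl
      exact x.2 hρ.2.symm
    have := hρ.1.unique hne hρ'.1
    exact hs (Prod.ext this.1 this.2)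

theorem card_usem [Finite α] (x : {x : List α // x ≠ []}) :
    ((A.usem x).card : ℕ∞) = (A.successfulRuns x.1).encard := by
  rw [usem_eq_sum, Multiset.card_sum, (A.finite_successfulRuns x.1).encard_eq_coe_toFinset_card]
  simp

/-! ### Sums of automata -/

/-- An automaton without states. -/
def empty (α : Type u) (R : Type v) : WAutomaton α R where
  State := Empty
  finite_state := inferInstance
  Δ := ∅
  wgt δ := δ.2.elim
  init := ∅
  final := ∅

theorem empty_usem [Finite α] (x) : (empty α R).usem x = 0 := by
  simp [usem, empty]

theorem empty_aperiodic : (empty α R).Aperiodic := ⟨1, le_rfl, fun p => p.elim⟩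

variable (B : WAutomaton α R)

/-- A transition of one of two automata as a transition of their sum. -/
def sumTransition : A.Δ ⊕ B.Δ → (A.State ⊕ B.State) × α × (A.State ⊕ B.State)
  | .inl δ => (.inl δ.1.1, δ.1.2.1, .inl δ.1.2.2)
  | .inr δ => (.inr δ.1.1, δ.1.2.1, .inr δ.1.2.2)

theorem sumTransition_injective : Function.Injective (sumTransition A B) := by
  rintro (⟨⟨p, a, q⟩, h⟩ | ⟨⟨p, a, q⟩, h⟩) (⟨⟨p', a', q'⟩, h'⟩ | ⟨⟨p', a', q'⟩, h'⟩) <;>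
    simp [sumTransition]

/-- The disjoint union of two automata. -/
noncomputable def sum : WAutomaton α R where
  State := A.State ⊕ B.State
  finite_state := inferInstance
  Δ := Set.range (sumTransition A B)
  wgt δ := Sum.elim A.wgt B.wgt δ.2.choose
  init := Sum.elim A.init B.init
  final := Sum.elim A.final B.final

/-- The transitions of the disjoint union. -/
def sumMk (δ : A.Δ ⊕ B.Δ) : (sum A B).Δ := ⟨_, δ, rfl⟩

theorem sumMk_injective : Function.Injective (sumMk A B) := fun _ _ h =>
  sumTransition_injective A B (congrArg Subtype.val h)

theorem wgt_sumMk (δ : A.Δ ⊕ B.Δ) : (sum A B).wgt (sumMk A B δ) = Sum.elim A.wgt B.wgt δ := by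
  have h : ∃ δ', sumTransition A B δ' = (sumMk A B δ).1 := (sumMk A B δ).2
  exact congrArg (Sum.elim A.wgt B.wgt) (sumTransition_injective A B h.choose_spec)

theorem sum_isRun_inl {ρ : List (sum A B).Δ} : ∀ {p : A.State} {q : (sum A B).State},
    (sum A B).IsRun (Sum.inl p) ρ q ↔ ∃ q' ρ', q = Sum.inl q' ∧ A.IsRun p ρ' q' ∧
      ρ = ρ'.map fun δ => sumMk A B (.inl δ) := by
  induction ρ with
  | nil =>
    intro p q
    constructor
    · rintro h
      exact ⟨p, [], (show _ = _ from h).symm, rfl, rfl⟩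
    · rintro ⟨q', ρ', rfl, h, hρ⟩
      obtain rfl := List.map_eq_nil_iff.1 hρ.symm
      exact congrArg Sum.inl h
  | cons δ ρ ih =>
    intro p q
    constructor
    · obtain ⟨_, δ | δ, rfl⟩ := δ
      · rintro ⟨h1, h2⟩
        obtain ⟨q', ρ', rfl, h, rfl⟩ := ih.1 h2
        exact ⟨q', δ :: ρ', rfl, ⟨Sum.inl_injective h1, h⟩, rfl⟩
      · rintro ⟨h1, h2⟩
        exact absurd h1 (by simp [sumTransition])
    · rintro ⟨q', ρ', rfl, h, hρ⟩
      cases ρ' with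
      | nil => simp at hρ
      | cons δ' ρ' =>
        simp only [List.map_cons, List.cons.injEq] at hρ
        obtain ⟨rfl, rfl⟩ := hρ
        exact ⟨congrArg Sum.inl h.1, ih.2 ⟨q', ρ', rfl, h.2, rfl⟩⟩

theorem sum_isRun_inr {ρ : List (sum A B).Δ} : ∀ {p : B.State} {q : (sum A B).State},
    (sum A B).IsRun (Sum.inr p) ρ q ↔ ∃ q' ρ', q = Sum.inr q' ∧ B.IsRun p ρ' q' ∧
      ρ = ρ'.map fun δ => sumMk A B (.inr δ) := by
  induction ρ with
  | nil =>
    intro p q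
    constructor
    · rintro h
      exact ⟨p, [], (show _ = _ from h).symm, rfl, rfl⟩
    · rintro ⟨q', ρ', rfl, h, hρ⟩
      obtain rfl := List.map_eq_nil_iff.1 hρ.symm
      exact congrArg Sum.inr h
  | cons δ ρ ih =>
    intro p q
    constructor
    · obtain ⟨_, δ | δ, rfl⟩ := δ
      · rintro ⟨h1, h2⟩
        exact absurd h1 (by simp [sumTransition])
      · rintro ⟨h1, h2⟩
        obtain ⟨q', ρ', rfl, h, rfl⟩ := ih.1 h2
        exact ⟨q', δ :: ρ', rfl, ⟨Sum.inr_injective h1, h⟩, rfl⟩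
    · rintro ⟨q', ρ', rfl, h, hρ⟩
      cases ρ' with
      | nil => simp at hρ
      | cons δ' ρ' =>
        simp only [List.map_cons, List.cons.injEq] at hρ
        obtain ⟨rfl, rfl⟩ := hρ
        exact ⟨congrArg Sum.inr h.1, ih.2 ⟨q', ρ', rfl, h.2, rfl⟩⟩

theorem sum_label_inl (ρ : List A.Δ) :
    (sum A B).label (ρ.map fun δ => sumMk A B (.inl δ)) = A.label ρ := by
  simp [label, sumMk, sumTransition, Function.comp_def]

theorem sum_label_inr (ρ : List B.Δ) :
    (sum A B).label (ρ.map fun δ => sumMk A B (.inr δ)) = B.label ρ := by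
  simp [label, sumMk, sumTransition, Function.comp_def]

theorem sum_lang_inl {p : A.State} {q : (sum A B).State} {x : List α} :
    x ∈ (sum A B).lang (Sum.inl p) q ↔ ∃ q', q = Sum.inl q' ∧ x ∈ A.lang p q' := by
  constructor
  · rintro ⟨ρ, hρ, hl⟩
    obtain ⟨q', ρ', rfl, h, rfl⟩ := (sum_isRun_inl A B).1 hρ
    exact ⟨q', rfl, ρ', h, by rwa [sum_label_inl] at hl⟩
  · rintro ⟨q', rfl, ρ, hρ, hl⟩
    exact ⟨_, (sum_isRun_inl A B).2 ⟨q', ρ, rfl, hρ, rfl⟩, by rwa [sum_label_inl]⟩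

theorem sum_lang_inr {p : B.State} {q : (sum A B).State} {x : List α} :
    x ∈ (sum A B).lang (Sum.inr p) q ↔ ∃ q', q = Sum.inr q' ∧ x ∈ B.lang p q' := by
  constructor
  · rintro ⟨ρ, hρ, hl⟩
    obtain ⟨q', ρ', rfl, h, rfl⟩ := (sum_isRun_inr A B).1 hρ
    exact ⟨q', rfl, ρ', h, by rwa [sum_label_inr] at hl⟩
  · rintro ⟨q', rfl, ρ, hρ, hl⟩
    exact ⟨_, (sum_isRun_inr A B).2 ⟨q', ρ, rfl, hρ, rfl⟩, by rwa [sum_label_inr]⟩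

variable {A B} in
theorem Aperiodic.sum (hA : A.Aperiodic) (hB : B.Aperiodic) : (sum A B).Aperiodic := by
  rw [aperiodic_iff] at hA hB
  obtain ⟨N, hN⟩ := (hA.prodMk hB).exists_pow
  have h := fun x => (hA.prodMk hB).pow_of_le hN (Nat.le_succ N) x
  simp only [Prod.mk.injEq] at h
  refine ⟨N + 1, by lia, fun p q x _ => ?_⟩
  rcases p with p | p
  · rw [sum_lang_inl, sum_lang_inl]
    exact exists_congr fun q' => and_congr_right fun _ => Set.ext_iff.1 (h x).1 (p, q')
  · rw [sum_lang_inr, sum_lang_inr]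
    exact exists_congr fun q' => and_congr_right fun _ => Set.ext_iff.1 (h x).2 (p, q')

theorem sum_usem [Finite α] (x : {x : List α // x ≠ []}) :
    (sum A B).usem x = A.usem x + B.usem x := by
  classical
  have hinl : Function.Injective (List.map fun δ => sumMk A B (.inl δ)) :=
    List.map_injective_iff.2 fun _ _ h => Sum.inl_injective (sumMk_injective A B h)
  have hinr : Function.Injective (List.map fun δ => sumMk A B (.inr δ)) :=
    List.map_injective_iff.2 fun _ _ h => Sum.inr_injective (sumMk_injective A B h)
  have hset : ((sum A B).finite_successfulRuns x.1).toFinset =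
      (A.finite_successfulRuns x.1).toFinset.image (List.map fun δ => sumMk A B (.inl δ)) ∪
      (B.finite_successfulRuns x.1).toFinset.image (List.map fun δ => sumMk A B (.inr δ)) := by
    ext ρ
    simp only [Finset.mem_union, Finset.mem_image, Set.Finite.mem_toFinset]
    constructor
    · rintro ⟨p | p, hp, q, hq, hρ, hl⟩
      · obtain ⟨q', ρ', rfl, h, rfl⟩ := (sum_isRun_inl A B).1 hρ
        exact .inl ⟨ρ', ⟨p, hp, q', hq, h, by rwa [sum_label_inl] at hl⟩, rfl⟩
      · obtain ⟨q', ρ', rfl, h, rfl⟩ := (sum_isRun_inr A B).1 hρ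
        exact .inr ⟨ρ', ⟨p, hp, q', hq, h, by rwa [sum_label_inr] at hl⟩, rfl⟩
    · rintro (⟨ρ, ⟨p, hp, q, hq, hρ, hl⟩, rfl⟩ | ⟨ρ, ⟨p, hp, q, hq, hρ, hl⟩, rfl⟩)
      · exact ⟨.inl p, hp, .inl q, hq, (sum_isRun_inl A B).2 ⟨q, ρ, rfl, hρ, rfl⟩,
          by rwa [sum_label_inl]⟩
      · exact ⟨.inr p, hp, .inr q, hq, (sum_isRun_inr A B).2 ⟨q, ρ, rfl, hρ, rfl⟩,
          by rwa [sum_label_inr]⟩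
  rw [usem_eq_sum, usem_eq_sum, usem_eq_sum, hset, Finset.sum_union,
    Finset.sum_image hinl.injOn, Finset.sum_image hinr.injOn]
  · simp [weight, wgt_sumMk, Function.comp_def]
  · rw [Finset.disjoint_left]
    intro ρ hρ hρ'
    simp only [Finset.mem_image, Set.Finite.mem_toFinset] at hρ hρ'
    obtain ⟨ρ₁, ⟨_, _, _, _, _, hl⟩, rfl⟩ := hρ
    obtain ⟨ρ₂, -, h⟩ := hρ'
    cases ρ₁ with
    | nil => exact x.2 hl.symm
    | cons δ ρ₁ =>
      cases ρ₂ with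
      | nil => simp at h
      | cons δ' ρ₂ =>
        simp only [List.map_cons, List.cons.injEq] at h
        exact absurd (sumMk_injective A B h.1) (by simp)

end WAutomaton

/-! ### The automaton which guesses a valuation -/

/-- All marks of a word over the extended alphabet. -/
def allMarks {α : Type u} {V : Type} (y : List (α × Set V)) : Set V := {x | ∃ b ∈ y, x ∈ b.2}

/-- Each mark occurs at most once. -/
def MarksDisjoint {α : Type u} {V : Type} (y : List (α × Set V)) : Prop :=
  y.Pairwise fun b c => Disjoint b.2 c.2

section Marks

variable {α : Type u} {V : Type}

theorem allMarks_nil : allMarks ([] : List (α × Set V)) = ∅ := by simp [allMarks]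

theorem allMarks_append (y z : List (α × Set V)) :
    allMarks (y ++ z) = allMarks y ∪ allMarks z := by
  ext x
  simp [allMarks, or_and_right, exists_or]

theorem allMarks_cons (b : α × Set V) (y : List (α × Set V)) :
    allMarks (b :: y) = b.2 ∪ allMarks y := by
  ext x
  simp [allMarks]

theorem disjoint_allMarks_left {y : List (α × Set V)} {S : Set V} :
    Disjoint (allMarks y) S ↔ ∀ b ∈ y, Disjoint b.2 S := by
  simp only [Set.disjoint_left, allMarks]
  exact ⟨fun h b hb x hx => h ⟨b, hb, hx⟩, fun h x ⟨b, hb, hx⟩ => h b hb hx⟩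

theorem marksDisjoint_append {y z : List (α × Set V)} : MarksDisjoint (y ++ z) ↔
    MarksDisjoint y ∧ MarksDisjoint z ∧ Disjoint (allMarks y) (allMarks z) := by
  rw [MarksDisjoint, List.pairwise_append, disjoint_allMarks_left]
  refine and_congr_right fun _ => and_congr_right fun _ => forall₂_congr fun b _ => ?_
  rw [disjoint_comm, disjoint_allMarks_left]
  exact forall₂_congr fun c _ => disjoint_comm

theorem marksDisjoint_cons {b : α × Set V} {y : List (α × Set V)} : MarksDisjoint (b :: y) ↔
    MarksDisjoint y ∧ Disjoint b.2 (allMarks y) := by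
  rw [MarksDisjoint, List.pairwise_cons, and_comm, disjoint_comm, disjoint_allMarks_left]
  exact and_congr_right fun _ => forall₂_congr fun c _ => disjoint_comm

theorem aperiodicCongr_marks :
    AperiodicCongr fun y : List (α × Set V) => (MarksDisjoint y, allMarks y) where
  append h h' := by
    simp only [Prod.mk.injEq] at h h' ⊢
    rw [marksDisjoint_append, marksDisjoint_append, allMarks_append, allMarks_append,
      h.1, h.2, h'.1, h'.2]
    exact ⟨rfl, rfl⟩
  exists_pow := by
    refine ⟨2, fun y => ?_⟩
    simp only [wordPow_succ, wordPow_zero, List.append_nil, Prod.mk.injEq]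
    simp only [marksDisjoint_append, allMarks_append, Set.union_self, eq_iff_iff, and_true]
    tauto

theorem markCount_le_of_marksDisjoint [Finite V] {y : List (α × Set V)} (h : MarksDisjoint y) :
    markCount Prod.fst (fun a => (a, (∅ : Set V))) y ≤ (allMarks y).ncard := by
  classical
  induction y with
  | nil => simp [markCount]
  | cons b y ih =>
    rw [marksDisjoint_cons] at h
    have ih := ih h.1
    rw [allMarks_cons, Set.ncard_union_eq h.2]
    simp only [markCount, List.countP_cons] at ih ⊢
    by_cases hb : b.2 = ∅
    · have : (b.1, (∅ : Set V)) = b := Prod.ext rfl hb.symm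
      simp only [this]
      simpa [hb] using ih
    · have h1 : (b.2).ncard ≠ 0 := fun h0 => hb ((Set.ncard_eq_zero).1 h0)
      split_ifs <;> lia

theorem marksDisjoint_mark (p : PointedWord α V) : MarksDisjoint p.mark := by
  rw [MarksDisjoint, mark, List.pairwise_ofFn]
  intro i j hij
  rw [Set.disjoint_left]
  intro x hx hy
  exact hij.ne ((show _ = _ from hx).symm.trans hy)

theorem allMarks_mark (p : PointedWord α V) : allMarks p.mark = Set.univ := by
  refine Set.eq_univ_of_forall fun x => ⟨_, List.mem_ofFn.2 ⟨p.val x, rfl⟩, rfl⟩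

theorem exists_eq_mark {x : List α} (hx : x ≠ []) {y : List (α × Set V)} (hy : y.map Prod.fst = x)
    (hd : MarksDisjoint y) (hu : allMarks y = Set.univ) :
    ∃ τ : V → Fin x.length, y = (⟨x, hx, τ⟩ : PointedWord α V).mark := by
  have hlen : y.length = x.length := by rw [← hy, List.length_map]
  have h : ∀ z : V, ∃ i : Fin x.length, z ∈ (y[(i : ℕ)]'(i.2.trans_eq hlen.symm)).2 := by
    intro z
    obtain ⟨b, hb, hz⟩ : z ∈ allMarks y := hu ▸ Set.mem_univ z
    obtain ⟨i, hi, rfl⟩ := List.getElem_of_mem hb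
    exact ⟨⟨i, hlen ▸ hi⟩, hz⟩
  choose τ hτ using h
  refine ⟨τ, List.ext_getElem (by simp [length_mark, hlen]) fun i hi hi' => ?_⟩
  rw [getElem_mark]
  refine Prod.ext ?_ (Set.ext fun z => ⟨fun hz => ?_, fun hz => ?_⟩)
  · simp [← hy]
  · change τ z = ⟨i, _⟩
    by_contra hne
    have hpw := List.pairwise_iff_getElem.1 hd
    rcases lt_or_gt_of_ne hne with hlt | hlt
    · exact Set.disjoint_left.1 (hpw _ _ ((τ z).2.trans_eq hlen.symm) hi hlt) (hτ z) hz
    · exact Set.disjoint_left.1 (hpw _ _ hi ((τ z).2.trans_eq hlen.symm) hlt) hz (hτ z)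
  · have hz : τ z = ⟨i, _⟩ := hz
    have := hτ z
    simp only [hz] at this
    exact this

theorem mark_val_injective {x : List α} (hx : x ≠ []) {τ τ' : V → Fin x.length}
    (h : (⟨x, hx, τ⟩ : PointedWord α V).mark = (⟨x, hx, τ'⟩ : PointedWord α V).mark) :
    τ = τ' := by
  funext z
  have := congrFun (List.ofFn_injective h) (τ z)
  exact ((Set.ext_iff.1 (congrArg Prod.snd this) z).1 rfl).symm

end Marks

/-- The automaton which guesses a valuation, with the marks met so far and the classes of the
marked prefix and of the marked suffix as states. -/
def guessAutomaton {α : Type u} {R : Type v} {V T : Type} [Finite V] [Finite T]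
    (g : List (α × Set V) → T) (wt : T → α × Set V → T → R) (I : Set T) : WAutomaton α R where
  State := Set V × T × T
  finite_state := inferInstance
  Δ := {x | ∃ (X : Set V) (y z : List (α × Set V)), Disjoint x.1.1 X ∧ x.2.2.1 = x.1.1 ∪ X ∧
    g y = x.1.2.1 ∧ g (y ++ [(x.2.1, X)]) = x.2.2.2.1 ∧
    g z = x.2.2.2.2 ∧ g ((x.2.1, X) :: z) = x.1.2.2}
  wgt δ := wt δ.1.1.2.1 (δ.1.2.1, δ.1.2.2.1 \ δ.1.1.1) δ.1.2.2.2.2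
  init := {s | s.1 = ∅ ∧ s.2.1 = g [] ∧ s.2.2 ∈ I}
  final := {s | s.1 = Set.univ ∧ s.2.2 = g []}

namespace GuessAutomaton

variable {α : Type u} {R : Type v} {V T : Type} [Finite V] [Finite T]
  {g : List (α × Set V) → T} {wt : T → α × Set V → T → R} {I : Set T}

/-- The marked letter read by a transition. -/
def dec (δ : (guessAutomaton g wt I).Δ) : α × Set V := (δ.1.2.1, δ.1.2.2.1 \ δ.1.1.1)

theorem transition_spec (hg : AperiodicCongr g) (δ : (guessAutomaton g wt I).Δ) :
    Disjoint δ.1.1.1 (dec δ).2 ∧ δ.1.2.2.1 = δ.1.1.1 ∪ (dec δ).2 ∧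
    (∀ y, g y = δ.1.1.2.1 → g (y ++ [dec δ]) = δ.1.2.2.2.1) ∧
    (∀ z, g z = δ.1.2.2.2.2 → g (dec δ :: z) = δ.1.1.2.2) := by
  obtain ⟨X, y, z, hd, hu, hy, hy', hz, hz'⟩ := δ.2
  have hX : (dec δ).2 = X := by
    change δ.1.2.2.1 \ δ.1.1.1 = X
    rw [hu, Set.union_sdiff_cancel_left hd.le_bot]
  have hdec : dec δ = (δ.1.2.1, X) := Prod.ext rfl hX
  refine ⟨hX ▸ hd, hX ▸ hu, fun y' h => ?_, fun z' h => ?_⟩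
  · rw [hdec, ← hy']
    exact hg.append (h.trans hy.symm) rfl
  · rw [hdec, ← hz']
    exact hg.append (x := [_]) rfl (h.trans hz.symm)

theorem map_dec_fst (ρ : List (guessAutomaton g wt I).Δ) :
    (ρ.map dec).map Prod.fst = (guessAutomaton g wt I).label ρ := by
  simp [WAutomaton.label, dec, Function.comp_def]

theorem isRun_spec (hg : AperiodicCongr g) {ρ : List (guessAutomaton g wt I).Δ} :
    ∀ {p q : (guessAutomaton g wt I).State}, (guessAutomaton g wt I).IsRun p ρ q →
      MarksDisjoint (ρ.map dec) ∧ Disjoint p.1 (allMarks (ρ.map dec)) ∧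
      q.1 = p.1 ∪ allMarks (ρ.map dec) ∧
      (∀ y, g y = p.2.1 → g (y ++ ρ.map dec) = q.2.1) ∧
      (∀ z, g z = q.2.2 → g (ρ.map dec ++ z) = p.2.2) := by
  induction ρ with
  | nil =>
    rintro p q h
    obtain rfl : p = q := h
    simp [MarksDisjoint, allMarks_nil]
  | cons δ ρ ih =>
    rintro p q ⟨rfl, h⟩
    obtain ⟨h1, h2, h3, h4, h5⟩ := ih h
    obtain ⟨k1, k2, k3, k4⟩ := transition_spec hg δ
    rw [k2, Set.disjoint_union_left] at h2
    refine ⟨?_, ?_, ?_, fun y hy => ?_, fun z hz => ?_⟩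
    · rw [List.map_cons, marksDisjoint_cons]
      exact ⟨h1, h2.2⟩
    · rw [List.map_cons, allMarks_cons, Set.disjoint_union_right]
      exact ⟨k1, h2.1⟩
    · rw [h3, k2, List.map_cons, allMarks_cons, Set.union_assoc]
    · rw [← h4 _ (k3 y hy), List.map_cons]
      simp
    · exact k4 _ (h5 z hz)

theorem exists_isRun {y : List (α × Set V)} : ∀ {S : Set V} (x z : List (α × Set V)),
    MarksDisjoint y → Disjoint S (allMarks y) →
    ∃ ρ, (guessAutomaton g wt I).IsRun (S, g x, g (y ++ z)) ρ (S ∪ allMarks y, g (x ++ y), g z) ∧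
      ρ.map dec = y := by
  induction y with
  | nil =>
    intro S x z _ _
    refine ⟨[], ?_, rfl⟩
    rw [allMarks_nil, Set.union_empty, List.append_nil, List.nil_append]
    rfl
  | cons b y ih =>
    intro S x z hd hS
    rw [marksDisjoint_cons] at hd
    rw [allMarks_cons, Set.disjoint_union_right] at hS
    obtain ⟨ρ, hρ, hdec⟩ := ih (S := S ∪ b.2) (x ++ [b]) z hd.1
      (Set.disjoint_union_left.2 ⟨hS.2, hd.2⟩)
    refine ⟨⟨((S, g x, g (b :: (y ++ z))), b.1, (S ∪ b.2, g (x ++ [b]), g (y ++ z))),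
      b.2, x, y ++ z, hS.1, rfl, rfl, rfl, rfl, rfl⟩ :: ρ, ⟨rfl, ?_⟩, ?_⟩
    · rw [allMarks_cons, ← Set.union_assoc]
      simpa using hρ
    · rw [List.map_cons, hdec]
      refine congrArg (· :: y) (Prod.ext rfl ?_)
      exact Set.union_sdiff_cancel_left hS.1.le_bot

theorem isRun_injective (hg : AperiodicCongr g) (hsurj : Function.Surjective g)
    {ρ : List (guessAutomaton g wt I).Δ} : ∀ {ρ' : List (guessAutomaton g wt I).Δ}
    {p q p' q' : (guessAutomaton g wt I).State}, (guessAutomaton g wt I).IsRun p ρ q →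
      (guessAutomaton g wt I).IsRun p' ρ' q' → p.1 = p'.1 → p.2.1 = p'.2.1 → q.2.2 = q'.2.2 →
      ρ.map dec = ρ'.map dec → ρ = ρ' ∧ p = p' := by
  induction ρ with
  | nil =>
    intro ρ' p q p' q' h h' h1 h2 h3 hdec
    obtain rfl := List.map_eq_nil_iff.1 hdec.symm
    obtain rfl : p = q := h
    obtain rfl : p' = q' := h'
    exact ⟨rfl, Prod.ext h1 (Prod.ext h2 h3)⟩
  | cons δ ρ ih =>
    intro ρ' p q p' q' h h' h1 h2 h3 hdec
    cases ρ' with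
    | nil => simp at hdec
    | cons δ' ρ' =>
      obtain ⟨rfl, h⟩ := h
      obtain ⟨rfl, h'⟩ := h'
      simp only [List.map_cons, List.cons.injEq] at hdec
      obtain ⟨k1, k2, k3, k4⟩ := transition_spec hg δ
      obtain ⟨l1, l2, l3, l4⟩ := transition_spec hg δ'
      obtain ⟨y, hy⟩ := hsurj δ.1.1.2.1
      have hl : δ.1.2.2.2.1 = δ'.1.2.2.2.1 := by
        rw [← k3 y hy, ← l3 y (hy.trans h2), hdec.1]
      obtain ⟨rfl, ht⟩ := ih h h' (by rw [k2, l2, h1, hdec.1]) hl h3 hdec.2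
      obtain ⟨z, hz⟩ := hsurj δ.1.2.2.2.2
      have hr : δ.1.1.2.2 = δ'.1.1.2.2 := by
        rw [← k4 z hz, ← l4 z (by rw [hz, ht]), hdec.1]
      have hs : δ.1.1 = δ'.1.1 := Prod.ext h1 (Prod.ext h2 hr)
      have hδ : δ = δ' := Subtype.ext (Prod.ext hs (Prod.ext (congrArg Prod.fst hdec.1 :) ht))
      exact ⟨by rw [hδ], hs⟩

theorem isRun_weight (hg : AperiodicCongr g) {ρ : List (guessAutomaton g wt I).Δ} :
    ∀ {p q : (guessAutomaton g wt I).State} {y z : List (α × Set V)},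
      (guessAutomaton g wt I).IsRun p ρ q → g y = p.2.1 → g z = q.2.2 →
      ∀ (i : ℕ) (hi : i < ρ.length), (guessAutomaton g wt I).wgt ρ[i] =
        wt (g (y ++ (ρ.map dec).take i)) (dec ρ[i]) (g ((ρ.map dec).drop (i + 1) ++ z)) := by
  induction ρ with
  | nil => intro p q y z _ _ _ i hi; simp at hi
  | cons δ ρ ih =>
    rintro p q y z ⟨rfl, h⟩ hy hz i hi
    cases i with
    | zero =>
      have := (isRun_spec hg h).2.2.2.2 z hz
      simp only [List.take_zero, List.append_nil, List.getElem_cons_zero, List.map_cons,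
        zero_add, List.drop_succ_cons, List.drop_zero, hy, this]
      rfl
    | succ i =>
      have := ih (y := y ++ [dec δ]) h ((transition_spec hg δ).2.2.1 y hy) hz i
        (by simpa using hi)
      simpa using this

theorem mem_lang_iff (hg : AperiodicCongr g) (hsurj : Function.Surjective g) {x : List α}
    {p q : (guessAutomaton g wt I).State} : x ∈ (guessAutomaton g wt I).lang p q ↔
      ∃ y : List (α × Set V), y.map Prod.fst = x ∧ MarksDisjoint y ∧ Disjoint p.1 (allMarks y) ∧
        q.1 = p.1 ∪ allMarks y ∧ (∀ z, g z = p.2.1 → g (z ++ y) = q.2.1) ∧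
        (∀ z, g z = q.2.2 → g (y ++ z) = p.2.2) := by
  constructor
  · rintro ⟨ρ, hρ, hl⟩
    exact ⟨ρ.map dec, by rw [map_dec_fst, hl], isRun_spec hg hρ⟩
  · rintro ⟨y, hy, hd, hS, hq, h1, h2⟩
    obtain ⟨x', hx'⟩ := hsurj p.2.1
    obtain ⟨z', hz'⟩ := hsurj q.2.2
    obtain ⟨ρ, hρ, hdec⟩ := exists_isRun (g := g) (wt := wt) (I := I) x' z' hd hS
    refine ⟨ρ, ?_, by rw [← map_dec_fst, hdec, hy]⟩
    rw [hx', hz', h1 _ hx', h2 _ hz', ← hq] at hρ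
    exact hρ

theorem aperiodic (hg : AperiodicCongr g) (hsurj : Function.Surjective g) :
    (guessAutomaton g wt I).Aperiodic := by
  have hf := hg.prodMk (aperiodicCongr_marks (α := α) (V := V))
  obtain ⟨N, hN⟩ := (hf.projectClasses (π := Prod.fst) (emb := fun a => (a, (∅ : Set V)))
    (fun _ => rfl) (Nat.card V)).exists_pow
  have key : ∀ (x x' : List α), projectClasses (fun y => (g y, MarksDisjoint y, allMarks y))
      Prod.fst (fun a => (a, (∅ : Set V))) (Nat.card V) x = projectClasses (fun y =>
        (g y, MarksDisjoint y, allMarks y)) Prod.fst (fun a => (a, (∅ : Set V))) (Nat.card V) x' →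
      ∀ p q, x ∈ (guessAutomaton g wt I).lang p q → x' ∈ (guessAutomaton g wt I).lang p q := by
    intro x x' h p q hx
    rw [mem_lang_iff hg hsurj] at hx ⊢
    obtain ⟨y, hy, hd, hS, hq, h1, h2⟩ := hx
    have hcount : markCount Prod.fst (fun a => (a, (∅ : Set V))) y < Nat.card V + 1 :=
      Nat.lt_succ_of_le ((markCount_le_of_marksDisjoint hd).trans
        (by rw [← Set.ncard_univ]; exact Set.ncard_le_ncard (Set.subset_univ _)))
    obtain ⟨y', hy', -, he⟩ := (congrFun h ⟨_, hcount⟩).subset ⟨y, hy, rfl, rfl⟩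
    simp only [Prod.mk.injEq, eq_iff_iff] at he
    refine ⟨y', hy', he.2.1.2 hd, he.2.2 ▸ hS, he.2.2 ▸ hq, fun z hz => ?_, fun z hz => ?_⟩
    · rw [← h1 z hz]
      exact hg.append rfl he.1
    · rw [← h2 z hz]
      exact hg.append he.1 rfl
  have hpow := fun x => (hf.projectClasses (π := Prod.fst) (emb := fun a => (a, (∅ : Set V)))
    (fun _ => rfl) (Nat.card V)).pow_of_le hN (Nat.le_succ N) x
  exact ⟨N + 1, by lia, fun p q x _ => ⟨key _ _ (hpow x) p q, key _ _ (hpow x).symm p q⟩⟩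

theorem usem_eq [Finite α] [Fintype V] [DecidableEq V] (hg : AperiodicCongr g)
    (hsurj : Function.Surjective g)
    (x : {x : List α // x ≠ []}) (w : PointedWord α (Option V) → R)
    (hw : ∀ (p : PointedWord α V) (i : Fin p.word.length), w (p.extend i) =
      wt (g (p.mark.take i)) (p.mark[(i : ℕ)]'(p.length_mark.symm ▸ i.2)) (g (p.mark.drop (i + 1)))) :
    (guessAutomaton g wt I).usem x = ∑ τ : V → Fin x.1.length,
      condProd (fun p => g p.mark ∈ I) w ⟨x.1, x.2, τ⟩ := by
  classical
  have hrun : ∀ τ : V → Fin x.1.length, ∃ ρ, (guessAutomaton g wt I).IsRun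
      (∅, g [], g (⟨x.1, x.2, τ⟩ : PointedWord α V).mark) ρ
      (Set.univ, g (⟨x.1, x.2, τ⟩ : PointedWord α V).mark, g []) ∧
      ρ.map dec = (⟨x.1, x.2, τ⟩ : PointedWord α V).mark := by
    intro τ
    have := exists_isRun (g := g) (wt := wt) (I := I) (S := ∅) [] []
      (marksDisjoint_mark ⟨x.1, x.2, τ⟩) (by simp)
    simpa [allMarks_mark] using this
  choose E hE hE' using hrun
  rw [WAutomaton.usem_eq_sum]
  simp only [condProd]
  rw [← Finset.sum_filter]
  symm
  refine Finset.sum_bij (fun τ _ => E τ) (fun τ hτ => ?_) (fun τ _ τ' _ h => ?_)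
    (fun ρ hρ => ?_) (fun τ _ => ?_)
  · rw [Finset.mem_filter] at hτ
    rw [Set.Finite.mem_toFinset]
    refine ⟨_, ⟨rfl, rfl, hτ.2⟩, _, ⟨rfl, rfl⟩, hE τ, ?_⟩
    rw [← map_dec_fst, hE' τ, mark_map_fst]
  · refine mark_val_injective x.2 ?_
    rw [← hE' τ, ← hE' τ', h]
  · rw [Set.Finite.mem_toFinset] at hρ
    obtain ⟨p, ⟨hp1, hp2, hp3⟩, q, ⟨hq1, hq2⟩, hr, hl⟩ := hρ
    obtain ⟨h1, h2, h3, h4, h5⟩ := isRun_spec hg hr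
    obtain ⟨τ, hτ⟩ := exists_eq_mark x.2 (y := ρ.map dec) (by rw [map_dec_fst, hl]) h1
      (by rw [hp1, hq1, Set.empty_union] at h3; exact h3.symm)
    obtain ⟨he, hp⟩ := isRun_injective hg hsurj (hE τ) hr hp1.symm hp2.symm hq2.symm
      ((hE' τ).trans hτ.symm)
    refine ⟨τ, Finset.mem_filter.2 ⟨Finset.mem_univ _, ?_⟩, he⟩
    rw [← hp] at hp3
    exact hp3
  · have hlen : (E τ).length = x.1.length := by
      have := congrArg List.length (hE' τ)
      rwa [List.length_map, length_mark] at this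
    refine congrArg (fun l => ({l} : Multiset (List R))) (List.ext_getElem ?_ fun i hi hi' => ?_)
    · simp [WAutomaton.weight, hlen]
    · have hiE : i < (E τ).length := by simpa [hlen] using hi
      have h1 := isRun_weight hg (y := []) (z := []) (hE τ) rfl rfl i hiE
      have h2 : dec (E τ)[i] = ((E τ).map dec)[i]'(by simpa using hiE) := by simp
      simp only [h2, hE' τ, List.nil_append, List.append_nil] at h1
      simp only [List.getElem_ofFn, WAutomaton.weight, List.getElem_map, h1]
      exact hw ⟨x.1, x.2, τ⟩ ⟨i, hlen ▸ hiE⟩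

end GuessAutomaton

/-! ### Recognizable series are given by aperiodic automata -/

section

variable {α : Type u} {R : Type v} {V : Type}

/-- Adds the mark `none` to a letter. -/
def addNone (b : α × Set V) : α × Set (Option V) := (b.1, insert none (some '' b.2))

theorem mark_extend_eq (p : PointedWord α V) (i : Fin p.word.length) :
    (p.extend i).mark = (p.mark.take i).map Rec.embSome ++
      ([addNone (p.mark[(i : ℕ)]'(p.length_mark.symm ▸ i.2))] ++
        (p.mark.drop (i + 1)).map Rec.embSome) := by
  have hi := i.2
  refine List.ext_getElem (by simp [length_mark]; lia) fun j hj hj' => ?_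
  rw [getElem_mark]
  have hjp : j < p.word.length := by simpa [length_mark] using hj
  rcases lt_trichotomy j i with h | h | h
  · rw [List.getElem_append_left (by simp [length_mark]; lia)]
    simp only [List.getElem_map, List.getElem_take, getElem_mark, Rec.embSome]
    refine Prod.ext rfl (Set.ext fun o => ?_)
    cases o with
    | none => simp [extend, Fin.ext_iff]; lia
    | some x => simp [extend]
  · subst h
    rw [List.getElem_append_right (by simp)]
    simp only [List.length_map, List.length_take, length_mark, Nat.min_eq_left hi.le, Nat.sub_self,
      List.cons_append, List.getElem_cons_zero, getElem_mark, addNone]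
    refine Prod.ext rfl (Set.ext fun o => ?_)
    cases o with
    | none => simp [extend]
    | some x => simp [extend]
  · rw [List.getElem_append_right (by simp; lia)]
    simp only [List.length_map, List.length_take, length_mark, Nat.min_eq_left hi.le,
      List.cons_append, List.nil_append, List.getElem_cons, List.getElem_map, List.getElem_drop]
    rw [dif_neg (by lia)]
    simp only [show (i : ℕ) + 1 + (j - i - 1) = j by lia, getElem_mark, Rec.embSome]
    refine Prod.ext rfl (Set.ext fun o => ?_)
    cases o with
    | none => simp [extend, Fin.ext_iff]; lia
    | some x => simp [extend]

theorem exists_aperiodic_of_condProd [Finite α] [Fintype V] [DecidableEq V]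
    {P : PointedWord α V → Prop} (hP : Rec P) {w : PointedWord α (Option V) → R} (hw : Rec w) :
    ∃ A : WAutomaton α R, A.Aperiodic ∧ ∀ x : {x : List α // x ≠ []},
      A.usem x = ∑ τ : V → Fin x.1.length, condProd P w ⟨x.1, x.2, τ⟩ := by
  classical
  by_cases hR : Nonempty R
  · obtain ⟨n, f, hf, hfP⟩ := hP
    obtain ⟨m, f', hf', hfw⟩ := hw
    have hg₀ := hf.prodMk (hf'.comp_map Rec.embSome)
    let g := Set.rangeFactorization fun y : List (α × Set V) => (f y, f' (y.map Rec.embSome))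
    have hg_eq : ∀ {y z}, g y = g z ↔ f y = f z ∧ f' (y.map Rec.embSome) = f' (z.map Rec.embSome) :=
      fun {y z} => by simp [g, Set.rangeFactorization, Subtype.ext_iff]
    have hg : AperiodicCongr g := by
      refine ⟨fun {x x' y y'} h h' => ?_, ?_⟩
      · rw [hg_eq, ← Prod.mk.injEq] at *
        exact hg₀.append h h'
      · obtain ⟨N, hN⟩ := hg₀.exists_pow
        exact ⟨N, fun x => by rw [hg_eq, ← Prod.mk.injEq]; exact hN x⟩
    have hsurj : Function.Surjective g := Set.rangeFactorization_surjective
    let Q : _ → α × Set V → _ → (Σ p : PointedWord α V, Fin p.word.length) → Prop :=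
      fun l b r s => g (s.1.mark.take s.2) = l ∧
        s.1.mark[(s.2 : ℕ)]'(s.1.length_mark.symm ▸ s.2.2) = b ∧ g (s.1.mark.drop (s.2 + 1)) = r
    let wt : _ → α × Set V → _ → R := fun l b r => if h : ∃ s, Q l b r s then
      w (h.choose.1.extend h.choose.2) else Classical.arbitrary R
    refine ⟨guessAutomaton g wt {t | ∃ q : PointedWord α V, P q ∧ g q.mark = t},
      GuessAutomaton.aperiodic hg hsurj, fun x => ?_⟩
    rw [GuessAutomaton.usem_eq hg hsurj x w]
    · refine Finset.sum_congr rfl fun τ _ => condProd_congr _ _ ?_ fun _ => rfl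
      constructor
      · rintro ⟨q, hq, h⟩
        rwa [← hfP q _ (hg_eq.1 h).1]
      · exact fun h => ⟨_, h, rfl⟩
    · intro p i
      have h : ∃ s, Q (g (p.mark.take i)) (p.mark[(i : ℕ)]'(p.length_mark.symm ▸ i.2))
          (g (p.mark.drop (i + 1))) s := ⟨⟨p, i⟩, rfl, rfl, rfl⟩
      simp only [wt]
      rw [dif_pos h]
      obtain ⟨h1, h2, h3⟩ := h.choose_spec
      refine hfw _ _ ?_
      rw [mark_extend_eq, mark_extend_eq]
      exact hf'.append (hg_eq.1 h1).2.symm (hf'.append (by rw [h2]) (hg_eq.1 h3).2.symm)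
  · refine ⟨.empty α R, WAutomaton.empty_aperiodic, fun x => absurd ⟨w ⟨x.1, x.2, fun _ =>
      ⟨0, List.length_pos_iff.2 x.2⟩⟩⟩ hR⟩

theorem RecSeries.exists_aperiodic [Finite α] {G : PointedWord α Empty → Multiset (List R)}
    (hG : G ∈ RecSeries α R Empty) :
    ∃ A : WAutomaton α R, A.Aperiodic ∧ ∀ x, A.usem x = G (pureWord x) := by
  induction hG using AddSubmonoid.closure_induction with
  | mem G hG =>
    obtain ⟨k, P, w, hP, hw, rfl⟩ := hG
    obtain ⟨A, hA, h⟩ := exists_aperiodic_of_condProd (hP.subst (Sum.elim Empty.elim id))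
      (hw.subst (Option.map (Sum.elim Empty.elim id)))
    refine ⟨A, hA, fun x => (h x).trans (Finset.sum_congr rfl fun τ _ => ?_)⟩
    refine condProd_congr _ _ (iff_of_eq (congrArg P (ext_val _ _ ?_)))
      fun z => congrArg w (ext_val _ _ ?_)
    · rintro (x | j)
      · exact x.elim
      · rfl
    · rintro (_ | x | j)
      · rfl
      · exact x.elim
      · rfl
  | zero => exact ⟨.empty α R, WAutomaton.empty_aperiodic, fun x => WAutomaton.empty_usem x⟩
  | add G H _ _ ihG ihH =>
    obtain ⟨A, hA, h⟩ := ihG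
    obtain ⟨B, hB, h'⟩ := ihH
    exact ⟨.sum A B, hA.sum hB, fun x => by rw [WAutomaton.sum_usem, h, h']; rfl⟩

end

/-! ### Polynomially ambiguous automata -/

theorem Polynomial.exists_eval_lt_two_pow (P : Polynomial ℕ) (c d : ℕ) :
    ∃ n : ℕ, 1 ≤ n ∧ P.eval (c + n * d) < 2 ^ n := by
  set D := P.natDegree
  set C := ∑ i ∈ Finset.range (D + 1), P.coeff i
  have hP : ∀ m, 1 ≤ m → P.eval m ≤ C * m ^ D := by
    intro m hm
    rw [Polynomial.eval_eq_sum_range, Finset.sum_mul]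
    refine Finset.sum_le_sum fun i hi => Nat.mul_le_mul_left _ (Nat.pow_le_pow_right hm ?_)
    exact Nat.le_of_lt_succ (Finset.mem_range.1 hi)
  have hlim := tendsto_pow_const_div_const_pow_of_one_lt D (one_lt_two (α := ℝ))
  set K : ℕ := C * (c + d + 1) ^ D + 1
  have hev := hlim.eventually (gt_mem_nhds (show (0 : ℝ) < 1 / K by positivity))
  obtain ⟨n, hn, hn1⟩ := (hev.and (Filter.eventually_ge_atTop 1)).exists
  refine ⟨n, hn1, ?_⟩
  have h1 : K * n ^ D < 2 ^ n := by
    rw [div_lt_div_iff₀ (by positivity) (by positivity), one_mul, mul_comm] at hn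
    exact_mod_cast hn
  have hmono : ∀ m m' : ℕ, m ≤ m' → P.eval m ≤ P.eval m' := by
    intro m m' hm
    rw [Polynomial.eval_eq_sum_range, Polynomial.eval_eq_sum_range]
    exact Finset.sum_le_sum fun i _ => Nat.mul_le_mul_left _ (Nat.pow_le_pow_left hm _)
  calc P.eval (c + n * d) ≤ P.eval ((c + d + 1) * n) := hmono _ _ (by nlinarith)
    _ ≤ C * ((c + d + 1) * n) ^ D := hP _ (by nlinarith)
    _ = C * (c + d + 1) ^ D * n ^ D := by rw [mul_pow, mul_assoc]
    _ ≤ K * n ^ D := Nat.mul_le_mul_right _ (Nat.le_succ _)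
    _ < 2 ^ n := h1

namespace WAutomaton

variable {α : Type u} {R : Type v} {A : WAutomaton α R}

/-- There is a run from `p` to `q`. -/
def Reach (A : WAutomaton α R) (p q : A.State) : Prop := ∃ ρ, A.IsRun p ρ q

theorem Reach.trans {p q r : A.State} : A.Reach p q → A.Reach q r → A.Reach p r := by
  rintro ⟨ρ, h⟩ ⟨ρ', h'⟩
  exact ⟨ρ ++ ρ', isRun_append.2 ⟨q, h, h'⟩⟩

theorem IsRun.reach {p q : A.State} {ρ : List A.Δ} (h : A.IsRun p ρ q) : A.Reach p q := ⟨ρ, h⟩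

theorem reach_refl (p : A.State) : A.Reach p p := ⟨[], rfl⟩

theorem reach_transition (δ : A.Δ) : A.Reach δ.1.1 δ.1.2.2 := ⟨[δ], rfl, rfl⟩

/-- The transition leads to another strongly connected component. -/
def Crossing (A : WAutomaton α R) (δ : A.Δ) : Prop := ¬ A.Reach δ.1.2.2 δ.1.1

theorem IsRun.reach_of_mem {ρ : List A.Δ} {δ : A.Δ} (hδ : δ ∈ ρ) : ∀ {p q : A.State},
    A.IsRun p ρ q → A.Reach p δ.1.1 ∧ A.Reach δ.1.2.2 q := by
  intro p q h
  obtain ⟨ρ₁, ρ₂, rfl⟩ := List.append_of_mem hδ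
  obtain ⟨r, h₁, rfl, h₂⟩ := isRun_append.1 h
  exact ⟨h₁.reach, h₂.reach⟩

theorem IsRun.reach_of_not_crossing {ρ : List A.Δ} : ∀ {p q : A.State}, A.IsRun p ρ q →
    (∀ δ ∈ ρ, ¬ A.Crossing δ) → A.Reach q p := by
  induction ρ with
  | nil =>
    intro p q h _
    obtain rfl : p = q := h
    exact reach_refl p
  | cons δ ρ ih =>
    rintro p q ⟨rfl, h⟩ hc
    exact (ih h fun δ' hδ' => hc δ' (by simp [hδ'])).trans (not_not.1 (hc δ (by simp)))

theorem IsRun.not_crossing_of_reach {ρ : List A.Δ} {p q : A.State} (h : A.IsRun p ρ q)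
    (hq : A.Reach q p) : ∀ δ ∈ ρ, ¬ A.Crossing δ := by
  intro δ hδ
  have := h.reach_of_mem hδ
  exact not_not.2 ((this.2.trans hq).trans this.1)

theorem IsRun.pairwise_crossing {ρ : List A.Δ} : ∀ {p q : A.State}, A.IsRun p ρ q →
    ρ.Pairwise fun δ δ' => δ = δ' → ¬ A.Crossing δ := by
  induction ρ with
  | nil => simp
  | cons δ ρ ih =>
    rintro p q ⟨rfl, h⟩
    refine List.pairwise_cons.2 ⟨?_, ih h⟩
    rintro δ' hδ' rfl
    exact not_not.2 (h.reach_of_mem hδ').1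

theorem IsRun.eq_of_crossing {ρ : List A.Δ} {p q : A.State} (h : A.IsRun p ρ q) {i j : ℕ}
    (hi : i < ρ.length) (hj : j < ρ.length) (hij : ρ[i] = ρ[j]) (hc : A.Crossing ρ[i]) :
    i = j := by
  have hp := List.pairwise_iff_getElem.1 h.pairwise_crossing
  rcases lt_trichotomy i j with hlt | heq | hlt
  · exact absurd hc (hp i j hi hj hlt hij)
  · exact heq
  · exact absurd (hij ▸ hc) (hp j i hj hi hlt hij.symm)

theorem flatten_map_cond_injective {B : Type*} {x y : List B} (hne : x ≠ y)
    (hlen : x.length = y.length) : ∀ {l l' : List Bool}, l.length = l'.length →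
      (l.map fun b => cond b x y).flatten = (l'.map fun b => cond b x y).flatten → l = l' := by
  intro l
  induction l with
  | nil =>
    intro l' h _
    exact (List.length_eq_zero_iff.1 h.symm).symm
  | cons b l ih =>
    intro l' h he
    cases l' with
    | nil => simp at h
    | cons b' l' =>
      simp only [List.map_cons, List.flatten_cons] at he
      obtain ⟨h1, h2⟩ := List.append_inj he (by cases b <;> cases b' <;> simp [hlen])
      rw [ih (by simpa using h) h2]
      cases b <;> cases b' <;> simp_all

theorem PolynomiallyAmbiguous.loop_unique (hA : A.PolynomiallyAmbiguous) {p₀ q₀ p : A.State}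
    (hp₀ : p₀ ∈ A.init) (hq₀ : q₀ ∈ A.final) (h₁ : A.Reach p₀ p) (h₂ : A.Reach p q₀)
    {ρ ρ' : List A.Δ} (hρ : A.IsRun p ρ p) (hρ' : A.IsRun p ρ' p)
    (hl : A.label ρ = A.label ρ') : ρ = ρ' := by
  by_contra hne
  obtain ⟨x, hx⟩ := h₁
  obtain ⟨y, hy⟩ := h₂
  obtain ⟨P, hP⟩ := hA
  have hlen : ρ.length = ρ'.length := by simpa [label] using congrArg List.length hl
  obtain ⟨n, hn, hlt⟩ := P.exists_eval_lt_two_pow (x.length + y.length) ρ.length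
  set F : (Fin n → Bool) → List A.Δ := fun b =>
    x ++ ((List.ofFn b).map fun b => cond b ρ ρ').flatten ++ y
  have hF : Function.Injective F := by
    intro b b' h
    have := List.append_cancel_right h
    exact List.ofFn_injective
      (flatten_map_cond_injective hne hlen (by simp) (List.append_cancel_left this))
  set word := A.label x ++ wordPow (A.label ρ) n ++ A.label y
  have hloop : ∀ l : List Bool, A.IsRun p (l.map fun b => cond b ρ ρ').flatten p ∧
      A.label (l.map fun b => cond b ρ ρ').flatten = wordPow (A.label ρ) l.length := by
    intro l
    induction l with
    | nil => exact ⟨rfl, rfl⟩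
    | cons b l ih =>
      rw [List.map_cons, List.flatten_cons, label_append, ih.2, List.length_cons, wordPow_succ]
      cases b
      · exact ⟨isRun_append.2 ⟨p, hρ', ih.1⟩, by simp [hl]⟩
      · exact ⟨isRun_append.2 ⟨p, hρ, ih.1⟩, rfl⟩
  have hsub : Set.range F ⊆ A.successfulRuns word := by
    rintro _ ⟨b, rfl⟩
    refine ⟨p₀, hp₀, q₀, hq₀, ?_, ?_⟩
    · exact isRun_append.2 ⟨p, isRun_append.2 ⟨p, hx, (hloop _).1⟩, hy⟩
    · rw [label_append, label_append, (hloop _).2, List.length_ofFn]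
  have hlword : word.length = x.length + y.length + n * ρ.length := by
    simp only [word, List.length_append, length_wordPow, label, List.length_map]
    ring
  have hρ0 : 0 < ρ.length := by
    rw [List.length_pos_iff]
    rintro rfl
    exact hne (List.length_eq_zero_iff.1 hlen.symm).symm
  have hword : word ≠ [] := by
    rw [← List.length_pos_iff, hlword]
    positivity
  have h1 := (Set.encard_le_encard hsub).trans (hP word hword)
  have h2 : (Set.range F).encard = (2 ^ n : ℕ) := by
    rw [← Set.image_univ, hF.encard_image, Set.encard_univ]
    simp
  rw [h2, hlword] at h1
  exact absurd (by exact_mod_cast h1) (not_le.2 hlt)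

theorem PolynomiallyAmbiguous.component_unique (hA : A.PolynomiallyAmbiguous)
    {p₀ q₀ p q : A.State} (hp₀ : p₀ ∈ A.init) (hq₀ : q₀ ∈ A.final) (h₁ : A.Reach p₀ p)
    (h₂ : A.Reach q q₀) (hqp : A.Reach q p) {ρ ρ' : List A.Δ} (hρ : A.IsRun p ρ q)
    (hρ' : A.IsRun p ρ' q) (hl : A.label ρ = A.label ρ') : ρ = ρ' := by
  obtain ⟨γ, hγ⟩ := hqp
  have := hA.loop_unique hp₀ hq₀ h₁ (hρ.reach.trans h₂) (isRun_append.2 ⟨q, hρ, hγ⟩)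
    (isRun_append.2 ⟨q, hρ', hγ⟩) (by rw [label_append, label_append, hl])
  exact List.append_cancel_right this

theorem PolynomiallyAmbiguous.run_unique_append (hA : A.PolynomiallyAmbiguous) {p₀ q₀ : A.State}
    (hp₀ : p₀ ∈ A.init) (hq₀ : q₀ ∈ A.final) {ρ ρ' : List A.Δ}
    (h : List.Forall₂ (fun δ δ' => δ.1.2.1 = δ'.1.2.1 ∧
      (A.Crossing δ ∨ A.Crossing δ' → δ = δ')) ρ ρ') :
    ∀ {p r r' : A.State} {η η' : List A.Δ}, A.Reach p₀ p → A.IsRun p η r → A.IsRun p η' r' →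
      A.label η = A.label η' → (∀ δ ∈ η, ¬ A.Crossing δ) → (∀ δ ∈ η', ¬ A.Crossing δ) →
      A.IsRun r ρ q₀ → A.IsRun r' ρ' q₀ → η ++ ρ = η' ++ ρ' := by
  induction h with
  | nil =>
    intro p r r' η η' hp hη hη' hl hc _ hr hr'
    obtain rfl : r = q₀ := hr
    obtain rfl : r' = r := hr'
    rw [hA.component_unique hp₀ hq₀ hp (reach_refl _) (hη.reach_of_not_crossing hc) hη hη' hl]
  | @cons δ δ' ρ ρ' hδ _ ih =>
    intro p r r' η η' hp hη hη' hl hc hc' hr hr'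
    obtain ⟨rfl, hr⟩ := hr
    obtain ⟨rfl, hr'⟩ := hr'
    by_cases hcr : A.Crossing δ ∨ A.Crossing δ'
    · obtain rfl := hδ.2 hcr
      have h1 := hA.component_unique hp₀ hq₀ hp ((reach_transition δ).trans hr.reach)
        (hη.reach_of_not_crossing hc) hη hη' hl
      have h2 := ih (η := []) (η' := []) ((hp.trans hη.reach).trans (reach_transition δ)) rfl rfl
        rfl (by simp) (by simp) hr hr'
      rw [h1, show ρ = ρ' from h2]
    · push Not at hcr
      have := ih (η := η ++ [δ]) (η' := η' ++ [δ']) hp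
        (isRun_append.2 ⟨_, hη, rfl, rfl⟩) (isRun_append.2 ⟨_, hη', rfl, rfl⟩)
        (by rw [label_append, label_append, hl]; simp [label, hδ.1])
        (fun ε hε => (List.mem_append.1 hε).elim (hc ε) fun h => List.mem_singleton.1 h ▸ hcr.1)
        (fun ε hε => (List.mem_append.1 hε).elim (hc' ε) fun h => List.mem_singleton.1 h ▸ hcr.2)
        hr hr'
      simpa using this

/-- A run of a polynomially ambiguous automaton is determined by its label, its end points and
its crossing transitions. -/
theorem PolynomiallyAmbiguous.run_unique (hA : A.PolynomiallyAmbiguous) {p₀ q₀ : A.State}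
    (hp₀ : p₀ ∈ A.init) (hq₀ : q₀ ∈ A.final) {ρ ρ' : List A.Δ}
    (h : List.Forall₂ (fun δ δ' => δ.1.2.1 = δ'.1.2.1 ∧
      (A.Crossing δ ∨ A.Crossing δ' → δ = δ')) ρ ρ')
    (hρ : A.IsRun p₀ ρ q₀) (hρ' : A.IsRun p₀ ρ' q₀) : ρ = ρ' :=
  hA.run_unique_append hp₀ hq₀ h (η := []) (η' := []) (reach_refl p₀) rfl rfl rfl (by simp)
    (by simp) hρ hρ'

/-! ### Runs through prescribed transitions -/

section Compat

variable {V : Type} (d : V → A.Δ) (D : Set V)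

/-- The transition reads the letter, it is the one prescribed by each of the marks, and if it is
crossing, then it is prescribed by a mark in `D`. -/
def Compat (b : α × Set V) (δ : A.Δ) : Prop :=
  δ.1.2.1 = b.1 ∧ (∀ x ∈ b.2, d x = δ) ∧ (A.Crossing δ → ∃ x ∈ D, x ∈ b.2)

/-- The pairs of states between which there is a run compatible with the marked word. -/
def compatRel (y : List (α × Set V)) : Set (A.State × A.State) :=
  {s | ∃ ρ, A.IsRun s.1 ρ s.2 ∧ List.Forall₂ (Compat d D) y ρ}

variable {d D}

theorem mem_compatRel_append {p q : A.State} {y z : List (α × Set V)} :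
    (p, q) ∈ compatRel d D (y ++ z) ↔
      ∃ r, (p, r) ∈ compatRel d D y ∧ (r, q) ∈ compatRel d D z := by
  constructor
  · rintro ⟨ρ, hρ, h⟩
    have h1 := (List.forall₂_take_append _ _ _ h.flip).flip
    have h2 := (List.forall₂_drop_append _ _ _ h.flip).flip
    rw [← List.take_append_drop y.length ρ] at hρ
    obtain ⟨r, hr, hr'⟩ := isRun_append.1 hρ
    exact ⟨r, ⟨_, hr, h1⟩, ⟨_, hr', h2⟩⟩
  · rintro ⟨r, ⟨ρ, hρ, h⟩, ⟨ρ', hρ', h'⟩⟩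
    exact ⟨ρ ++ ρ', isRun_append.2 ⟨r, hρ, hρ'⟩, List.rel_append h h'⟩

theorem compatRel_append_congr {x x' y y' : List (α × Set V)}
    (h : compatRel d D x = compatRel d D x') (h' : compatRel d D y = compatRel d D y') :
    compatRel d D (x ++ y) = compatRel d D (x' ++ y') := by
  ext ⟨p, q⟩
  rw [mem_compatRel_append, mem_compatRel_append, h, h']

theorem compatRel_of_no_marks {y : List (α × Set V)} (hy : ∀ b ∈ y, b.2 = ∅) {p q : A.State} :
    (p, q) ∈ compatRel d D y ↔ A.Reach q p ∧ y.map Prod.fst ∈ A.lang p q := by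
  constructor
  · rintro ⟨ρ, hρ, h⟩
    have hc : ∀ δ ∈ ρ, ¬ A.Crossing δ := by
      intro δ hδ hcr
      obtain ⟨i, hi, rfl⟩ := List.getElem_of_mem hδ
      have hi' : i < y.length := h.length_eq ▸ hi
      obtain ⟨x, -, hx⟩ := (h.get hi' hi).2.2 hcr
      have h0 : (y.get ⟨i, hi'⟩).2 = ∅ := hy _ (List.get_mem _ _)
      rw [h0] at hx
      exact hx
    refine ⟨hρ.reach_of_not_crossing hc, ρ, hρ, ?_⟩
    clear hρ hc hy
    induction h with
    | nil => rfl
    | cons hb _ ih => simpa [label] using ⟨hb.1, ih⟩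
  · rintro ⟨hqp, ρ, hρ, hl⟩
    have hc := hρ.not_crossing_of_reach hqp
    refine ⟨ρ, hρ, ?_⟩
    clear hρ hqp
    induction y generalizing ρ with
    | nil =>
      obtain rfl := List.map_eq_nil_iff.1 hl
      exact .nil
    | cons b y ih =>
      cases ρ with
      | nil => simp [label] at hl
      | cons δ ρ =>
        simp only [label, List.map_cons, List.cons.injEq] at hl
        refine .cons ⟨hl.1, ?_, fun h => absurd h (hc δ (by simp))⟩
          (ih (fun b hb => hy b (by simp [hb])) ρ hl.2 fun δ hδ => hc δ (by simp [hδ]))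
        rw [hy b (by simp)]
        simp

theorem compatRel_rectangular {y : List (α × Set V)} {b : α × Set V} (hb : b ∈ y) {x : V}
    (hx : x ∈ b.2) {p q p' q' : A.State} (h : (p, q) ∈ compatRel d D y)
    (h' : (p', q') ∈ compatRel d D y) : (p, q') ∈ compatRel d D y := by
  obtain ⟨y₁, y₂, rfl⟩ := List.append_of_mem hb
  have key : ∀ {r s : A.State}, (r, s) ∈ compatRel d D (b :: y₂) →
      r = (d x).1.1 ∧ Compat d D b (d x) ∧ ((d x).1.2.2, s) ∈ compatRel d D y₂ := by
    rintro r s ⟨ρ, hρ, h⟩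
    cases h with
    | cons hδ h =>
      obtain rfl := hδ.2.1 x hx
      exact ⟨hρ.1.symm, hδ, _, hρ.2, h⟩
  obtain ⟨r, h1, h2⟩ := mem_compatRel_append.1 h
  obtain ⟨r', h1', h2'⟩ := mem_compatRel_append.1 h'
  obtain ⟨rfl, hc, -⟩ := key h2
  obtain ⟨-, -, ρ, hρ, h3⟩ := key h2'
  exact mem_compatRel_append.2 ⟨_, h1, d x :: ρ, ⟨rfl, hρ⟩, .cons hc h3⟩

theorem Aperiodic.compatRel (hA : A.Aperiodic) : AperiodicCongr (compatRel d D) where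
  append := compatRel_append_congr
  exists_pow := by
    rw [aperiodic_iff] at hA
    obtain ⟨N, hN⟩ := hA.exists_pow
    refine ⟨max N 2, fun y => ?_⟩
    by_cases hy : ∀ b ∈ y, b.2 = ∅
    · have hy' : ∀ n, ∀ b ∈ wordPow y n, b.2 = ∅ := by
        intro n b hb
        obtain ⟨z, hz, hbz⟩ := List.mem_flatten.1 hb
        rw [(List.mem_replicate.1 hz).2] at hbz
        exact hy b hbz
      ext ⟨p, q⟩
      rw [compatRel_of_no_marks (hy' _), compatRel_of_no_marks (hy' _), map_wordPow, map_wordPow]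
      exact and_congr_right fun _ =>
        Set.ext_iff.1 (hA.pow_of_le hN (le_max_left N 2) (y.map Prod.fst)) (p, q)
    · push Not at hy
      obtain ⟨b, hb, x, hx⟩ := hy
      refine apply_wordPow_of_le (fun h => compatRel_append_congr h rfl) ?_ (le_max_right N 2)
      ext ⟨p, q⟩
      simp only [wordPow_succ, wordPow_zero, List.append_nil, mem_compatRel_append]
      constructor
      · rintro ⟨r, h1, h2⟩
        exact ⟨r, h1, r, compatRel_rectangular hb hx h2 h1, h2⟩
      · rintro ⟨r, h1, s, h2, h3⟩
        exact ⟨r, h1, compatRel_rectangular hb hx h2 h3⟩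

theorem Aperiodic.rec_compatRel (hA : A.Aperiodic) (p q : A.State) :
    Rec fun w : PointedWord α V => (p, q) ∈ WAutomaton.compatRel d D w.mark :=
  Rec.of_aperiodicCongr hA.compatRel fun _ _ h => by rw [h]

theorem forall₂_compat_mark_iff {w : PointedWord α V} {ρ : List A.Δ} :
    List.Forall₂ (Compat d D) w.mark ρ ↔ A.label ρ = w.word ∧
      ∀ (i : Fin w.word.length) (hi : i < ρ.length), (∀ x, w.val x = i → d x = ρ[(i : ℕ)]) ∧
        (A.Crossing ρ[(i : ℕ)] → ∃ x ∈ D, w.val x = i) := by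
  rw [List.forall₂_iff_get]
  constructor
  · rintro ⟨hlen, h⟩
    rw [length_mark] at hlen
    refine ⟨List.ext_getElem (by simp [label, hlen]) fun i hi hi' => ?_, fun i hi => ?_⟩
    · have := (h i (by rw [length_mark]; exact hi') (by simpa [label] using hi)).1
      simpa [label, getElem_mark] using this
    · have := (h i (by rw [length_mark]; exact i.2) hi).2
      simpa [getElem_mark] using this
  · rintro ⟨hl, h⟩
    have hlen : w.word.length = ρ.length := by simp [← hl, label]
    refine ⟨w.length_mark.trans hlen, fun i hi hi' => ⟨?_, ?_⟩⟩
    · simp only [List.get_eq_getElem, getElem_mark]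
      simp [← hl, label]
    · have := h ⟨i, hlen ▸ hi'⟩ hi'
      simpa [getElem_mark] using this

theorem PolynomiallyAmbiguous.compat_unique (hA : A.PolynomiallyAmbiguous) {p₀ q₀ : A.State}
    (hp₀ : p₀ ∈ A.init) (hq₀ : q₀ ∈ A.final) {y : List (α × Set V)} {ρ ρ' : List A.Δ}
    (hρ : A.IsRun p₀ ρ q₀) (hρ' : A.IsRun p₀ ρ' q₀) (h : List.Forall₂ (Compat d D) y ρ)
    (h' : List.Forall₂ (Compat d D) y ρ') : ρ = ρ' := by
  refine hA.run_unique hp₀ hq₀ ?_ hρ hρ'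
  clear hρ hρ'
  induction h generalizing ρ' with
  | nil => cases h'; exact .nil
  | @cons b δ y ρ hb _ ih =>
    cases h' with
    | @cons _ δ' _ ρ' hb' h' =>
      refine .cons ⟨hb.1.trans hb'.1.symm, ?_⟩ (ih h')
      rintro (hc | hc)
      · obtain ⟨x, -, hx⟩ := hb.2.2 hc
        exact (hb.2.1 x hx).symm.trans (hb'.2.1 x hx)
      · obtain ⟨x, -, hx⟩ := hb'.2.2 hc
        exact (hb.2.1 x hx).symm.trans (hb'.2.1 x hx)

end Compat

/-! ### Aperiodic polynomially ambiguous automata define recognizable series -/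

open Classical in
/-- The weight of the transition at the position `none` of the run compatible with the other
marks. -/
noncomputable def compatWeight (A : WAutomaton α R) [Nonempty R] (p q : A.State) {V : Type}
    (d : V → A.Δ) (w : PointedWord α (Option V)) : R :=
  if h : ∃ δ : A.Δ, (p, q) ∈ compatRel (fun o => o.elim δ d) (Set.range some) w.mark then
    A.wgt h.choose else Classical.arbitrary R

theorem Aperiodic.rec_compatWeight [Finite α] [Nonempty R] (hA : A.Aperiodic) (p q : A.State)
    {V : Type} (d : V → A.Δ) : Rec (A.compatWeight p q d) := by
  classical
  exact (Rec.pi fun δ : A.Δ => hA.rec_compatRel (d := fun o => o.elim δ d)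
    (D := Set.range some) p q).comp fun S : A.Δ → Prop =>
      if h : ∃ δ, S δ then A.wgt h.choose else Classical.arbitrary R

theorem forall₂_compat_extend_iff {V : Type} {d : V → A.Δ} {δ : A.Δ} {w : PointedWord α V}
    {i : Fin w.word.length} {ρ : List A.Δ} :
    List.Forall₂ (Compat (fun o : Option V => o.elim δ d) (Set.range some)) (w.extend i).mark ρ ↔
      List.Forall₂ (Compat d Set.univ) w.mark ρ ∧ ∀ hi : i < ρ.length, ρ[(i : ℕ)] = δ := by
  rw [forall₂_compat_mark_iff, forall₂_compat_mark_iff]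
  constructor
  · rintro ⟨hl, h⟩
    refine ⟨⟨hl, fun j hj => ⟨fun x hx => (h j hj).1 (some x) hx, fun hc => ?_⟩⟩,
      fun hi => ((h i hi).1 none rfl).symm⟩
    obtain ⟨_, ⟨x, rfl⟩, hx⟩ := (h j hj).2 hc
    exact ⟨x, trivial, hx⟩
  · rintro ⟨⟨hl, h⟩, h'⟩
    refine ⟨hl, fun j hj => ⟨?_, fun hc => ?_⟩⟩
    · rintro (_ | x) hx
      · obtain rfl : i = j := hx
        exact (h' hj).symm
      · exact (h j hj).1 x hx
    · obtain ⟨x, -, hx⟩ := (h j hj).2 hc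
      exact ⟨some x, ⟨x, rfl⟩, hx⟩

theorem PolynomiallyAmbiguous.compatWeight_eq [Nonempty R] (hA : A.PolynomiallyAmbiguous)
    {p₀ q₀ : A.State} (hp₀ : p₀ ∈ A.init) (hq₀ : q₀ ∈ A.final) {V : Type} {d : V → A.Δ}
    {w : PointedWord α V} {ρ : List A.Δ} (hρ : A.IsRun p₀ ρ q₀)
    (h : List.Forall₂ (Compat d Set.univ) w.mark ρ) (i : Fin w.word.length) (hi : i < ρ.length) :
    A.compatWeight p₀ q₀ d (w.extend i) = A.wgt ρ[(i : ℕ)] := by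
  have hex : ∃ δ : A.Δ, (p₀, q₀) ∈ compatRel (fun o : Option V => o.elim δ d) (Set.range some)
      (w.extend i).mark :=
    ⟨ρ[(i : ℕ)], ρ, hρ, forall₂_compat_extend_iff.2 ⟨h, fun _ => rfl⟩⟩
  rw [compatWeight, dif_pos hex]
  obtain ⟨ρ', hρ', h'⟩ := hex.choose_spec
  obtain ⟨h1, h2⟩ := forall₂_compat_extend_iff.1 h'
  obtain rfl := hA.compat_unique hp₀ hq₀ hρ hρ' h h1
  rw [h2 hi]

open Classical in
theorem PolynomiallyAmbiguous.sum_fiber [Finite α] [Nonempty R] (hA : A.PolynomiallyAmbiguous)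
    {p₀ q₀ : A.State} (hp₀ : p₀ ∈ A.init) (hq₀ : q₀ ∈ A.final) (x : {x : List α // x ≠ []})
    {k : ℕ} (d : Fin k → A.Δ) (hc : ∀ j, A.Crossing (d j)) :
    ∑ ρ ∈ (A.finite_runs p₀ q₀ x.1).toFinset with
        ∀ δ, (δ ∈ ρ ∧ A.Crossing δ) ↔ δ ∈ Set.range d, ({A.weight ρ} : Multiset (List R)) =
      ∑ τ : Fin k → Fin x.1.length, condProd (fun w => (p₀, q₀) ∈ compatRel d Set.univ w.mark)
        (A.compatWeight p₀ q₀ d) ⟨x.1, x.2, τ⟩ := by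
  have hrun : ∀ τ : Fin k → Fin x.1.length, ∃ ρ,
      (p₀, q₀) ∈ compatRel d Set.univ (⟨x.1, x.2, τ⟩ : PointedWord α (Fin k)).mark →
      A.IsRun p₀ ρ q₀ ∧
        List.Forall₂ (Compat d Set.univ) (⟨x.1, x.2, τ⟩ : PointedWord α (Fin k)).mark ρ := by
    intro τ
    by_cases h : (p₀, q₀) ∈ compatRel d Set.univ (⟨x.1, x.2, τ⟩ : PointedWord α (Fin k)).mark
    · obtain ⟨ρ, h1, h2⟩ := h
      exact ⟨ρ, fun _ => ⟨h1, h2⟩⟩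
    · exact ⟨[], fun h' => absurd h' h⟩
  choose E hE using hrun
  simp only [condProd]
  rw [← Finset.sum_filter]
  symm
  have hlen : ∀ {ρ : List A.Δ}, A.label ρ = x.1 → ρ.length = x.1.length := fun h => by
    rw [← h]; simp [label]
  refine Finset.sum_bij (fun τ _ => E τ) (fun τ hτ => ?_) (fun τ hτ τ' hτ' h => ?_)
    (fun ρ hρ => ?_) (fun τ hτ => ?_)
  · obtain ⟨h1, h2⟩ := hE τ (Finset.mem_filter.1 hτ).2
    obtain ⟨h3, h4⟩ := forall₂_compat_mark_iff.1 h2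
    refine Finset.mem_filter.2 ⟨(Set.Finite.mem_toFinset _).2 ⟨h1, h3⟩, fun δ => ⟨?_, ?_⟩⟩
    · rintro ⟨hδ, hcr⟩
      obtain ⟨i, hi, rfl⟩ := List.getElem_of_mem hδ
      have := h4 ⟨i, hlen h3 ▸ hi⟩ hi
      obtain ⟨j, -, hj⟩ := this.2 hcr
      exact ⟨j, this.1 j hj⟩
    · rintro ⟨j, rfl⟩
      have hi : (τ j : ℕ) < (E τ).length := (τ j).2.trans_eq (hlen h3).symm
      rw [(h4 (τ j) hi).1 j rfl]
      exact ⟨List.getElem_mem hi, (h4 (τ j) hi).1 j rfl ▸ hc j⟩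
  · obtain ⟨h1, h2⟩ := hE τ (Finset.mem_filter.1 hτ).2
    obtain ⟨h3, h4⟩ := forall₂_compat_mark_iff.1 h2
    obtain ⟨h1', h2'⟩ := hE τ' (Finset.mem_filter.1 hτ').2
    have h : E τ = E τ' := h
    rw [← h] at h2'
    obtain ⟨h3', h4'⟩ := forall₂_compat_mark_iff.1 h2'
    funext j
    have hi : (τ j : ℕ) < (E τ).length := (τ j).2.trans_eq (hlen h3).symm
    have hi' : (τ' j : ℕ) < (E τ).length := (τ' j).2.trans_eq (hlen h3).symm
    have e1 := (h4 (τ j) hi).1 j rfl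
    have e2 := (h4' (τ' j) hi').1 j rfl
    exact Fin.ext (h1.eq_of_crossing hi hi' (e1.symm.trans e2) (e1 ▸ hc j))
  · obtain ⟨hρ, hcr⟩ := Finset.mem_filter.1 hρ
    obtain ⟨h1, h3⟩ := (Set.Finite.mem_toFinset _).1 hρ
    have hpos : ∀ j : Fin k, ∃ i : Fin x.1.length,
        ρ[(i : ℕ)]'(i.2.trans_eq (hlen h3).symm) = d j := by
      intro j
      obtain ⟨i, hi, he⟩ := List.getElem_of_mem ((hcr (d j)).2 ⟨j, rfl⟩).1
      exact ⟨⟨i, hlen h3 ▸ hi⟩, he⟩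
    choose τ hτ using hpos
    have h2 : List.Forall₂ (Compat d Set.univ) (⟨x.1, x.2, τ⟩ : PointedWord α (Fin k)).mark ρ := by
      refine forall₂_compat_mark_iff.2 ⟨h3, fun i hi => ⟨?_, fun hci => ?_⟩⟩
      · rintro j rfl
        exact (hτ j).symm
      · obtain ⟨j, hj⟩ := (hcr _).1 ⟨List.getElem_mem hi, hci⟩
        refine ⟨j, trivial, Fin.ext ?_⟩
        exact (h1.eq_of_crossing hi ((τ j).2.trans_eq (hlen h3).symm)
          (hj.symm.trans (hτ j).symm) hci).symm
    have hmem : (p₀, q₀) ∈ compatRel d Set.univ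
        (⟨x.1, x.2, τ⟩ : PointedWord α (Fin k)).mark := ⟨ρ, h1, h2⟩
    refine ⟨τ, Finset.mem_filter.2 ⟨Finset.mem_univ _, hmem⟩, ?_⟩
    exact hA.compat_unique hp₀ hq₀ (hE τ hmem).1 h1 (hE τ hmem).2 h2
  · obtain ⟨h1, h2⟩ := hE τ (Finset.mem_filter.1 hτ).2
    have h3 := (forall₂_compat_mark_iff.1 h2).1
    refine congrArg (fun l => ({l} : Multiset (List R))) (List.ext_getElem ?_ fun i hi hi' => ?_)
    · simp [weight, hlen h3]
    · have hiE : i < (E τ).length := by simpa [weight] using hi'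
      have := hA.compatWeight_eq hp₀ hq₀ h1 h2 ⟨i, hlen h3 ▸ hiE⟩ hiE
      simp only [List.getElem_ofFn, weight, List.getElem_map, ← this]

theorem PolynomiallyAmbiguous.exists_recSeries [Finite α] (hA : A.PolynomiallyAmbiguous)
    (hap : A.Aperiodic) : ∃ G ∈ RecSeries α R Empty, ∀ x, A.usem x = G (pureWord x) := by
  classical
  by_cases hR : Nonempty R
  swap
  · refine ⟨0, (RecSeries α R Empty).zero_mem, fun x => ?_⟩
    rw [usem_eq_sum]
    refine Finset.sum_eq_zero fun ρ hρ => ?_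
    obtain ⟨_, _, _, _, _, hl⟩ := (Set.Finite.mem_toFinset _).1 hρ
    cases ρ with
    | nil => exact absurd hl.symm x.2
    | cons δ ρ => exact absurd ⟨A.wgt δ⟩ hR
  let Cr : Finset A.Δ := (Set.toFinite {δ | A.Crossing δ}).toFinset
  let d : ∀ D : Finset A.Δ, Fin D.card → A.Δ := fun D j => (D.equivFin.symm j).1
  have hdrange : ∀ D δ, δ ∈ Set.range (d D) ↔ δ ∈ D := fun D δ =>
    ⟨fun ⟨j, hj⟩ => hj ▸ (D.equivFin.symm j).2, fun h => ⟨D.equivFin ⟨δ, h⟩, by simp [d]⟩⟩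
  have hCr : ∀ {δ}, δ ∈ Cr ↔ A.Crossing δ := by simp [Cr]
  refine ⟨∑ p ∈ A.init.toFinite.toFinset, ∑ q ∈ A.final.toFinite.toFinset, ∑ D ∈ Cr.powerset,
    sumProd D.card (fun w => (p, q) ∈ compatRel (d D) Set.univ (w.subst Sum.inr).mark)
      (fun w => A.compatWeight p q (d D) (w.subst (Option.map Sum.inr))), ?_, fun x => ?_⟩
  · exact sum_mem fun p _ => sum_mem fun q _ => sum_mem fun D _ =>
      sumProd_mem ((hap.rec_compatRel p q).subst Sum.inr) ((hap.rec_compatWeight p q _).subst _)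
  · simp only [Finset.sum_apply]
    refine Finset.sum_congr rfl fun p hp => Finset.sum_congr rfl fun q hq => ?_
    rw [Set.Finite.mem_toFinset] at hp hq
    rw [usemFrom_eq_sum, ← Finset.sum_fiberwise_of_maps_to (t := Cr.powerset)
      (g := fun ρ => ρ.toFinset.filter A.Crossing)]
    · refine Finset.sum_congr rfl fun D hD => ?_
      have hDc : ∀ j, A.Crossing (d D j) := fun j =>
        hCr.1 (Finset.mem_powerset.1 hD ((hdrange D _).1 ⟨j, rfl⟩))
      have hfib := hA.sum_fiber hp hq x (d D) hDc
      refine Eq.trans (Finset.sum_congr (Finset.filter_congr fun ρ _ => ?_) fun _ _ => rfl)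
        (hfib.trans (Finset.sum_congr rfl fun τ _ => ?_))
      · rw [Finset.ext_iff]
        exact forall_congr' fun δ => by rw [hdrange]; simp
      · refine condProd_congr _ _ Iff.rfl fun z => congrArg _ (ext_val _ _ fun o => ?_)
        cases o <;> rfl
    · intro ρ _
      rw [Finset.mem_powerset]
      intro δ hδ
      exact hCr.2 (Finset.mem_filter.1 hδ).2

end WAutomaton

/-! ### The number of values of a formula -/

namespace WFO

variable {α : Type u} {R : Type v}

theorem exists_card_sem_le_eval (Φ : WFO α R) :
    ∃ P : Polynomial ℕ, ∀ (x : List α) (σ : ℕ → Fin x.length),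
      (Φ.sem x σ).card ≤ P.eval x.length := by
  induction Φ with
  | zero => exact ⟨0, fun x σ => by simp [sem]⟩
  | prod y Ψ => exact ⟨1, fun x σ => by simp [sem]⟩
  | ite φ Φ₁ Φ₂ ih₁ ih₂ =>
    obtain ⟨P₁, h₁⟩ := ih₁
    obtain ⟨P₂, h₂⟩ := ih₂
    refine ⟨P₁ + P₂, fun x σ => ?_⟩
    have := h₁ x σ
    have := h₂ x σ
    rw [sem, Polynomial.eval_add]
    split_ifs <;> lia
  | add Φ₁ Φ₂ ih₁ ih₂ =>
    obtain ⟨P₁, h₁⟩ := ih₁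
    obtain ⟨P₂, h₂⟩ := ih₂
    refine ⟨P₁ + P₂, fun x σ => ?_⟩
    rw [sem, Multiset.card_add, Polynomial.eval_add]
    exact Nat.add_le_add (h₁ x σ) (h₂ x σ)
  | sum y Φ ih =>
    obtain ⟨P, h⟩ := ih
    refine ⟨Polynomial.X * P, fun x σ => ?_⟩
    rw [sem, Multiset.card_sum, Polynomial.eval_mul, Polynomial.eval_X]
    exact (Finset.sum_le_card_nsmul _ _ _ fun i _ => h x _).trans (by simp)

theorem exists_card_sem_le (Φ : WFO α R) (hΦ : Φ.NoFirstOrderSum) :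
    ∃ k : ℕ, ∀ (x : List α) (σ : ℕ → Fin x.length), (Φ.sem x σ).card ≤ k := by
  induction Φ with
  | zero => exact ⟨0, fun x σ => by simp [sem]⟩
  | prod y Ψ => exact ⟨1, fun x σ => by simp [sem]⟩
  | ite φ Φ₁ Φ₂ ih₁ ih₂ =>
    obtain ⟨k₁, h₁⟩ := ih₁ hΦ.1
    obtain ⟨k₂, h₂⟩ := ih₂ hΦ.2
    refine ⟨k₁ + k₂, fun x σ => ?_⟩
    have := h₁ x σ
    have := h₂ x σ
    rw [sem]
    split_ifs <;> lia
  | add Φ₁ Φ₂ ih₁ ih₂ =>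
    obtain ⟨k₁, h₁⟩ := ih₁ hΦ.1
    obtain ⟨k₂, h₂⟩ := ih₂ hΦ.2
    refine ⟨k₁ + k₂, fun x σ => ?_⟩
    rw [sem, Multiset.card_add]
    exact Nat.add_le_add (h₁ x σ) (h₂ x σ)
  | sum y Φ _ => exact hΦ.elim

theorem card_sem_le_one (Φ : WFO α R) (h : Φ.NoBinarySum) (h' : Φ.NoFirstOrderSum) (x : List α)
    (σ : ℕ → Fin x.length) : (Φ.sem x σ).card ≤ 1 := by
  induction Φ with
  | zero => simp [sem]
  | prod y Ψ => simp [sem]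
  | ite φ Φ₁ Φ₂ ih₁ ih₂ =>
    rw [sem]
    split_ifs
    · exact ih₁ h.1 h'.1
    · exact ih₂ h.2 h'.2
  | add Φ₁ Φ₂ _ _ => exact h.elim
  | sum y Φ _ => exact h'.elim

theorem exists_aperiodic [Finite α] (Φ : WFO α R) :
    ∃ A : WAutomaton α R, A.Aperiodic ∧ A.usem = Φ.usem := by
  obtain ⟨G, hG, h⟩ := Φ.exists_recSeries
  obtain ⟨A, hA, h'⟩ := RecSeries.exists_aperiodic hG
  exact ⟨A, hA, funext fun x => (h' x).trans (h x).symm⟩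

end WFO

namespace WAutomaton

variable {α : Type u} {R : Type v} {A : WAutomaton α R}

theorem encard_successfulRuns_le_iff [Finite α] {x : List α} (hx : x ≠ []) {n : ℕ} :
    (A.successfulRuns x).encard ≤ n ↔ (A.usem ⟨x, hx⟩).card ≤ n := by
  rw [← A.card_usem ⟨x, hx⟩, Nat.cast_le]

theorem FinitelyAmbiguous.polynomiallyAmbiguous (h : A.FinitelyAmbiguous) :
    A.PolynomiallyAmbiguous := by
  obtain ⟨k, hk⟩ := h
  exact ⟨Polynomial.C k, fun w hw => by simpa using hk w hw⟩

theorem Unambiguous.finitelyAmbiguous (h : A.Unambiguous) : A.FinitelyAmbiguous :=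
  ⟨1, fun w hw => by simpa using h w hw⟩

end WAutomaton

theorem PointedWord.eq_pureWord {α : Type u} (p : PointedWord α Empty) :
    p = pureWord ⟨p.word, p.ne⟩ :=
  ext_val _ _ fun x => x.elim

theorem theorem1 {α : Type*} [Finite α] {R : Type*} :
    ({f : {u : List α // u ≠ []} → Multiset (List R) |
        ∃ A : WAutomaton α R, A.Aperiodic ∧ A.PolynomiallyAmbiguous ∧ A.usem = f} =
      {f | ∃ Φ : WFO α R, Φ.IsSentence ∧ Φ.usem = f}) ∧
    ({f : {u : List α // u ≠ []} → Multiset (List R) |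
        ∃ A : WAutomaton α R, A.Aperiodic ∧ A.FinitelyAmbiguous ∧ A.usem = f} =
      {f | ∃ Φ : WFO α R, Φ.IsSentence ∧ Φ.NoFirstOrderSum ∧ Φ.usem = f}) ∧
    ({f : {u : List α // u ≠ []} → Multiset (List R) |
        ∃ A : WAutomaton α R, A.Aperiodic ∧ A.Unambiguous ∧ A.usem = f} =
      {f | ∃ Φ : WFO α R,
        Φ.IsSentence ∧ Φ.NoBinarySum ∧ Φ.NoFirstOrderSum ∧ Φ.usem = f}) := by
  refine ⟨Set.ext fun f => ⟨?_, ?_⟩, Set.ext fun f => ⟨?_, ?_⟩, Set.ext fun f => ⟨?_, ?_⟩⟩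
  · rintro ⟨A, hap, hA, rfl⟩
    obtain ⟨G, hG, h⟩ := hA.exists_recSeries hap
    obtain ⟨Φ, hΦ, -, hsem⟩ := (RecSeries.wfoDef hG).exists_sentence
    exact ⟨Φ, hΦ, hsem.trans (funext h).symm⟩
  · rintro ⟨Φ, -, rfl⟩
    obtain ⟨A, hA, h⟩ := Φ.exists_aperiodic
    obtain ⟨P, hP⟩ := Φ.exists_card_sem_le_eval
    refine ⟨A, hA, ⟨P, fun w hw => ?_⟩, h⟩
    rw [WAutomaton.encard_successfulRuns_le_iff hw, h]
    exact hP _ _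
  · rintro ⟨A, hap, ⟨k, hk⟩, rfl⟩
    obtain ⟨G, hG, h⟩ :=
      (WAutomaton.FinitelyAmbiguous.polynomiallyAmbiguous ⟨k, hk⟩).exists_recSeries hap
    have hcard : ∀ p, (G p).card ≤ k := fun p => by
      rw [p.eq_pureWord, ← h]
      exact (WAutomaton.encard_successfulRuns_le_iff p.ne).1 (hk _ p.ne)
    obtain ⟨Φ, hΦ, hC, hsem⟩ :=
      (RecStepSeries.wfoDef (RecSeries.mem_step_of_card_le hG hcard)).exists_sentence
    exact ⟨Φ, hΦ, hC, hsem.trans (funext h).symm⟩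
  · rintro ⟨Φ, -, hC, rfl⟩
    obtain ⟨A, hA, h⟩ := Φ.exists_aperiodic
    obtain ⟨k, hk⟩ := Φ.exists_card_sem_le hC
    refine ⟨A, hA, ⟨k, fun w hw => ?_⟩, h⟩
    rw [WAutomaton.encard_successfulRuns_le_iff hw, h]
    exact hk _ _
  · rintro ⟨A, hap, hA, rfl⟩
    obtain ⟨G, hG, h⟩ := hA.finitelyAmbiguous.polynomiallyAmbiguous.exists_recSeries hap
    have hcard : ∀ p, (G p).card ≤ 1 := fun p => by
      rw [p.eq_pureWord, ← h]
      exact (WAutomaton.encard_successfulRuns_le_iff p.ne).1 (by simpa using hA _ p.ne)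
    obtain ⟨Φ, hΦ, hC, hsem⟩ := (RecStepSeries.wfoDef_of_card_le_one
      (RecSeries.mem_step_of_card_le hG hcard) hcard).exists_sentence
    exact ⟨Φ, hΦ, hC.1, hC.2, hsem.trans (funext h).symm⟩
  · rintro ⟨Φ, -, hC, hC', rfl⟩
    obtain ⟨A, hA, h⟩ := Φ.exists_aperiodic
    refine ⟨A, hA, fun w hw => ?_, h⟩
    have := (WAutomaton.encard_successfulRuns_le_iff (A := A) hw (n := 1)).2
      (by rw [h]; exact Φ.card_sem_le_one hC hC' _ _)
    simpa using this
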